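/- **Notation.** Write $e\,\|\,m$ if $e\mid m$ and $\gcd(e,m/e)=1$, and put $a*b=ab/\gcd(a,b)^2$. For integers $n\ge 1$, $h\mid\gcd(n,24)$ and $e\,\|\,n/h$, let $w_e$ be the set of matrices $\begin{pmatrix}ae&b/h\\cn&de\end{pmatrix}$ with $a,b,c,d\in\mathbb Z$ and determinant $e$, regarded up to nonzero scalars. For a set $E=\{1,e_1,e_2,\dots\}$ of exact divisors of $n/h$ that is a group under $*$, the group $\Gamma=\Gamma_0(n|h){+}e_1,e_2,\dots$ generated by the $w_e$, $e\in E$, is called an $n|h$-type group; $w_e\in\Gamma$ means $e\in E$. For $d\geq1$ let $\Gamma^d=\Gamma_0(n'|h'){+}e_1',e_2',\dots$ with $n'=n/\gcd(n,d)$, $h'=h/\gcd(h,d)$ and $e_1',e_2',\dots$ the divisors of $n'/h'$ among $e_1,e_2,\dots$; and for $e\,\|\,n/h$ let $\langle\Gamma,w_e\rangle=\Gamma_0(n|h){+}e_1,e_2,\dots,e_1*e,e_2*e,\dots$ (including $1*e=e$). Put $N=nh$. The Conway–Norton rule asks for a homomorphism $\lambda:\Gamma\to\boldsymbol\mu_h$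 that is $1$ on $\Gamma_0(N)$ and on every matrix $W_e=\begin{pmatrix}ae&b\\cN&de\end{pmatrix}\in\Gamma$ of determinant $e$ with $a,b,c,d\in\mathbb Z$, $e\,\|\,N$ and every prime divisor of $e$ dividing $n/h$, with $\lambda\begin{pmatrix}1&1/h\\0&1\end{pmatrix}=e^{-2\pi i/h}$ and $\lambda\begin{pmatrix}1&0\\n&1\end{pmatrix}=e^{\pm2\pi i/h}$, the sign being $+$ if and only if $\tau\mapsto-1/(N\tau)$ lies in $\Gamma$. If such a $\lambda$ exists, it is unique; put $\Gamma_\lambda=\ker\lambda$, and let $\mathcal T_\Gamma$ denote the normalized Hauptmodul of $\Gamma_\lambda$: the holomorphic $\Gamma_\lambda$-invariant function on the upper half-plane that is bounded at all cusps not $\Gamma_\lambda$-equivalent to $\infty$ and satisfies $\mathcal T_\Gamma=q^{-1}+O(q)$ at $\infty$, $q=e^{2\pi i\tau}$. We say that $\Gamma$ appears in monstrous moonshine if it is one of the $171$ groups $\Gamma_0(n|h){+}e_1,e_2,\dots$ that Conway and Norton attached to the conjugacy classes of the monster; for these groups $\mathcal T_\Gamma$ exists and is the corresponding McKay–Thompson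 series. Finally let $(f|U_p)(\tau)=\frac1p\sum_{\mu=0}^{p-1}f\left(\frac{\tau+\mu}{p}\right)$, so that $\left(\sum a(m)q^m\right)|U_p=\sum a(pm)q^m$. **Proposition.** Let $p$ be a prime, let $n,h\ge1$ and $r\geq0$ be integers with $p\nmid nh$, and let $\Gamma$ be a $p^rn|h$-type group. Then each of the following holds whenever all the groups that occur in it appear in monstrous moonshine: (a) $p\,\mathcal T_\Gamma|U_p=\mathcal T_\Gamma-\mathcal T_{\langle\Gamma,w_p\rangle}$, if $r=1$ and $p\nmid e$ for all $w_e\in\Gamma$; (b) $p^2\,\mathcal T_\Gamma|U_p^2=\mathcal T_\Gamma-\mathcal T_{\Gamma^p}$, if $r=1$ and $p\nmid e$ for all $w_e\in\Gamma$; (c) $p\,\mathcal T_\Gamma|U_p=\mathcal T_{\langle\Gamma^p,w_{p^{r-1}}\rangle}-\mathcal T_{\Gamma^p}$, if $r>1$ and $w_{p^r}\in\Gamma$; (d) $\mathcal T_\Gamma|U_p=-\mathcal T_{\Gamma^p}|U_p$, if $r=2$ and $w_{p^2}\in\Gamma$. -/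

import Mathlib

namespace Moonshine

open UpperHalfPlane Matrix
open scoped MatrixGroups Manifold

noncomputable section

/-- `e ∥ m`: `e` is an exact divisor of `m`. -/
def ExactDvd (e m : ℕ) : Prop := e ∣ m ∧ Nat.Coprime e (m / e)

/-- The operation `a * b / gcd(a, b)²` on exact divisors. -/
def star (a b : ℕ) : ℕ := a * b / Nat.gcd a b ^ 2

/-- The symbol `n|h + e₁, e₂, …`; the finite set `E` is `{1, e₁, e₂, …}`. -/
@[ext]
structure NHSymbol where
  n : ℕ
  h : ℕ
  E : Finset ℕ
deriving DecidableEq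

/-- The real invertible matrix `g` equals `M` up to a nonzero scalar, i.e. both define the same
fractional linear transformation. -/
def Represents (g : GL (Fin 2) ℝ) (M : Matrix (Fin 2) (Fin 2) ℝ) : Prop :=
  ∃ r : ℝ, r ≠ 0 ∧ (g : Matrix (Fin 2) (Fin 2) ℝ) = r • M

/-- The set `w_e` for `n|h`: matrices `(ae, b/h; cn, de)` of determinant `e` with integers
`a, b, c, d`, up to nonzero scalars. With `h = 1` these are the Atkin–Lehner matrices `W_e` of
level `n`, and with `e = h = 1` this is `Γ₀(n)`. -/
def w (n h e : ℕ) : Set (GL (Fin 2) ℝ) :=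
  {g | ∃ a b c d : ℤ,
    (!![(a : ℝ) * e, (b : ℝ) / h; (c : ℝ) * n, (d : ℝ) * e]).det = e ∧
    Represents g !![(a : ℝ) * e, (b : ℝ) / h; (c : ℝ) * n, (d : ℝ) * e]}

namespace NHSymbol

/-- The symbol denotes an `n|h`-type group: `n ≥ 1`, `h ∣ gcd(n, 24)` and `E` is a subgroup of the
group of exact divisors of `n / h`. -/
structure IsNHType (Γ : NHSymbol) : Prop where
  n_pos : 0 < Γ.n
  h_dvd : Γ.h ∣ Nat.gcd Γ.n 24
  one_mem : 1 ∈ Γ.E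
  exact : ∀ e ∈ Γ.E, ExactDvd e (Γ.n / Γ.h)
  star_mem : ∀ e ∈ Γ.E, ∀ f ∈ Γ.E, star e f ∈ Γ.E

/-- The group `Γ₀(n|h) + e₁, e₂, …` generated by the sets `w_e`, `e ∈ E`, as a subgroup of
`GL₂(ℝ)` containing all nonzero scalars. -/
def group (Γ : NHSymbol) : Subgroup (GL (Fin 2) ℝ) :=
  Subgroup.closure (⋃ e ∈ Γ.E, w Γ.n Γ.h e)

/-- The group `Γ^d = Γ₀(n'|h') + e₁', e₂', …` with `n' = n / gcd(n, d)`, `h' = h / gcd(h, d)` and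
`e₁', e₂', …` the divisors of `n' / h'` among `e₁, e₂, …`. -/
def power (Γ : NHSymbol) (d : ℕ) : NHSymbol where
  n := Γ.n / Nat.gcd Γ.n d
  h := Γ.h / Nat.gcd Γ.h d
  E := Γ.E.filter fun e => e ∣ (Γ.n / Nat.gcd Γ.n d) / (Γ.h / Nat.gcd Γ.h d)

/-- The group `⟨Γ, w_e⟩ = Γ₀(n|h) + e₁, e₂, …, e₁ * e, e₂ * e, …`. -/
def adjoin (Γ : NHSymbol) (e : ℕ) : NHSymbol where
  n := Γ.n
  h := Γ.h
  E := Γ.E ∪ Γ.E.image fun f => star f e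

/-- The Fricke involution `τ ↦ -1 / (Nτ)`, `N = nh`, belongs to `Γ`. -/
def HasFricke (Γ : NHSymbol) : Prop :=
  ∃ g ∈ Γ.group, Represents g !![0, -1; ((Γ.n * Γ.h : ℕ) : ℝ), 0]

/-- The Conway–Norton rule for the eigenvalue map `λ : Γ → μ_h`. -/
structure IsConwayNortonMap (Γ : NHSymbol) (lam : Γ.group →* rootsOfUnity Γ.h ℂ) : Prop where
  gamma0 : ∀ g : Γ.group, (g : GL (Fin 2) ℝ) ∈ w (Γ.n * Γ.h) 1 1 → lam g = 1
  atkinLehner : ∀ e : ℕ, ExactDvd e (Γ.n * Γ.h) → (∀ q : ℕ, q.Prime → q ∣ e → q ∣ Γ.n / Γ.h) →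
    ∀ g : Γ.group, (g : GL (Fin 2) ℝ) ∈ w (Γ.n * Γ.h) 1 e → lam g = 1
  x : ∀ g : Γ.group, Represents g !![1, 1 / (Γ.h : ℝ); 0, 1] →
    ((lam g : ℂˣ) : ℂ) = Complex.exp (-(2 * Real.pi * Complex.I / Γ.h))
  y_pos : Γ.HasFricke → ∀ g : Γ.group, Represents g !![1, 0; (Γ.n : ℝ), 1] →
    ((lam g : ℂˣ) : ℂ) = Complex.exp (2 * Real.pi * Complex.I / Γ.h)
  y_neg : ¬ Γ.HasFricke → ∀ g : Γ.group, Represents g !![1, 0; (Γ.n : ℝ), 1] →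
    ((lam g : ℂˣ) : ℂ) = Complex.exp (-(2 * Real.pi * Complex.I / Γ.h))

/-- The subgroup `Γ_λ = ker λ`, as a subgroup of `GL₂(ℝ)`. -/
def fixingGroup (Γ : NHSymbol) (lam : Γ.group →* rootsOfUnity Γ.h ℂ) :
    Subgroup (GL (Fin 2) ℝ) :=
  lam.ker.map Γ.group.subtype

end NHSymbol

/-- `T` is the (normalized) Hauptmodul of a group `G` for which the translations fixing `∞` are
generated by `τ ↦ τ + 1`: it is holomorphic on `ℍ` and `G`-invariant, it is bounded at every cusp
that is not `G`-equivalent to `∞`, and `T = q⁻¹ + O(q)` at `∞`. In particular its only pole on the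
compactified quotient is simple, so `T` has degree one and generates the function field, and `G`
has genus zero. -/
structure IsHauptmodul (G : Subgroup (GL (Fin 2) ℝ)) (T : ℍ → ℂ) : Prop where
  holo : MDifferentiable 𝓘(ℂ) 𝓘(ℂ) T
  invariant : ∀ g ∈ G, ∀ τ : ℍ, T (g • τ) = T τ
  bounded : ∀ c : OnePoint ℝ, IsCusp c G → (∀ g ∈ G, g • OnePoint.infty ≠ c) →
    c.IsBoundedAt T 0
  normalized : (fun τ : ℍ => T τ - Complex.exp (-(2 * Real.pi * Complex.I * τ))) =O[atImInfty]
    fun τ : ℍ => Complex.exp (2 * Real.pi * Complex.I * τ)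

/-- `T = 𝒯_Γ`: the Conway–Norton rule defines an eigenvalue map `λ` on `Γ`, and `T` is the
Hauptmodul of `Γ_λ`. -/
def NHSymbol.IsHauptmodulOf (Γ : NHSymbol) (T : ℍ → ℂ) : Prop :=
  ∃ lam : Γ.group →* rootsOfUnity Γ.h ℂ, Γ.IsConwayNortonMap lam ∧
    IsHauptmodul (Γ.fixingGroup lam) T

/-- The operator `(f | U_p)(τ) = (1/p) ∑_{0 ≤ μ < p} f((τ + μ) / p)` (for `p ≥ 1`), which sends
`∑ a(n) qⁿ` to `∑ a(pn) qⁿ`. -/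
def U (p : ℕ) (f : ℍ → ℂ) : ℍ → ℂ := fun τ =>
  (1 / (p : ℂ)) * ∑ μ ∈ Finset.range p, f (ofComplex (((τ : ℂ) + μ) / p))

end

namespace NHSymbol

/-- The symbol `n|h-`, i.e. `Γ₀(n|h)` itself. -/
def minus (n h : ℕ) : NHSymbol := ⟨n, h, {1}⟩

/-- The symbol `n|h+`: all exact divisors of `n / h` are included. -/
def plus (n h : ℕ) : NHSymbol :=
  ⟨n, h, (n / h).divisors.filter fun e => Nat.Coprime e (n / h / e)⟩

/-- The symbol `n|h + e₁, e₂, …` where `s = {e₁, e₂, …}`. -/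
def plusSome (n h : ℕ) (s : Finset ℕ) : NHSymbol := ⟨n, h, insert 1 s⟩

/-- Conway and Norton's list of the 171 groups `n|h + e₁, e₂, …` that are attached to the
conjugacy classes of the monster. -/
def moonshineList : List NHSymbol :=
  [
    minus 1 1,
    plus 2 1, minus 2 1,
    plus 3 1, minus 3 1, minus 3 3,
    plus 4 1, plus 4 2, minus 4 1, minus 4 2,
    plus 5 1, minus 5 1,
    plus 6 1, plusSome 6 1 {6}, plusSome 6 1 {3}, plusSome 6 1 {2}, minus 6 1, minus 6 3,
    plus 7 1, minus 7 1,
    plus 8 1, plus 8 2, plus 8 4, minus 8 2, minus 8 1, minus 8 4,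
    plus 9 1, minus 9 1,
    plus 10 1, plusSome 10 1 {5}, plusSome 10 1 {2}, plusSome 10 1 {10}, minus 10 1,
    plus 11 1,
    plus 12 1, plusSome 12 1 {4}, plus 12 2, plus 12 3, plusSome 12 1 {3}, plusSome 12 2 {6},
    plusSome 12 2 {2}, plusSome 12 1 {12}, minus 12 1, minus 12 6,
    plus 13 1, minus 13 1,
    plus 14 1, plusSome 14 1 {7}, plusSome 14 1 {14},
    plus 15 1, plusSome 15 1 {5}, plusSome 15 1 {15}, minus 15 3,
    plus 16 2, minus 16 1, plus 16 1,
    plus 17 1,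
    plusSome 18 1 {2}, plus 18 1, plusSome 18 1 {9}, minus 18 1, plusSome 18 1 {18},
    plus 19 1,
    plus 20 1, plus 20 2, plusSome 20 1 {4}, plusSome 20 2 {5}, plusSome 20 2 {10},
    plusSome 20 1 {20},
    plus 21 1, plusSome 21 1 {3}, plus 21 3, plusSome 21 1 {21},
    plus 22 1, plusSome 22 1 {11},
    plus 23 1,
    plus 24 2, plus 24 1, plusSome 24 1 {8}, plusSome 24 2 {3}, plus 24 6, plusSome 24 4 {6},
    plusSome 24 4 {2}, plusSome 24 2 {12}, plusSome 24 1 {24}, minus 24 12,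
    plus 25 1,
    plus 26 1, plusSome 26 1 {26},
    plus 27 1,
    plus 28 2, plus 28 1, plusSome 28 1 {7}, plusSome 28 2 {14},
    plus 29 1,
    plusSome 30 1 {6, 10, 15}, plus 30 1, plusSome 30 1 {3, 5, 15}, plusSome 30 1 {5, 6, 30},
    plusSome 30 3 {10}, plusSome 30 1 {2, 15, 30}, plusSome 30 1 {15},
    plus 31 1,
    plus 32 1, plus 32 2,
    plusSome 33 1 {11}, plus 33 1,
    plus 34 1,
    plus 35 1, plusSome 35 1 {35},
    plus 36 1, plusSome 36 1 {4}, plus 36 2, plusSome 36 1 {36},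
    plus 38 1,
    plus 39 1, plus 39 3, plusSome 39 1 {39},
    plus 40 4, plus 40 2, plusSome 40 2 {20},
    plus 41 1,
    plus 42 1, plusSome 42 1 {6, 14, 21}, plusSome 42 3 {7}, plusSome 42 1 {3, 14, 42},
    plus 44 1,
    plus 45 1,
    plusSome 46 1 {23}, plus 46 1,
    plus 47 1,
    plus 48 2,
    plus 50 1,
    plus 51 1,
    plus 52 2, plusSome 52 2 {26},
    plus 54 1,
    plus 55 1,
    plus 56 1, plusSome 56 4 {14},
    plus 57 3,
    plus 59 1,
    plus 60 2, plus 60 1, plusSome 60 1 {4, 15, 60}, plusSome 60 1 {12, 15, 20},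
    plusSome 60 2 {5, 6, 30}, plusSome 60 6 {10},
    plus 62 1,
    plus 66 1, plusSome 66 1 {6, 11, 66},
    plus 68 2,
    plus 69 1,
    plus 70 1, plusSome 70 1 {10, 14, 35},
    plus 71 1,
    plus 78 1, plusSome 78 1 {6, 26, 39},
    plus 84 2, plusSome 84 2 {6, 14, 21}, plus 84 3,
    plus 87 1,
    plus 88 2,
    plus 92 1,
    plus 93 3,
    plus 94 1,
    plus 95 1,
    plus 104 4,
    plus 105 1,
    plus 110 1,
    plus 119 1
  ]

/-- The group appears in monstrous moonshine. -/
def AppearsInMoonshine (Γ : NHSymbol) : Prop := Γ ∈ moonshineList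

end NHSymbol

end Moonshine

namespace Moonshine

open UpperHalfPlane Matrix
open scoped MatrixGroups Manifold
open Filter Topology
open scoped ModularForm

/-! ### Matrices up to scalars -/

/-! Each identity is first proved up to an additive constant. A holomorphic function invariant under
a group containing some Γ₀(N) is constant once it is bounded at ∞ and at every cusp inequivalent to
∞ (`exists_eq_const_of_group`). The constant is then 0 by `eq_zero_of_const`, since both sides tend
to 0 at i∞: U_p removes the term q⁻¹, and two Hauptmoduln have the same principal part.

Let T = 𝒯_Γ and let W be an Atkin–Lehner matrix. Four relations, modulo constants, carry the proof;
(1) and (2) assume r = 1, all e prime to p, and W = W_p. (1) T∘W + pT|U_p ≡ 0. The left side is the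
trace of T∘W from level Mp to level M = nh, because suitable coset representatives turn W into W
itself and the matrices (1,μ;0,p). It has no pole (`exists_comp_add_mul_U_eq`). (2) T + p(T∘W)|U_p ≡
𝒯_{Γ^p}. This is the trace of T itself, with a single pole (`exists_add_mul_U_comp_sub_eq`). (3) T +
T∘W ≡ 𝒯_{⟨Γ,w_P⟩} for W = W_P and all e prime to P, because the kernel for ⟨Γ,w_P⟩ is the union of
two cosets of that for Γ (`exists_add_comp_sub_eq`). (4) pT|U_p ≡ 𝒯_{Γ^p}∘V if w_{p^r} ∈ Γ and r >
1, where V = W_{p^{r-1}} belongs to the level of Γ^p. Here W_{p^r} = V·(p,0;0,1), so invariance of T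
turns pT|U_p into a trace of T evaluated at Vτ (`exists_mul_U_sub_comp_eq`). Then (a) is (1) minus
(3), (b) is (1) substituted in (2), (c) is (4) plus (3) for Γ^p, and (d) is (4) plus (1) for Γ^p.

The kernels of the eigenvalue maps must also be comparable. As h divides 24, units square to 1
modulo h; hence Γ is generated by Γ₀(nh), two unipotents and Atkin–Lehner matrices (`group_le`, with
n the level parameter of Γ). Eigenvalue maps of two groups can then disagree on a common subgroup
only at (1,0;n,1), where a sign depends on the Fricke involution. Membership in the moonshine list
settles this: either h ≤ 2 and the sign is immaterial, or h ∣ p + 1 and the signs are opposite,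
which is what passing from Γ to Γ^p requires (`h_le_two`, `power_compat`, `agree`). -/

lemma Represents.mul {g g' : GL (Fin 2) ℝ} {A B : Matrix (Fin 2) (Fin 2) ℝ}
    (hg : Represents g A) (hg' : Represents g' B) : Represents (g * g') (A * B) := by
  obtain ⟨r, hr, h⟩ := hg
  obtain ⟨s, hs, h'⟩ := hg'
  exact ⟨r * s, mul_ne_zero hr hs, by rw [Units.val_mul, h, h', smul_mul_smul_comm]⟩

lemma Represents.inv {g : GL (Fin 2) ℝ} {a b c d : ℝ} (hg : Represents g !![a, b; c, d]) :
    Represents g⁻¹ !![d, -b; -c, a] := by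
  obtain ⟨r, hr, h⟩ := hg
  have hd : (g : Matrix (Fin 2) (Fin 2) ℝ).det ≠ 0 := g.det_ne_zero
  refine ⟨(g : Matrix (Fin 2) (Fin 2) ℝ).det⁻¹ * r, mul_ne_zero (inv_ne_zero hd) hr, ?_⟩
  rw [Matrix.coe_units_inv, Matrix.inv_def, mul_smul]
  congr 1
  · simp
  · rw [h, Matrix.adjugate_smul]
    simp [Matrix.adjugate_fin_two_of]

lemma Represents.of_smul {g : GL (Fin 2) ℝ} {A B : Matrix (Fin 2) (Fin 2) ℝ} {s : ℝ}
    (hg : Represents g A) (hs : s ≠ 0) (h : A = s • B) : Represents g B := by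
  obtain ⟨r, hr, h'⟩ := hg
  exact ⟨r * s, mul_ne_zero hr hs, by rw [h', h, smul_smul]⟩

lemma Represents.congr {g : GL (Fin 2) ℝ} {A B : Matrix (Fin 2) (Fin 2) ℝ}
    (hg : Represents g A) (h : A = B) : Represents g B := h ▸ hg

lemma Represents.mul_of {g g' : GL (Fin 2) ℝ} {a b c d a' b' c' d' : ℝ}
    (hg : Represents g !![a, b; c, d]) (hg' : Represents g' !![a', b'; c', d']) :
    Represents (g * g')
      !![a * a' + b * c', a * b' + b * d'; c * a' + d * c', c * b' + d * d'] := by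
  simpa [Matrix.mul_fin_two] using hg.mul hg'

lemma of_eq_smul {a b c d a' b' c' d' s : ℝ} (ha : a = s * a') (hb : b = s * b')
    (hc : c = s * c') (hd : d = s * d') :
    !![a, b; c, d] = s • !![a', b'; c', d'] := by
  subst ha hb hc hd
  ext i j
  fin_cases i <;> fin_cases j <;> simp

lemma of_congr {a b c d a' b' c' d' : ℝ} (ha : a = a') (hb : b = b') (hc : c = c')
    (hd : d = d') : !![a, b; c, d] = !![a', b'; c', d'] := by
  rw [ha, hb, hc, hd]

/-- The invertible matrix with the given entries. -/
noncomputable def gl (a b c d : ℝ) (h : a * d - b * c ≠ 0) : GL (Fin 2) ℝ :=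
  GeneralLinearGroup.mkOfDetNeZero !![a, b; c, d] (by simpa [Matrix.det_fin_two_of] using h)

@[simp] lemma coe_gl {a b c d : ℝ} (h : a * d - b * c ≠ 0) :
    (gl a b c d h : Matrix (Fin 2) (Fin 2) ℝ) = !![a, b; c, d] := rfl

lemma represents_gl {a b c d : ℝ} (h : a * d - b * c ≠ 0) :
    Represents (gl a b c d h) !![a, b; c, d] := ⟨1, one_ne_zero, by simp⟩

/-! ### The sets `w_e` -/

/-- Dividing the determinant condition by e makes it an equation over ℤ; m is the divisor
complementary to e. -/
lemma mem_w_iff {n h e m : ℕ} (hh : 0 < h) (he : 0 < e) (hn : n = h * e * m) {g : GL (Fin 2) ℝ} :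
    g ∈ w n h e ↔ ∃ a b c d : ℤ, a * d * e - b * c * m = 1 ∧
      Represents g !![(a : ℝ) * e, (b : ℝ) / h; (c : ℝ) * n, (d : ℝ) * e] := by
  have hh' : (h : ℝ) ≠ 0 := by positivity
  have he' : (e : ℝ) ≠ 0 := by positivity
  have key : ∀ a b c d : ℤ,
      (!![(a : ℝ) * e, (b : ℝ) / h; (c : ℝ) * n, (d : ℝ) * e]).det = e ↔
        a * d * e - b * c * m = 1 := by
    intro a b c d
    rw [Matrix.det_fin_two_of, hn]
    push_cast
    rw [show (a : ℝ) * e * (d * e) - b / h * (c * (h * e * m)) =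
      e * (a * d * e - b * c * m) by field_simp]
    rw [mul_eq_left₀ he']
    exact_mod_cast Iff.rfl
  simp only [w, Set.mem_ofPred_eq, key]

lemma mem_w_one_one_iff {N : ℕ} {g : GL (Fin 2) ℝ} :
    g ∈ w N 1 1 ↔ ∃ a b c d : ℤ, a * d - b * c * N = 1 ∧
      Represents g !![(a : ℝ), (b : ℝ); (c : ℝ) * N, (d : ℝ)] := by
  rw [mem_w_iff (m := N) one_pos one_pos (by simp)]
  simp

lemma inv_mem_w {n h e m : ℕ} (hh : 0 < h) (he : 0 < e) (hn : n = h * e * m) {g : GL (Fin 2) ℝ}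
    (hg : g ∈ w n h e) : g⁻¹ ∈ w n h e := by
  rw [mem_w_iff hh he hn] at hg ⊢
  obtain ⟨a, b, c, d, hdet, hr⟩ := hg
  refine ⟨d, -b, -c, a, by linear_combination hdet, hr.inv.congr ?_⟩
  apply of_congr <;> push_cast <;> ring

/-- The product has determinant k²ef, and a scalar k can be removed from it, leaving a matrix of the
required shape. -/
lemma mul_mem_w {n h k e f m : ℕ} (hh : 0 < h) (hk : 0 < k) (he : 0 < e) (hf : 0 < f)
    (hn : n = h * (k * e * f * m)) {x y : GL (Fin 2) ℝ}
    (hx : x ∈ w n h (k * e)) (hy : y ∈ w n h (k * f)) : x * y ∈ w n h (e * f) := by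
  rw [mem_w_iff (m := f * m) hh (by positivity) (by rw [hn]; ring)] at hx
  rw [mem_w_iff (m := e * m) hh (by positivity) (by rw [hn]; ring)] at hy
  rw [mem_w_iff (m := k * m) hh (by positivity) (by rw [hn]; ring)]
  obtain ⟨a, b, c, d, hdet, hr⟩ := hx
  obtain ⟨a', b', c', d', hdet', hr'⟩ := hy
  have hh' : (h : ℝ) ≠ 0 := by positivity
  have hk' : (k : ℝ) ≠ 0 := by positivity
  push_cast at hdet hdet'
  refine ⟨a * a' * k + b * c' * m, a * b' * e + b * d' * f, c * a' * f + d * c' * e,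
    c * b' * m + d * d' * k, ?_, (hr.mul_of hr').of_smul hk' ?_⟩
  · push_cast
    linear_combination (a' * d' * k * f - b' * c' * e * m : ℤ) * hdet + hdet'
  · have hn' : (n : ℝ) = h * (k * e * f * m) := by exact_mod_cast hn
    apply of_eq_smul <;> push_cast <;> (try simp only [hn']) <;> field_simp

lemma star_mul_mul {k e f : ℕ} (hk : 0 < k) (hef : Nat.Coprime e f) :
    star (k * e) (k * f) = e * f := by
  rw [star, Nat.gcd_mul_left, hef.gcd_eq_one, mul_one,
    show k * e * (k * f) = e * f * k ^ 2 by ring, Nat.mul_div_cancel _ (by positivity)]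

/-- Extracting k = gcd(e, f) puts two divisors in the normal form needed by `mul_mem_w`;
divisibility alone suffices. -/
lemma exists_star_decomp {e f l : ℕ} (hl : 0 < l) (he : e ∣ l) (hf : f ∣ l) :
    ∃ k e' f' m : ℕ, 0 < k ∧ 0 < e' ∧ 0 < f' ∧ e = k * e' ∧ f = k * f' ∧
      l = k * e' * f' * m ∧ Nat.Coprime e' f' ∧ star e f = e' * f' := by
  have he0 : 0 < e := Nat.pos_of_dvd_of_pos he hl
  have hf0 : 0 < f := Nat.pos_of_dvd_of_pos hf hl
  have hk : 0 < Nat.gcd e f := Nat.gcd_pos_of_pos_left _ he0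
  obtain ⟨e', he'⟩ := Nat.gcd_dvd_left e f
  obtain ⟨f', hf'⟩ := Nat.gcd_dvd_right e f
  have hcop : Nat.Coprime e' f' := by
    have := Nat.coprime_div_gcd_div_gcd hk
    rwa [Nat.div_eq_of_eq_mul_right hk he', Nat.div_eq_of_eq_mul_right hk hf'] at this
  generalize Nat.gcd e f = k at *
  subst he' hf'
  have : k * e' * f' ∣ l := by
    obtain ⟨t, ht⟩ := he
    have h1 : f' ∣ e' * t := by
      have : k * f' ∣ k * (e' * t) := by rw [← mul_assoc, ← ht]; exact hf
      exact Nat.dvd_of_mul_dvd_mul_left hk this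
    obtain ⟨s, hs⟩ := (Nat.Coprime.dvd_mul_left hcop.symm).mp h1
    exact ⟨s, by rw [ht, hs]; ring⟩
  obtain ⟨m, hm⟩ := this
  refine ⟨k, e', f', m, hk, Nat.pos_of_mul_pos_left he0, Nat.pos_of_mul_pos_left hf0, rfl, rfl,
    hm, hcop, star_mul_mul hk hcop⟩

lemma mul_mem_w_star {n h l e f : ℕ} (hh : 0 < h) (hl : 0 < l) (hn : n = h * l) (he : e ∣ l)
    (hf : f ∣ l) {x y : GL (Fin 2) ℝ} (hx : x ∈ w n h e) (hy : y ∈ w n h f) :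
    x * y ∈ w n h (star e f) := by
  obtain ⟨k, e', f', m, hk, he', hf', rfl, rfl, rfl, -, hs⟩ := exists_star_decomp hl he hf
  rw [hs]
  exact mul_mem_w hh hk he' hf' hn hx hy

lemma star_self {e : ℕ} (he : 0 < e) : star e e = 1 := by
  have := star_mul_mul (e := 1) (f := 1) he (by simp)
  simpa using this

lemma star_of_coprime {e f : ℕ} (h : Nat.Coprime e f) : star e f = e * f := by
  simp [star, h.gcd_eq_one]

lemma star_comm (e f : ℕ) : star e f = star f e := by
  rw [star, star, mul_comm, Nat.gcd_comm]

lemma one_mem_w (n h : ℕ) : (1 : GL (Fin 2) ℝ) ∈ w n h 1 := by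
  refine ⟨1, 0, 0, 1, by simp [Matrix.det_fin_two_of], 1, one_ne_zero, ?_⟩
  simp [Matrix.one_fin_two]

namespace NHSymbol

variable {Γ : NHSymbol}

namespace IsNHType

lemma h_pos (hΓ : Γ.IsNHType) : 0 < Γ.h :=
  Nat.pos_of_dvd_of_pos (hΓ.h_dvd.trans (Nat.gcd_dvd_right _ _)) (by norm_num)

lemma n_eq (hΓ : Γ.IsNHType) : Γ.n = Γ.h * (Γ.n / Γ.h) :=
  (Nat.mul_div_cancel' (hΓ.h_dvd.trans (Nat.gcd_dvd_left _ _))).symm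

lemma div_pos (hΓ : Γ.IsNHType) : 0 < Γ.n / Γ.h :=
  Nat.pos_of_ne_zero fun h => by
    have := hΓ.n_eq
    rw [h, mul_zero] at this
    exact hΓ.n_pos.ne' this

lemma h_dvd_24 (hΓ : Γ.IsNHType) : Γ.h ∣ 24 := hΓ.h_dvd.trans (Nat.gcd_dvd_right _ _)

lemma pos_of_mem (hΓ : Γ.IsNHType) {e : ℕ} (he : e ∈ Γ.E) : 0 < e :=
  Nat.pos_of_dvd_of_pos (hΓ.exact e he).1 hΓ.div_pos

/-- Closure of E under `star` makes the union of the w_e a group already, so no words in generators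
have to be considered. -/
lemma mem_group_iff (hΓ : Γ.IsNHType) {g : GL (Fin 2) ℝ} :
    g ∈ Γ.group ↔ ∃ e ∈ Γ.E, g ∈ w Γ.n Γ.h e := by
  constructor
  · intro hg
    induction hg using Subgroup.closure_induction with
    | mem x hx => simpa using hx
    | one => exact ⟨1, hΓ.one_mem, one_mem_w _ _⟩
    | mul x y _ _ hx hy =>
      obtain ⟨e, he, hx⟩ := hx
      obtain ⟨f, hf, hy⟩ := hy
      exact ⟨star e f, hΓ.star_mem e he f hf, mul_mem_w_star hΓ.h_pos hΓ.div_pos hΓ.n_eq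
        (hΓ.exact e he).1 (hΓ.exact f hf).1 hx hy⟩
    | inv x _ hx =>
      obtain ⟨e, he, hx⟩ := hx
      obtain ⟨m, hm⟩ := (hΓ.exact e he).1
      refine ⟨e, he, inv_mem_w hΓ.h_pos (hΓ.pos_of_mem he) (m := m) ?_ hx⟩
      rw [mul_assoc, ← hm]
      exact hΓ.n_eq
  · rintro ⟨e, he, hg⟩
    refine Subgroup.subset_closure ?_
    simp only [Set.mem_iUnion]
    exact ⟨e, he, hg⟩

end IsNHType

end NHSymbol

/-- `Γ₀(N)`, as a subgroup of `GL₂(ℝ)` containing all scalars. -/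
def scaledGamma0 (N : ℕ) : Subgroup (GL (Fin 2) ℝ) where
  carrier := w N 1 1
  one_mem' := one_mem_w N 1
  mul_mem' {x y} hx hy := by
    have := mul_mem_w (n := N) (h := 1) (k := 1) (e := 1) (f := 1) (m := N) one_pos one_pos
      one_pos one_pos (by simp) (x := x) (y := y) (by simpa using hx) (by simpa using hy)
    simpa using this
  inv_mem' hx := inv_mem_w (m := N) one_pos one_pos (by simp) hx

lemma mem_scaledGamma0 {N : ℕ} {g : GL (Fin 2) ℝ} : g ∈ scaledGamma0 N ↔ g ∈ w N 1 1 := Iff.rfl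

lemma mem_scaledGamma0_iff {N : ℕ} {g : GL (Fin 2) ℝ} :
    g ∈ scaledGamma0 N ↔ ∃ a b c d : ℤ, a * d - b * c * N = 1 ∧
      Represents g !![(a : ℝ), (b : ℝ); (c : ℝ) * N, (d : ℝ)] := mem_w_one_one_iff

/-! ### Units modulo divisors of 24 -/

/-- The divisors of 24 are the moduli whose units all square to 1. This is where the condition h ∣
24 acts; it is checked on residues modulo 24. -/
lemma dvd_sq_sub_one {h : ℕ} (hh : h ∣ 24) {a : ℤ} (ha : IsCoprime a (h : ℤ)) :
    (h : ℤ) ∣ a ^ 2 - 1 := by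
  have hle : h ≤ 24 := Nat.le_of_dvd (by norm_num) hh
  have key : ∀ h' : Fin 25, h'.1 ∣ 24 → ∀ x : Fin 24, Nat.Coprime x.1 h'.1 →
      x.1 ^ 2 % h'.1 = 1 % h'.1 := by decide
  have hm := Int.emod_nonneg a (show (24 : ℤ) ≠ 0 by norm_num)
  have hm' := Int.emod_lt_of_pos a (show (0 : ℤ) < 24 by norm_num)
  obtain ⟨x, hx⟩ : ∃ x : ℕ, a % 24 = x := ⟨(a % 24).toNat, by omega⟩
  have hax : (h : ℤ) ∣ a - x := by
    rw [← hx]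
    exact (Int.natCast_dvd_natCast.mpr hh).trans (Int.dvd_self_sub_emod)
  have hcop : IsCoprime (x : ℤ) (h : ℤ) := by
    obtain ⟨t, ht⟩ := hax
    rw [show (x : ℤ) = a + h * (-t) by linear_combination -ht]
    exact IsCoprime.add_mul_left_left ha _
  have := key ⟨h, by omega⟩ hh ⟨x, by omega⟩ (Nat.isCoprime_iff_coprime.mp hcop)
  have h1 : (h : ℤ) ∣ (x : ℤ) ^ 2 - 1 := by
    have h2 : (x ^ 2 : ℕ) ≡ 1 [MOD h] := this
    have := (Nat.modEq_iff_dvd.mp h2.symm)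
    exact_mod_cast this
  have h3 : (h : ℤ) ∣ a ^ 2 - x ^ 2 := (hax.trans (sub_dvd_pow_sub_pow a (x : ℤ) 2))
  have := dvd_add h3 h1
  ring_nf at this ⊢
  exact this

lemma dvd_sub_of_mul_sub_one {h : ℕ} (hh : h ∣ 24) {a d : ℤ} (had : (h : ℤ) ∣ a * d - 1) :
    (h : ℤ) ∣ a - d := by
  have hc : IsCoprime a (h : ℤ) := by
    obtain ⟨t, ht⟩ := had
    exact ⟨d, -t, by linear_combination ht⟩
  have h1 := dvd_sq_sub_one hh hc
  have : a - d = a * (-(a * d - 1)) + d * (a ^ 2 - 1) := by ring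
  rw [this]
  exact dvd_add ((dvd_neg.mpr had).mul_left _) (h1.mul_left _)

/-- The elements of `w_e` normalize `Γ₀(nh)`. -/
lemma conj_mem_scaledGamma0 {n h e m : ℕ} (hh24 : h ∣ 24) (hh : 0 < h) (he : 0 < e)
    (hn : n = h * e * m) {g x : GL (Fin 2) ℝ} (hg : g ∈ w n h e)
    (hx : x ∈ scaledGamma0 (n * h)) : g * x * g⁻¹ ∈ scaledGamma0 (n * h) := by
  rw [mem_w_iff hh he hn] at hg
  rw [mem_scaledGamma0_iff] at hx ⊢
  obtain ⟨a, b, c, d, hdet, hr⟩ := hg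
  obtain ⟨α, β, γ, δ, hdet', hr'⟩ := hx
  push_cast at hdet'
  -- The off-diagonal entries of the conjugate involve (α − δ)/h; integrality follows from αδ ≡ 1
  -- modulo h and h ∣ 24.
  obtain ⟨t, ht⟩ : (h : ℤ) ∣ α - δ := by
    refine dvd_sub_of_mul_sub_one hh24 ⟨β * γ * n, ?_⟩
    linear_combination hdet'
  have hh' : (h : ℝ) ≠ 0 := by positivity
  have he' : (e : ℝ) ≠ 0 := by positivity
  have htr : (α : ℝ) = δ + h * t := by
    have : α = δ + h * t := by linear_combination ht
    exact_mod_cast this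
  have hnz : (n : ℤ) = h * e * m := by exact_mod_cast hn
  refine ⟨a * d * e * α + b * d * n * γ - a * c * n * β - b * c * δ * m,
    -a * b * t - b ^ 2 * γ * m + a ^ 2 * e * β,
    c * d * t + d ^ 2 * e * γ - c ^ 2 * β * m,
    a * d * e * δ - b * d * n * γ + a * c * n * β - b * c * α * m, ?_,
    ((hr.mul_of hr').mul_of hr.inv).of_smul he' ?_⟩
  · have hα : α = δ + h * t := by linear_combination ht
    subst hα
    push_cast
    rw [hnz] at hdet' ⊢
    linear_combination (a * d * e - b * c * m) ^ 2 * hdet' +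
      (a * d * e - b * c * m + 1) * hdet
  · have hn' : (n : ℝ) = h * e * m := by exact_mod_cast hn
    apply of_eq_smul <;> push_cast <;> simp only [htr, hn'] <;> field_simp <;> ring

/-! ### Generators of `Γ₀(n|h) + e₁, e₂, …` -/

/-- Common primes are removed from h one at a time, which separates the part supported on primes of
e from the part prime to e. -/
lemma exists_coprime_part (e : ℤ) {h : ℕ} (hh : 0 < h) :
    ∃ k l : ℕ, h = k * l ∧ IsCoprime e (l : ℤ) ∧ ∀ q : ℕ, q.Prime → q ∣ k → (q : ℤ) ∣ e := by
  induction h using Nat.strong_induction_on with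
  | _ h ih =>
    by_cases hc : IsCoprime e (h : ℤ)
    · refine ⟨1, h, by simp, hc, fun q hq hq1 => ?_⟩
      exact absurd (Nat.dvd_one.mp hq1) hq.one_lt.ne'
    · rw [Int.isCoprime_iff_gcd_eq_one] at hc
      obtain ⟨q, hq, hqd⟩ := Nat.exists_prime_and_dvd hc
      have hqe : (q : ℤ) ∣ e := (Int.natCast_dvd_natCast.mpr hqd).trans (Int.gcd_dvd_left _ _)
      have hqh : q ∣ h := Int.natCast_dvd_natCast.mp
        ((Int.natCast_dvd_natCast.mpr hqd).trans (Int.gcd_dvd_right _ _))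
      obtain ⟨h', rfl⟩ := hqh
      have hh' : 0 < h' := Nat.pos_of_mul_pos_left hh
      obtain ⟨k, l, hkl, hcop, hk⟩ := ih h' (lt_mul_of_one_lt_left hh' hq.one_lt) hh'
      refine ⟨q * k, l, by rw [hkl, mul_assoc], hcop, fun q' hq' hd => ?_⟩
      rcases (Nat.Prime.dvd_mul hq').mp hd with h1 | h1
      · rwa [(Nat.prime_dvd_prime_iff_eq hq' hq).mp h1]
      · exact hk q' hq' h1

lemma exists_isCoprime_add_mul {a c : ℤ} (hac : IsCoprime a c) {h : ℕ} (hh : 0 < h) :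
    ∃ k : ℤ, IsCoprime (a + k * c) (h : ℤ) := by
  obtain ⟨k, l, rfl, hl, hk⟩ := exists_coprime_part a hh
  -- A prime of k divides a but neither l nor c; a prime of l divides lc but not a. Neither can
  -- divide a + lc.
  refine ⟨l, ?_⟩
  push_cast
  refine IsCoprime.mul_right ?_ (IsCoprime.add_mul_left_left hl c)
  rw [Int.isCoprime_iff_gcd_eq_one]
  by_contra hne
  obtain ⟨q, hq, hqd⟩ := Nat.exists_prime_and_dvd hne
  have hq1 : (q : ℤ) ∣ a + l * c :=
    (Int.natCast_dvd_natCast.mpr hqd).trans (Int.gcd_dvd_left _ _)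
  have hqk : q ∣ k := Int.natCast_dvd_natCast.mp
    ((Int.natCast_dvd_natCast.mpr hqd).trans (Int.gcd_dvd_right _ _))
  have hqa := hk q hq hqk
  have hqlc : (q : ℤ) ∣ l * c := (dvd_add_right hqa).mp hq1
  have hqu : ¬ IsUnit (q : ℤ) := (Nat.prime_iff_prime_int.mp hq).not_isUnit
  rcases (Nat.prime_iff_prime_int.mp hq).dvd_or_dvd hqlc with h1 | h1
  · exact hqu (hl.isUnit_of_dvd' hqa h1)
  · exact hqu (hac.isUnit_of_dvd' hqa h1)

/-- The upper unipotent matrix `(1, t; 0, 1)`. -/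
noncomputable def upperUni (t : ℝ) : GL (Fin 2) ℝ := gl 1 t 0 1 (by simp)

/-- The lower unipotent matrix `(1, 0; t, 1)`. -/
noncomputable def lowerUni (t : ℝ) : GL (Fin 2) ℝ := gl 1 0 t 1 (by simp)

lemma represents_upperUni (t : ℝ) : Represents (upperUni t) !![1, t; 0, 1] := represents_gl _

lemma represents_lowerUni (t : ℝ) : Represents (lowerUni t) !![1, 0; t, 1] := represents_gl _

lemma upperUni_add (s t : ℝ) : upperUni (s + t) = upperUni s * upperUni t := by
  apply Units.ext
  simp [upperUni, add_comm]

lemma lowerUni_add (s t : ℝ) : lowerUni (s + t) = lowerUni s * lowerUni t := by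
  apply Units.ext
  simp [lowerUni]

lemma upperUni_zpow (t : ℝ) (j : ℤ) : upperUni t ^ j = upperUni (j * t) := by
  let φ : Multiplicative ℝ →* GL (Fin 2) ℝ :=
    MonoidHom.mk' (fun x => upperUni x.toAdd) fun x y => upperUni_add _ _
  have := map_zpow φ (Multiplicative.ofAdd t) j
  rw [← ofAdd_zsmul] at this
  simpa [φ] using this.symm

lemma lowerUni_zpow (t : ℝ) (j : ℤ) : lowerUni t ^ j = lowerUni (j * t) := by
  let φ : Multiplicative ℝ →* GL (Fin 2) ℝ :=
    MonoidHom.mk' (fun x => lowerUni x.toAdd) fun x y => lowerUni_add _ _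
  have := map_zpow φ (Multiplicative.ofAdd t) j
  rw [← ofAdd_zsmul] at this
  simpa [φ] using this.symm

/-- `w_1` for `n|h` is generated by `Γ₀(nh)` and two unipotent matrices. -/
lemma mem_of_mem_w_one {n h l : ℕ} (hh24 : h ∣ 24) (hh : 0 < h) (hn : n = h * l)
    {K : Subgroup (GL (Fin 2) ℝ)} (h0 : scaledGamma0 (n * h) ≤ K)
    (hX : upperUni (1 / h) ∈ K) (hY : lowerUni n ∈ K) {g : GL (Fin 2) ℝ} (hg : g ∈ w n h 1) :
    g ∈ K := by
  have hh' : (h : ℝ) ≠ 0 := by positivity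
  have hn' : (n : ℝ) = h * l := by exact_mod_cast hn
  have hX' (j : ℤ) : upperUni (j * (1 / h)) ∈ K := upperUni_zpow (1 / h) j ▸ K.zpow_mem hX j
  have hY' (j : ℤ) : lowerUni (j * n) ∈ K := lowerUni_zpow n j ▸ K.zpow_mem hY j
  rw [mem_w_iff (m := l) hh one_pos (by rw [hn]; ring)] at hg
  obtain ⟨a, b, c, d, hdet, hr⟩ := hg
  simp only [Nat.cast_one, mul_one] at hdet hr
  -- A left translation makes the upper left entry a' prime to h. Since a'² ≡ 1 modulo h, the
  -- multiples −a'c and −a'b' of the two unipotents then bring the matrix into Γ₀(nh).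
  obtain ⟨k, hk⟩ := exists_isCoprime_add_mul (a := a) (c := c * l) ⟨d, -b, by
    linear_combination hdet⟩ hh
  set a' : ℤ := a + k * (c * l) with ha'
  set b' : ℤ := b + k * d with hb'
  have hdet1 : a' * d - b' * c * l = 1 := by rw [ha', hb']; linear_combination hdet
  have hr1 : Represents (upperUni (k * (1 / h)) * g)
      !![(a' : ℝ), (b' : ℝ) / h; (c : ℝ) * n, (d : ℝ)] := by
    refine ((represents_upperUni _).mul_of hr).congr ?_
    apply of_congr <;> push_cast [ha', hb', hn'] <;> field_simp <;> ring
  clear_value a' b'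
  obtain ⟨t, ht⟩ := dvd_sq_sub_one hh24 hk
  have htr : (a' : ℝ) ^ 2 = 1 + h * t := by
    have : a' ^ 2 = 1 + h * t := by linear_combination ht
    exact_mod_cast this
  have hr2 := (((represents_lowerUni ((-(a' * c) : ℤ) * n)).mul_of hr1).mul_of
    (represents_upperUni ((-(a' * b') : ℤ) * (1 / h))))
  have hmem : lowerUni ((-(a' * c) : ℤ) * n) * (upperUni (k * (1 / h)) * g) *
      upperUni ((-(a' * b') : ℤ) * (1 / h)) ∈ scaledGamma0 (n * h) := by
    rw [mem_scaledGamma0_iff]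
    refine ⟨a', -(b' * t), -(c * t), d - a' * c * b' * l + a' * b' * c * l * t * h, ?_,
      hr2.congr ?_⟩
    · push_cast [hn]
      linear_combination hdet1 + (-b' * c * l + b' * c * l * h * t) * ht
    · apply of_congr <;> push_cast <;> simp only [hn'] <;> field_simp
      · ring
      · linear_combination -b' * htr
      · linear_combination (-c * h * l) * htr
      · linear_combination (b' * c * l * a') * htr
  have := h0 hmem
  rw [K.mul_mem_cancel_right (hX' _), K.mul_mem_cancel_left (hY' _),
    K.mul_mem_cancel_left (hX' _)] at this
  exact this

namespace NHSymbol

variable {Γ : NHSymbol}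

namespace IsNHType

lemma exists_decomp (hΓ : Γ.IsNHType) {e : ℕ} (he : e ∈ Γ.E) :
    ∃ m : ℕ, Γ.n = Γ.h * e * m ∧ Nat.Coprime e m := by
  obtain ⟨⟨m, hm⟩, hc⟩ := hΓ.exact e he
  rw [hm, Nat.mul_div_cancel_left _ (hΓ.pos_of_mem he)] at hc
  exact ⟨m, by rw [mul_assoc, ← hm]; exact hΓ.n_eq, hc⟩

/-- The set `w_e` contains an Atkin–Lehner matrix of level `nh`. -/
lemma exists_atkinLehner (hΓ : Γ.IsNHType) {e : ℕ} (he : e ∈ Γ.E) :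
    ∃ e' : ℕ, ExactDvd e' (Γ.n * Γ.h) ∧ (∀ q : ℕ, q.Prime → q ∣ e' → q ∣ e) ∧
      ∃ g ∈ w (Γ.n * Γ.h) 1 e', g ∈ w Γ.n Γ.h e := by
  obtain ⟨m, hn, hem⟩ := hΓ.exists_decomp he
  have he0 := hΓ.pos_of_mem he
  have hh := hΓ.h_pos
  -- In nh = h²em the divisor e need not be exact. With k the part of h on primes of e, the exact
  -- divisor is ek² with cofactor l²m, and the matrix built below is k times an element of w_e.
  obtain ⟨k, l, hkl, hcop, hk⟩ := exists_coprime_part e hh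
  have hcop' : Nat.Coprime e l := Nat.isCoprime_iff_coprime.mp hcop
  have hk0 : 0 < k := Nat.pos_of_ne_zero fun h => by simp [h] at hkl; omega
  have hprime : ∀ q : ℕ, q.Prime → q ∣ k → q ∣ e := fun q hq hd =>
    Int.natCast_dvd_natCast.mp (hk q hq hd)
  have hkc : ∀ x : ℕ, Nat.Coprime e x → Nat.Coprime k x := fun x hx =>
    Nat.Coprime.symm <| Nat.coprime_of_dvd fun q hq hqx hqk => by
      have := Nat.dvd_gcd (hprime q hq hqk) hqx
      rw [hx.gcd_eq_one] at this
      exact hq.one_lt.ne' (Nat.dvd_one.mp this)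
  have hec : Nat.Coprime (e * k ^ 2) (l ^ 2 * m) := by
    refine Nat.Coprime.mul_left ?_ (Nat.Coprime.pow_left 2 ?_)
    · exact Nat.Coprime.mul_right (hcop'.pow_right 2) hem
    · exact Nat.Coprime.mul_right ((hkc l hcop').pow_right 2) (hkc m hem)
  have hN : Γ.n * Γ.h = e * k ^ 2 * (l ^ 2 * m) := by rw [hn, hkl]; ring
  have he'0 : 0 < e * k ^ 2 := by positivity
  obtain ⟨u, v, huv⟩ := Nat.isCoprime_iff_coprime.mpr hec
  push_cast at huv
  have he'r : ((e : ℝ) * k ^ 2) ≠ 0 := by positivity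
  have hkr : (k : ℝ) ≠ 0 := by positivity
  have hlr : (l : ℝ) ≠ 0 := by
    have : 0 < l := Nat.pos_of_ne_zero fun h => by simp [h] at hkl; omega
    positivity
  have huvr : (u : ℝ) * (e * k ^ 2) + v * (l ^ 2 * m) = 1 := by exact_mod_cast huv
  let g := gl (e * k ^ 2) (-v) (e * k ^ 2 * (l ^ 2 * m)) (u * (e * k ^ 2)) (by
    rw [show (e : ℝ) * k ^ 2 * (u * (e * k ^ 2)) - -v * (e * k ^ 2 * (l ^ 2 * m)) =
      (e * k ^ 2) * (u * (e * k ^ 2) + v * (l ^ 2 * m)) by ring, huvr, mul_one]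
    exact he'r)
  refine ⟨e * k ^ 2, ⟨⟨_, hN⟩, ?_⟩, ?_, g, ?_, ?_⟩
  · rwa [hN, Nat.mul_div_cancel_left _ he'0]
  · intro q hq hd
    rcases (Nat.Prime.dvd_mul hq).mp hd with h1 | h1
    · exact h1
    · exact hprime q hq (hq.dvd_of_dvd_pow h1)
  · rw [mem_w_iff (m := l ^ 2 * m) one_pos he'0 (by rw [hN]; ring)]
    refine ⟨1, -v, 1, u, by push_cast; linear_combination huv, (represents_gl _).congr ?_⟩
    rw [hN]
    apply of_congr <;> push_cast <;> ring
  · rw [mem_w_iff hh he0 hn]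
    refine ⟨k, -v * l, l, u * k, by linear_combination huv, (represents_gl _).of_smul hkr ?_⟩
    rw [hn, hkl]
    apply of_eq_smul <;> push_cast <;> field_simp

/-- The product of two elements of w_e lies in w_1, so one Atkin–Lehner matrix in each w_e reduces
everything to generators of w_1. -/
lemma group_le (hΓ : Γ.IsNHType) {K : Subgroup (GL (Fin 2) ℝ)}
    (h0 : scaledGamma0 (Γ.n * Γ.h) ≤ K) (hX : upperUni (1 / Γ.h) ∈ K) (hY : lowerUni Γ.n ∈ K)
    (hW : ∀ e ∈ Γ.E, ∀ e' : ℕ, ExactDvd e' (Γ.n * Γ.h) → (∀ q : ℕ, q.Prime → q ∣ e' → q ∣ e) →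
      ∀ g ∈ w (Γ.n * Γ.h) 1 e', g ∈ w Γ.n Γ.h e → g ∈ K) : Γ.group ≤ K := by
  intro g hg
  obtain ⟨e, he, hg⟩ := hΓ.mem_group_iff.mp hg
  obtain ⟨e', h1, h2, x, hx, hx'⟩ := hΓ.exists_atkinLehner he
  have hxK : x ∈ K := hW e he e' h1 h2 x hx hx'
  have : g * x ∈ w Γ.n Γ.h 1 := by
    have := mul_mem_w_star hΓ.h_pos hΓ.div_pos hΓ.n_eq (hΓ.exact e he).1 (hΓ.exact e he).1 hg hx'
    rwa [star_self (hΓ.pos_of_mem he)] at this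
  have := mem_of_mem_w_one hΓ.h_dvd_24 hΓ.h_pos hΓ.n_eq h0 hX hY this
  rwa [K.mul_mem_cancel_right hxK] at this

lemma scaledGamma0_le_group (hΓ : Γ.IsNHType) : scaledGamma0 (Γ.n * Γ.h) ≤ Γ.group := by
  intro g hg
  refine hΓ.mem_group_iff.mpr ⟨1, hΓ.one_mem, ?_⟩
  rw [mem_scaledGamma0_iff] at hg
  rw [mem_w_iff (m := Γ.n / Γ.h) hΓ.h_pos one_pos (by rw [mul_one]; exact hΓ.n_eq)]
  obtain ⟨a, b, c, d, hdet, hr⟩ := hg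
  have hh' : (Γ.h : ℝ) ≠ 0 := by have := hΓ.h_pos; positivity
  have hn : (Γ.n : ℤ) = Γ.h * ((Γ.n / Γ.h : ℕ) : ℤ) := by exact_mod_cast hΓ.n_eq
  refine ⟨a, b * Γ.h, c * Γ.h, d, ?_, hr.congr ?_⟩
  · push_cast at hdet hn ⊢
    linear_combination hdet + b * c * Γ.h * hn
  · apply of_congr <;> push_cast <;> field_simp

lemma upperUni_mem_group (hΓ : Γ.IsNHType) : upperUni (1 / Γ.h) ∈ Γ.group := by
  refine hΓ.mem_group_iff.mpr ⟨1, hΓ.one_mem, ?_⟩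
  rw [mem_w_iff (m := Γ.n / Γ.h) hΓ.h_pos one_pos (by rw [mul_one]; exact hΓ.n_eq)]
  exact ⟨1, 1, 0, 1, by simp, (represents_upperUni _).congr (by simp)⟩

lemma lowerUni_mem_group (hΓ : Γ.IsNHType) : lowerUni Γ.n ∈ Γ.group := by
  refine hΓ.mem_group_iff.mpr ⟨1, hΓ.one_mem, ?_⟩
  rw [mem_w_iff (m := Γ.n / Γ.h) hΓ.h_pos one_pos (by rw [mul_one]; exact hΓ.n_eq)]
  exact ⟨1, 0, 1, 1, by simp, (represents_lowerUni _).congr (by simp)⟩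

/-- Two homomorphisms on an `n|h`-type group agree if they agree on `Γ₀(nh)`, on the two standard
unipotent elements, and on Atkin–Lehner matrices. -/
lemma hom_ext (hΓ : Γ.IsNHType) {M : Type*} [Group M] {φ ψ : Γ.group →* M}
    (h0 : ∀ g : Γ.group, (g : GL (Fin 2) ℝ) ∈ scaledGamma0 (Γ.n * Γ.h) → φ g = ψ g)
    (hX : φ ⟨_, hΓ.upperUni_mem_group⟩ = ψ ⟨_, hΓ.upperUni_mem_group⟩)
    (hY : φ ⟨_, hΓ.lowerUni_mem_group⟩ = ψ ⟨_, hΓ.lowerUni_mem_group⟩)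
    (hW : ∀ e ∈ Γ.E, ∀ e' : ℕ, ExactDvd e' (Γ.n * Γ.h) → (∀ q : ℕ, q.Prime → q ∣ e' → q ∣ e) →
      ∀ g : Γ.group, (g : GL (Fin 2) ℝ) ∈ w (Γ.n * Γ.h) 1 e' → φ g = ψ g) : φ = ψ := by
  have key : Γ.group ≤ (φ.eqLocus ψ).map Γ.group.subtype := by
    refine hΓ.group_le ?_ ⟨_, hX, rfl⟩ ⟨_, hY, rfl⟩ ?_
    · exact fun g hg => ⟨⟨g, hΓ.scaledGamma0_le_group hg⟩, h0 _ hg, rfl⟩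
    · intro e he e' h1 h2 g hg hg'
      exact ⟨⟨g, hΓ.mem_group_iff.mpr ⟨e, he, hg'⟩⟩, hW e he e' h1 h2 _ hg, rfl⟩
  ext g
  obtain ⟨x, hx, hxg⟩ := key g.2
  rw [← Subtype.ext hxg]
  exact hx

end IsNHType

end NHSymbol

/-! ### Change of level and conjugation -/

lemma mem_w_of_mul {n h e m t : ℕ} (hh : 0 < h) (he : 0 < e) (hn : n = h * e * m)
    {g : GL (Fin 2) ℝ} (hg : g ∈ w (n * t) h e) : g ∈ w n h e := by
  rw [mem_w_iff (m := m * t) hh he (by rw [hn]; ring)] at hg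
  rw [mem_w_iff hh he hn]
  obtain ⟨a, b, c, d, hdet, hr⟩ := hg
  refine ⟨a, b, c * t, d, by push_cast at hdet; linear_combination hdet, hr.congr ?_⟩
  apply of_congr <;> push_cast <;> ring

lemma scaledGamma0_mul_le (N t : ℕ) : scaledGamma0 (N * t) ≤ scaledGamma0 N :=
  fun _ hg => mem_w_of_mul (m := N) one_pos one_pos (by simp) hg

/-- For e prime to P one has star (P·e) P = e, so conjugation by w_P preserves the index e. -/
lemma conj_mem_w {n h l P e : ℕ} (hh : 0 < h) (hl : 0 < l) (hn : n = h * l) (hP : P ∣ l)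
    (he : e ∣ l) (hPe : Nat.Coprime e P) {W g : GL (Fin 2) ℝ} (hW : W ∈ w n h P)
    (hg : g ∈ w n h e) : W * g * W⁻¹ ∈ w n h e := by
  have hP0 : 0 < P := Nat.pos_of_dvd_of_pos hP hl
  have h1 := mul_mem_w_star hh hl hn hP he hW hg
  rw [star_of_coprime hPe.symm] at h1
  obtain ⟨m, hm⟩ := hP
  have h2 : W⁻¹ ∈ w n h P := inv_mem_w hh hP0 (m := m) (by rw [hn, hm]; ring) hW
  have h3 := mul_mem_w_star hh hl hn (Nat.Coprime.mul_dvd_of_dvd_of_dvd hPe.symm ⟨m, hm⟩ he)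
    ⟨m, hm⟩ h1 h2
  have h4 : star (P * e) P = e := by
    have := star_mul_mul (e := e) (f := 1) hP0 (by simp)
    simpa using this
  rwa [h4] at h3

lemma conj_mem_w' {n h l P e : ℕ} (hh : 0 < h) (hl : 0 < l) (hn : n = h * l) (hP : P ∣ l)
    (he : e ∣ l) (hPe : Nat.Coprime e P) {W g : GL (Fin 2) ℝ} (hW : W ∈ w n h P)
    (hg : g ∈ w n h e) : W⁻¹ * g * W ∈ w n h e := by
  have hP0 : 0 < P := Nat.pos_of_dvd_of_pos hP hl
  obtain ⟨m, hm⟩ := hP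
  have h2 : W⁻¹ ∈ w n h P := inv_mem_w hh hP0 (m := m) (by rw [hn, hm]; ring) hW
  simpa using conj_mem_w hh hl hn ⟨m, hm⟩ he hPe h2 hg

namespace NHSymbol

variable {Γ : NHSymbol}

lemma mem_fixingGroup {lam : Γ.group →* rootsOfUnity Γ.h ℂ} {g : GL (Fin 2) ℝ} :
    g ∈ Γ.fixingGroup lam ↔ ∃ hg : g ∈ Γ.group, lam ⟨g, hg⟩ = 1 := by
  simp [fixingGroup, Subgroup.mem_map, MonoidHom.mem_ker]

lemma fixingGroup_le (lam : Γ.group →* rootsOfUnity Γ.h ℂ) : Γ.fixingGroup lam ≤ Γ.group :=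
  fun _ hg => (mem_fixingGroup.mp hg).1

/-- The zero diagonal forces m = 1 in the determinant equation, so the Fricke involution can only
lie in w_{n/h}. The sign in the Conway–Norton rule thereby becomes decidable from the symbol. -/
lemma IsNHType.hasFricke_iff (hΓ : Γ.IsNHType) : Γ.HasFricke ↔ Γ.n / Γ.h ∈ Γ.E := by
  constructor
  · rintro ⟨g, hg, r, hr, hgr⟩
    obtain ⟨e, he, hg⟩ := hΓ.mem_group_iff.mp hg
    obtain ⟨m, hm, -⟩ := hΓ.exists_decomp he
    have he0 := hΓ.pos_of_mem he
    obtain ⟨a, b, c, d, hdet, s, hs, hgs⟩ := (mem_w_iff hΓ.h_pos he0 hm).mp hg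
    have h00 : (0 : ℝ) = s * (a * e) := by
      have := congrFun (congrFun (hgr.symm.trans hgs) 0) 0
      simpa using this
    have ha : a = 0 := by
      have he' : (e : ℝ) ≠ 0 := by positivity
      have : (a : ℝ) = 0 := by
        rcases mul_eq_zero.mp h00.symm with h | h
        · exact absurd h hs
        · exact (mul_eq_zero.mp h).resolve_right he'
      exact_mod_cast this
    have hm1 : m = 1 := by
      have : (m : ℤ) ∣ 1 := ⟨-(b * c), by rw [← hdet, ha]; ring⟩
      exact Nat.dvd_one.mp (by exact_mod_cast this)
    rw [hm, hm1, mul_one, Nat.mul_div_cancel_left _ hΓ.h_pos]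
    exact he
  · intro hE
    have hh' : (Γ.h : ℝ) ≠ 0 := by have := hΓ.h_pos; positivity
    have hn' : (Γ.n : ℝ) ≠ 0 := by have := hΓ.n_pos; positivity
    refine ⟨gl 0 (-1) ((Γ.n * Γ.h : ℕ) : ℝ) 0 (by push_cast; simp [hh', hn']), ?_,
      represents_gl _⟩
    refine hΓ.mem_group_iff.mpr ⟨_, hE, ?_⟩
    rw [mem_w_iff (m := 1) hΓ.h_pos hΓ.div_pos (by rw [mul_one]; exact hΓ.n_eq)]
    refine ⟨0, -1, 1, 0, by simp, (represents_gl _).of_smul hh' ?_⟩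
    apply of_eq_smul <;> push_cast <;> field_simp <;> simp

namespace IsConwayNortonMap

variable {lam : Γ.group →* rootsOfUnity Γ.h ℂ}

lemma map_lowerUni (hlam : Γ.IsConwayNortonMap lam) (hΓ : Γ.IsNHType) :
    ((lam ⟨_, hΓ.lowerUni_mem_group⟩ : ℂˣ) : ℂ) =
      if Γ.n / Γ.h ∈ Γ.E then Complex.exp (2 * Real.pi * Complex.I / Γ.h)
      else Complex.exp (-(2 * Real.pi * Complex.I / Γ.h)) := by
  split_ifs with h
  · exact hlam.y_pos (hΓ.hasFricke_iff.mpr h) _ (represents_lowerUni _)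
  · exact hlam.y_neg (fun h' => h (hΓ.hasFricke_iff.mp h')) _ (represents_lowerUni _)

lemma scaledGamma0_le (hlam : Γ.IsConwayNortonMap lam) (hΓ : Γ.IsNHType) :
    scaledGamma0 (Γ.n * Γ.h) ≤ Γ.fixingGroup lam := fun _ hg =>
  mem_fixingGroup.mpr ⟨hΓ.scaledGamma0_le_group hg, hlam.gamma0 _ hg⟩

lemma map_eq_of_mul_inv_mem (hlam : Γ.IsConwayNortonMap lam) {x y : Γ.group}
    (h : (x : GL (Fin 2) ℝ) * (y : GL (Fin 2) ℝ)⁻¹ ∈ scaledGamma0 (Γ.n * Γ.h)) :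
    lam x = lam y := by
  have := hlam.gamma0 (x * y⁻¹) h
  rwa [map_mul, map_inv, mul_inv_eq_one] at this

lemma map_eq_of_inv_mul_mem (hlam : Γ.IsConwayNortonMap lam) {x y : Γ.group}
    (h : (x : GL (Fin 2) ℝ)⁻¹ * (y : GL (Fin 2) ℝ) ∈ scaledGamma0 (Γ.n * Γ.h)) :
    lam x = lam y := by
  have := hlam.gamma0 (x⁻¹ * y) h
  rwa [map_mul, map_inv, inv_mul_eq_one] at this

end IsConwayNortonMap

lemma IsNHType.group_le_of_subset {A : NHSymbol} (hA : A.IsNHType) (hΓ : Γ.IsNHType)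
    (hh : A.h = Γ.h) {t : ℕ} (hn : A.n = Γ.n * t) (hE : A.E ⊆ Γ.E) : A.group ≤ Γ.group := by
  intro g hg
  obtain ⟨e, he, hg⟩ := hA.mem_group_iff.mp hg
  obtain ⟨m, hm, -⟩ := hΓ.exists_decomp (hE he)
  rw [hh, hn] at hg
  exact hΓ.mem_group_iff.mpr ⟨e, hE he,
    mem_w_of_mul hΓ.h_pos (hΓ.pos_of_mem (hE he)) hm hg⟩

lemma coprime_of_prime_dvd_imp {e e' t : ℕ} (het : Nat.Coprime e t)
    (h : ∀ q : ℕ, q.Prime → q ∣ e' → q ∣ e) : Nat.Coprime e' t :=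
  Nat.coprime_of_dvd fun q hq h1 h2 => by
    have := Nat.dvd_gcd (h q hq h1) h2
    rw [het.gcd_eq_one] at this
    exact hq.one_lt.ne' (Nat.dvd_one.mp this)

/-- The eigenvalue maps of two `n|h`-type groups agree on a common `n|h`-type subgroup as soon as
their values at the lower unipotent generators match. -/
lemma IsConwayNortonMap.agree {A Γ Δ : NHSymbol} (hA : A.IsNHType) (hΓ : Γ.IsNHType)
    (hΔ : Δ.IsNHType) (hAn : A.n = Γ.n) (hAh : A.h = Γ.h) (hAE : A.E ⊆ Γ.E)
    (hΔh : A.h = Δ.h) {t : ℕ} (hΔn : A.n = Δ.n * t) (hΔE : A.E ⊆ Δ.E)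
    (hcop : ∀ e ∈ A.E, Nat.Coprime e t)
    {lam : Γ.group →* rootsOfUnity Γ.h ℂ} {mu : Δ.group →* rootsOfUnity Δ.h ℂ}
    (hlam : Γ.IsConwayNortonMap lam) (hmu : Δ.IsConwayNortonMap mu)
    (hy : ((lam ⟨_, hΓ.lowerUni_mem_group⟩ : ℂˣ) : ℂ) =
      ((mu ⟨_, hΔ.lowerUni_mem_group⟩ : ℂˣ) : ℂ) ^ t)
    {g : GL (Fin 2) ℝ} (hg : g ∈ A.group) (hgΓ : g ∈ Γ.group) (hgΔ : g ∈ Δ.group) :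
    (lam ⟨g, hgΓ⟩ : ℂˣ) = (mu ⟨g, hgΔ⟩ : ℂˣ) := by
  have hAΓ : A.group ≤ Γ.group :=
    hA.group_le_of_subset hΓ hAh (t := 1) (by rw [hAn, mul_one]) hAE
  have hAΔ : A.group ≤ Δ.group := hA.group_le_of_subset hΔ hΔh hΔn hΔE
  obtain ⟨φ, hφ⟩ : ∃ φ : A.group →* ℂˣ, ∀ x, φ x = (lam (Subgroup.inclusion hAΓ x) : ℂˣ) :=
    ⟨(rootsOfUnity Γ.h ℂ).subtype.comp (lam.comp (Subgroup.inclusion hAΓ)), fun _ => rfl⟩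
  obtain ⟨ψ, hψ⟩ : ∃ ψ : A.group →* ℂˣ, ∀ x, ψ x = (mu (Subgroup.inclusion hAΔ x) : ℂˣ) :=
    ⟨(rootsOfUnity Δ.h ℂ).subtype.comp (mu.comp (Subgroup.inclusion hAΔ)), fun _ => rfl⟩
  have hNΓ : A.n * A.h = Γ.n * Γ.h := by rw [hAn, hAh]
  have hNΔ : A.n * A.h = Δ.n * Δ.h * t := by rw [hΔn, hΔh]; ring
  have key : φ = ψ := by
    refine hA.hom_ext ?_ ?_ ?_ ?_
    · intro x hx
      have h1 : lam (Subgroup.inclusion hAΓ x) = 1 := hlam.gamma0 _ (by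
        rw [Subgroup.coe_inclusion, ← hNΓ]; exact hx)
      have h2 : mu (Subgroup.inclusion hAΔ x) = 1 :=
        hmu.gamma0 _ (by
          rw [Subgroup.coe_inclusion]
          rw [hNΔ] at hx
          exact scaledGamma0_mul_le _ t hx)
      rw [hφ, hψ, h1, h2, OneMemClass.coe_one, OneMemClass.coe_one]
    · apply Units.ext
      have h1 := hlam.x (Subgroup.inclusion hAΓ ⟨_, hA.upperUni_mem_group⟩)
        (by rw [← hAh]; exact represents_upperUni _)
      have h2 := hmu.x (Subgroup.inclusion hAΔ ⟨_, hA.upperUni_mem_group⟩)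
        (by rw [← hΔh]; exact represents_upperUni _)
      have hc : (Γ.h : ℂ) = (Δ.h : ℂ) := by rw [← hAh, hΔh]
      rw [hc] at h1
      rw [hφ, hψ, h1, h2]
    · apply Units.ext
      have h1 : Subgroup.inclusion hAΓ ⟨_, hA.lowerUni_mem_group⟩ =
          ⟨_, hΓ.lowerUni_mem_group⟩ := Subtype.ext (by simp [hAn])
      -- The lower generator of A is the t-th power of that of Δ, whence the exponent t in `hy`.
      have h2 : Subgroup.inclusion hAΔ ⟨_, hA.lowerUni_mem_group⟩ =
          ⟨_, hΔ.lowerUni_mem_group⟩ ^ t := Subtype.ext (by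
        have := lowerUni_zpow Δ.n t
        rw [zpow_natCast] at this
        simp [this, hΔn, mul_comm])
      rw [hφ, hψ, h1, h2, map_pow, SubmonoidClass.coe_pow, Units.val_pow_eq_pow_val]
      exact hy
    · intro e he e' h1 h2 x hx
      have h3 : lam (Subgroup.inclusion hAΓ x) = 1 :=
        hlam.atkinLehner e' (hNΓ ▸ h1) (fun q hq hd =>
          (h2 q hq hd).trans (hΓ.exact e (hAE he)).1) _
          (by rw [Subgroup.coe_inclusion, ← hNΓ]; exact hx)
      -- Being prime to t, e' stays an exact divisor at the lower level, so the rule for Δ applies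
      -- to the same matrix.
      have hc : Nat.Coprime e' t := coprime_of_prime_dvd_imp (hcop e he) h2
      have hd : e' ∣ Δ.n * Δ.h := hc.dvd_of_dvd_mul_right (hNΔ ▸ h1.1)
      have hN0 : 0 < Δ.n * Δ.h := Nat.mul_pos hΔ.n_pos hΔ.h_pos
      have he'0 : 0 < e' := Nat.pos_of_dvd_of_pos hd hN0
      have h4 : mu (Subgroup.inclusion hAΔ x) = 1 := by
        refine hmu.atkinLehner e' ⟨hd, ?_⟩ (fun q hq hd =>
          (h2 q hq hd).trans (hΔ.exact e (hΔE he)).1) _ ?_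
        · refine Nat.Coprime.coprime_dvd_right ?_ h1.2
          rw [hNΔ]
          exact Nat.div_dvd_div (hd) (dvd_mul_right _ _)
        · obtain ⟨m, hm⟩ := hd
          refine mem_w_of_mul (t := t) (m := m) one_pos he'0 (by rw [one_mul, hm]) ?_
          rw [← hNΔ, Subgroup.coe_inclusion]
          exact hx
      rw [hφ, hψ, h3, h4, OneMemClass.coe_one, OneMemClass.coe_one]
  have := DFunLike.congr_fun key ⟨g, hg⟩
  rw [hφ, hψ, show Subgroup.inclusion hAΓ ⟨g, hg⟩ = ⟨g, hgΓ⟩ from rfl,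
    show Subgroup.inclusion hAΔ ⟨g, hg⟩ = ⟨g, hgΔ⟩ from rfl] at this
  exact this

/-! ### Conjugation by Atkin–Lehner matrices -/

section Conj

variable {P n' : ℕ} {B D : ℤ}

lemma exists_mul_of_det (hΓ : Γ.IsNHType) (hn : Γ.n = P * n')
    (hBD : (P : ℤ) * D - B * (n' * Γ.h) = 1) : ∃ l : ℕ, n' = Γ.h * l := by
  have : IsCoprime (P : ℤ) (Γ.h : ℤ) := ⟨D, -(B * n'), by linear_combination hBD⟩
  have hc : Nat.Coprime Γ.h P := (Nat.isCoprime_iff_coprime.mp this).symm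
  exact hc.dvd_of_dvd_mul_left (hn ▸ hΓ.h_dvd.trans (Nat.gcd_dvd_left _ _))

lemma atkinLehner_mem_w (hΓ : Γ.IsNHType) (hn : Γ.n = P * n') (hP : 0 < P)
    (hBD : (P : ℤ) * D - B * (n' * Γ.h) = 1) {W : GL (Fin 2) ℝ}
    (hW : Represents W !![(P : ℝ), (B : ℝ); P * (n' * Γ.h), P * D]) : W ∈ w Γ.n Γ.h P := by
  obtain ⟨l, rfl⟩ := exists_mul_of_det hΓ hn hBD
  have hh' : (Γ.h : ℝ) ≠ 0 := by have := hΓ.h_pos; positivity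
  rw [mem_w_iff (m := l) hΓ.h_pos hP (by rw [hn]; ring)]
  refine ⟨1, B * Γ.h, Γ.h, D, ?_, hW.congr ?_⟩
  · push_cast at hBD
    linear_combination hBD
  · rw [hn]
    apply of_congr <;> push_cast <;> field_simp

lemma atkinLehner_mem_w_level {P M : ℕ} {B D : ℤ} (hP : 0 < P)
    (hBD : (P : ℤ) * D - B * M = 1) {W : GL (Fin 2) ℝ}
    (hW : Represents W !![(P : ℝ), (B : ℝ); P * M, P * D]) : W ∈ w (P * M) 1 P := by
  rw [mem_w_iff (m := M) one_pos hP (by ring)]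
  refine ⟨1, B, 1, D, by linear_combination hBD, hW.congr ?_⟩
  apply of_congr <;> push_cast <;> ring

lemma conj_mem_group (hΓ : Γ.IsNHType) (hn : Γ.n = P * n') (hP : 0 < P)
    (hcop : ∀ e ∈ Γ.E, Nat.Coprime e P)
    (hBD : (P : ℤ) * D - B * (n' * Γ.h) = 1) {W : GL (Fin 2) ℝ}
    (hW : Represents W !![(P : ℝ), (B : ℝ); P * (n' * Γ.h), P * D]) {g : GL (Fin 2) ℝ}
    (hg : g ∈ Γ.group) : W * g * W⁻¹ ∈ Γ.group ∧ W⁻¹ * g * W ∈ Γ.group := by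
  have hWw := atkinLehner_mem_w hΓ hn hP hBD hW
  obtain ⟨l, hl⟩ := exists_mul_of_det hΓ hn hBD
  obtain ⟨e, he, hg⟩ := hΓ.mem_group_iff.mp hg
  have hPd : P ∣ Γ.n / Γ.h :=
    ⟨l, by rw [hn, hl, Nat.div_eq_of_eq_mul_right hΓ.h_pos]; ring⟩
  exact ⟨hΓ.mem_group_iff.mpr ⟨e, he, conj_mem_w hΓ.h_pos hΓ.div_pos hΓ.n_eq hPd
    (hΓ.exact e he).1 (hcop e he) hWw hg⟩, hΓ.mem_group_iff.mpr ⟨e, he, conj_mem_w' hΓ.h_pos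
    hΓ.div_pos hΓ.n_eq hPd (hΓ.exact e he).1 (hcop e he) hWw hg⟩⟩

/-- Conjugation by `W_P` raises the eigenvalue map to the power `P`. -/
lemma IsConwayNortonMap.map_conj {lam : Γ.group →* rootsOfUnity Γ.h ℂ}
    (hlam : Γ.IsConwayNortonMap lam) (hΓ : Γ.IsNHType) (hn : Γ.n = P * n') (hP : 0 < P)
    (hcop : ∀ e ∈ Γ.E, Nat.Coprime e P)
    (hBD : (P : ℤ) * D - B * (n' * Γ.h) = 1) {W : GL (Fin 2) ℝ}
    (hW : Represents W !![(P : ℝ), (B : ℝ); P * (n' * Γ.h), P * D]) {g : GL (Fin 2) ℝ}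
    (hg : g ∈ Γ.group) (hg' : W * g * W⁻¹ ∈ Γ.group) :
    lam ⟨W * g * W⁻¹, hg'⟩ = lam ⟨g, hg⟩ ^ P := by
  obtain ⟨l, hl⟩ := exists_mul_of_det hΓ hn hBD
  have hh0 := hΓ.h_pos
  have hh' : (Γ.h : ℝ) ≠ 0 := by positivity
  have hP' : (P : ℝ) ≠ 0 := by positivity
  have hn'0 : 0 < n' := Nat.pos_of_ne_zero fun h => by
    have := hΓ.n_pos
    rw [hn, h] at this
    simp at this
  have hN : Γ.n * Γ.h = P * (n' * Γ.h) := by rw [hn]; ring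
  have hW' : Represents W !![(P : ℝ), (B : ℝ); P * ((n' * Γ.h : ℕ) : ℝ), P * D] := by
    push_cast; exact hW
  have hWN : W ∈ w (Γ.n * Γ.h) 1 P := by
    rw [hN]; exact atkinLehner_mem_w_level hP (by push_cast; exact hBD) hW'
  have hconj {e : ℕ} (he : e ∣ Γ.n * Γ.h) (hc : Nat.Coprime e P) {x : GL (Fin 2) ℝ}
      (hx : x ∈ w (Γ.n * Γ.h) 1 e) : W * x * W⁻¹ ∈ w (Γ.n * Γ.h) 1 e :=
    conj_mem_w one_pos (Nat.mul_pos hΓ.n_pos hh0) (by rw [one_mul]) (hN ▸ dvd_mul_right _ _) he hc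
      hWN hx
  obtain ⟨c, hc⟩ : ∃ c : Γ.group →* Γ.group,
      ∀ x : Γ.group, ((c x : Γ.group) : GL (Fin 2) ℝ) = W * x * W⁻¹ :=
    ⟨MonoidHom.mk' (fun x => ⟨W * x * W⁻¹, (conj_mem_group hΓ hn hP hcop hBD hW x.2).1⟩)
      fun x y => Subtype.ext (by simp [mul_assoc]), fun x => rfl⟩
  have hBDr : (P : ℝ) * D - B * (n' * Γ.h) = 1 := by exact_mod_cast hBD
  have hlr : (n' : ℝ) = Γ.h * l := by exact_mod_cast hl
  have hnr : (Γ.n : ℝ) = P * n' := by exact_mod_cast hn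
  have key : lam.comp c = (powMonoidHom P).comp lam := by
    refine hΓ.hom_ext ?_ ?_ ?_ ?_
    · intro x hx
      have h1 : lam (c x) = 1 := hlam.gamma0 (c x) (by
        rw [hc]; exact hconj (one_dvd _) (by simp) hx)
      simp [h1, hlam.gamma0 x hx]
    · rw [MonoidHom.comp_apply, MonoidHom.comp_apply, powMonoidHom_apply, ← map_pow]
      refine hlam.map_eq_of_mul_inv_mem ?_
      have hpow : ((⟨_, hΓ.upperUni_mem_group⟩ ^ P : Γ.group) : GL (Fin 2) ℝ)⁻¹ =
          upperUni ((-P : ℤ) * (1 / Γ.h)) := by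
        rw [← upperUni_zpow]; simp
      rw [hc, hpow, mem_scaledGamma0_iff]
      refine ⟨1 - P * n', P ^ 2 * l, -n', 1 + P * n' + P ^ 2 * n' ^ 2, ?_,
        ((((hW.mul_of (represents_upperUni _)).mul_of hW.inv).mul_of
          (represents_upperUni _)).of_smul hP' ?_)⟩
      · push_cast
        rw [show (Γ.n : ℤ) = P * n' by exact_mod_cast hn]
        have : (n' : ℤ) = Γ.h * l := by exact_mod_cast hl
        linear_combination (-P ^ 3 * n' ^ 2 : ℤ) * this
      · apply of_eq_smul <;> push_cast <;> simp only [hnr, hlr] at hBDr ⊢ <;> field_simp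
        · linear_combination (P * Γ.h : ℝ) * hBDr
        · linear_combination (-P ^ 2 : ℝ) * hBDr
        · ring
        · linear_combination (Γ.h : ℝ) * hBDr
    · rw [MonoidHom.comp_apply, MonoidHom.comp_apply, powMonoidHom_apply, ← map_pow]
      refine (hlam.map_eq_of_inv_mul_mem ?_).symm
      -- Conjugating y = (1,0;n,1) by W multiplies its lower entry by PD². As D is a unit modulo h,
      -- this agrees with the entry Pn of y^P modulo nh.
      obtain ⟨t, ht⟩ := dvd_sq_sub_one hΓ.h_dvd_24 (a := D)
        ⟨P, -(B * n'), by linear_combination hBD⟩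
      have htr : (D : ℝ) ^ 2 = 1 + Γ.h * t := by
        have : D ^ 2 = 1 + Γ.h * t := by linear_combination ht
        exact_mod_cast this
      have hpow : ((⟨_, hΓ.lowerUni_mem_group⟩ ^ P : Γ.group) : GL (Fin 2) ℝ)⁻¹ =
          lowerUni ((-P : ℤ) * Γ.n) := by
        rw [← lowerUni_zpow]; simp
      rw [hc, hpow, mem_scaledGamma0_iff]
      refine ⟨1 + B * D * P * n', -(B ^ 2 * n'), P * (t - B * D * P * l),
        1 - B * D * P * n' + P * (P * n') * B ^ 2 * n', ?_,
        (((represents_lowerUni _).mul_of ((hW.mul_of (represents_lowerUni _)).mul_of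
          hW.inv)).of_smul hP' ?_)⟩
      · push_cast
        rw [show (Γ.n : ℤ) = P * n' by exact_mod_cast hn]
        have : (n' : ℤ) = Γ.h * l := by exact_mod_cast hl
        linear_combination (-P ^ 2 * n' ^ 2 * B ^ 2 : ℤ) * ht +
          (P ^ 3 * n' ^ 2 * B ^ 3 * D : ℤ) * this
      · apply of_eq_smul <;> push_cast <;> simp only [hnr, hlr] at hBDr ⊢
        · linear_combination (P : ℝ) * hBDr
        · ring
        · linear_combination (P ^ 3 * Γ.h * l : ℝ) * htr - (P ^ 3 * Γ.h * l : ℝ) * hBDr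
        · linear_combination (P : ℝ) * hBDr
    · intro e he e' h1 h2 x hx
      have hc' : Nat.Coprime e' P := coprime_of_prime_dvd_imp (hcop e he) h2
      have hq (q : ℕ) (hq : q.Prime) (hd : q ∣ e') : q ∣ Γ.n / Γ.h :=
        (h2 q hq hd).trans (hΓ.exact e he).1
      have h3 : lam (c x) = 1 := hlam.atkinLehner e' h1 hq (c x) (by
        rw [hc]; exact hconj h1.1 hc' hx)
      simp [h3, hlam.atkinLehner e' h1 hq x hx]
  have hfin := DFunLike.congr_fun key ⟨g, hg⟩
  rw [MonoidHom.comp_apply, MonoidHom.comp_apply, powMonoidHom_apply] at hfin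
  rw [← hfin]
  exact congrArg lam (Subtype.ext (hc ⟨g, hg⟩).symm)

/-- For W⁻¹gW only the P-th power of the eigenvalue is seen to be 1; but the eigenvalue is an h-th
root of unity and P is prime to h. -/
lemma IsConwayNortonMap.conj_mem_fixingGroup {lam : Γ.group →* rootsOfUnity Γ.h ℂ}
    (hlam : Γ.IsConwayNortonMap lam) (hΓ : Γ.IsNHType) (hn : Γ.n = P * n') (hP : 0 < P)
    (hcop : ∀ e ∈ Γ.E, Nat.Coprime e P)
    (hBD : (P : ℤ) * D - B * (n' * Γ.h) = 1) {W : GL (Fin 2) ℝ}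
    (hW : Represents W !![(P : ℝ), (B : ℝ); P * (n' * Γ.h), P * D]) {g : GL (Fin 2) ℝ}
    (hg : g ∈ Γ.fixingGroup lam) :
    W * g * W⁻¹ ∈ Γ.fixingGroup lam ∧ W⁻¹ * g * W ∈ Γ.fixingGroup lam := by
  obtain ⟨hg, hg1⟩ := mem_fixingGroup.mp hg
  obtain ⟨h1, h2⟩ := conj_mem_group hΓ hn hP hcop hBD hW hg
  refine ⟨mem_fixingGroup.mpr ⟨h1, ?_⟩, mem_fixingGroup.mpr ⟨h2, ?_⟩⟩
  · rw [hlam.map_conj hΓ hn hP hcop hBD hW hg h1, hg1, one_pow]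
  · have h3 : W * (W⁻¹ * g * W) * W⁻¹ = g := by group
    have h4 := hlam.map_conj hΓ hn hP hcop hBD hW h2 (by rw [h3]; exact hg)
    simp only [h3, hg1] at h4
    have h5 : lam ⟨_, h2⟩ ^ Γ.h = 1 := Subtype.ext (lam ⟨_, h2⟩).2
    have hc : Nat.Coprime P Γ.h := Nat.isCoprime_iff_coprime.mp
      ⟨D, -(B * n'), by linear_combination hBD⟩
    have := pow_gcd_eq_one.mpr ⟨h4.symm, h5⟩
    rwa [hc.gcd_eq_one, pow_one] at this

end Conj

end NHSymbol

/-! ### Boundedness at cusps in weight zero -/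

/-- In weight 0 the slash action leaves a factor |det|⁻¹ and possibly a complex conjugation, neither
of which affects boundedness. -/
lemma isBoundedAt_zero_iff {c : OnePoint ℝ} {f : ℍ → ℂ} :
    c.IsBoundedAt f 0 ↔ ∀ g : GL (Fin 2) ℝ, g • OnePoint.infty = c →
      IsBoundedAtImInfty fun τ => f (g • τ) := by
  refine forall_congr' fun g => imp_congr_right fun _ => ?_
  have hd : |(g.det : ℝ)| ≠ 0 := abs_ne_zero.mpr g.det.ne_zero
  have hnorm : ∀ τ : ℍ, ‖(f ∣[(0 : ℤ)] g) τ‖ = |(g.det : ℝ)|⁻¹ * ‖f (g • τ)‖ := fun τ => by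
    rw [ModularForm.slash_apply]
    simp [mul_comm]
  simp only [isBoundedAtImInfty_iff, hnorm]
  constructor
  · rintro ⟨M, A, h⟩
    refine ⟨|(g.det : ℝ)| * M, A, fun z hz => ?_⟩
    have := mul_le_mul_of_nonneg_left (h z hz) (abs_nonneg (g.det : ℝ))
    rwa [mul_inv_cancel_left₀ hd] at this
  · rintro ⟨M, A, h⟩
    exact ⟨|(g.det : ℝ)|⁻¹ * M, A, fun z hz => mul_le_mul_of_nonneg_left (h z hz) (by positivity)⟩

lemma isBoundedAt_comp_smul {c : OnePoint ℝ} {f : ℍ → ℂ} (g : GL (Fin 2) ℝ) :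
    c.IsBoundedAt (fun τ => f (g • τ)) 0 ↔ (g • c).IsBoundedAt f 0 := by
  simp only [isBoundedAt_zero_iff]
  constructor
  · intro h x hx
    have := h (g⁻¹ * x) (by rw [mul_smul, hx, inv_smul_smul])
    simpa [mul_smul] using this
  · intro h x hx
    have := h (g * x) (by rw [mul_smul, hx])
    simpa [mul_smul] using this

lemma isBoundedAt_infty_of_bounded {f : ℍ → ℂ} (h : IsBoundedAtImInfty f) :
    OnePoint.infty.IsBoundedAt f 0 := OnePoint.isBoundedAt_infty_iff.mpr h

lemma isBoundedAt_const (c : OnePoint ℝ) (C : ℂ) : c.IsBoundedAt (fun _ => C) 0 :=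
  isBoundedAt_zero_iff.mpr fun _ _ => isBoundedAtImInfty_iff.mpr ⟨‖C‖, 0, fun _ _ => le_rfl⟩

lemma isBoundedAt_add {c : OnePoint ℝ} {f f' : ℍ → ℂ} (hf : c.IsBoundedAt f 0)
    (hf' : c.IsBoundedAt f' 0) : c.IsBoundedAt (fun τ => f τ + f' τ) 0 := hf.add hf'

lemma isBoundedAt_neg {c : OnePoint ℝ} {f : ℍ → ℂ} (hf : c.IsBoundedAt f 0) :
    c.IsBoundedAt (fun τ => -f τ) 0 := by
  rw [isBoundedAt_zero_iff] at hf ⊢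
  simpa only [isBoundedAtImInfty_iff, norm_neg] using hf

lemma isBoundedAt_sub {c : OnePoint ℝ} {f f' : ℍ → ℂ} (hf : c.IsBoundedAt f 0)
    (hf' : c.IsBoundedAt f' 0) : c.IsBoundedAt (fun τ => f τ - f' τ) 0 := by
  simpa only [sub_eq_add_neg] using isBoundedAt_add hf (isBoundedAt_neg hf')

lemma isBoundedAt_sum {ι : Type*} {c : OnePoint ℝ} {s : Finset ι} {f : ι → ℍ → ℂ}
    (hf : ∀ i ∈ s, c.IsBoundedAt (f i) 0) : c.IsBoundedAt (fun τ => ∑ i ∈ s, f i τ) 0 := by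
  classical
  induction s using Finset.induction_on with
  | empty => simpa using isBoundedAt_const c 0
  | insert i s hi ih =>
    simp only [Finset.sum_insert hi]
    exact isBoundedAt_add (hf i (by simp)) (ih fun j hj => hf j (by simp [hj]))

lemma isBoundedAt_smul_of_invariant {c : OnePoint ℝ} {f : ℍ → ℂ} {g : GL (Fin 2) ℝ}
    (hf : ∀ τ, f (g • τ) = f τ) (hc : c.IsBoundedAt f 0) : (g • c).IsBoundedAt f 0 := by
  rw [← isBoundedAt_comp_smul]
  simpa only [hf] using hc

/-! ### Functions on `Γ₀(N)` -/

lemma mapGL_mem_scaledGamma0 {N : ℕ} {γ : SL(2, ℤ)} (hγ : γ ∈ CongruenceSubgroup.Gamma0 N) :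
    (SpecialLinearGroup.mapGL ℝ γ) ∈ scaledGamma0 N := by
  rw [CongruenceSubgroup.Gamma0_mem, ZMod.intCast_zmod_eq_zero_iff_dvd] at hγ
  obtain ⟨c, hc⟩ := hγ
  have hdet := γ.det_coe
  rw [Matrix.det_fin_two] at hdet
  rw [mem_scaledGamma0_iff]
  refine ⟨γ 0 0, γ 0 1, c, γ 1 1, ?_, 1, one_ne_zero, ?_⟩
  · rw [hc] at hdet
    linear_combination hdet
  · rw [one_smul]
    have hc' : ((γ 1 0 : ℤ) : ℝ) = c * N := by rw [hc]; push_cast; ring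
    ext i j
    fin_cases i <;> fin_cases j <;> simp [hc']

/-- Γ₀(N) is arithmetic, so it has the same cusps as SL₂(ℤ), and a larger group keeps them. -/
lemma isCusp_of_scaledGamma0_le {N : ℕ} (hN : 0 < N) {G : Subgroup (GL (Fin 2) ℝ)}
    (hG : scaledGamma0 N ≤ G) {c : OnePoint ℝ} (hc : IsCusp c 𝒮ℒ) : IsCusp c G := by
  have : NeZero N := ⟨hN.ne'⟩
  have hc' := (Subgroup.IsArithmetic.isCusp_iff_isCusp_SL2Z
    ((CongruenceSubgroup.Gamma0 N : Subgroup SL(2, ℤ)) : Subgroup (GL (Fin 2) ℝ))).mpr hc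
  refine hc'.mono ?_
  rintro _ ⟨γ, hγ, rfl⟩
  exact hG (mapGL_mem_scaledGamma0 hγ)

/-- A holomorphic `Γ₀(N)`-invariant function that is bounded at all cusps is constant. -/
theorem exists_eq_const {N : ℕ} (hN : 0 < N) {F : ℍ → ℂ} (hF : MDifferentiable 𝓘(ℂ) 𝓘(ℂ) F)
    (hinv : ∀ g ∈ scaledGamma0 N, ∀ τ, F (g • τ) = F τ)
    (hbdd : ∀ c, IsCusp c 𝒮ℒ → c.IsBoundedAt F 0) : ∃ C, ∀ τ, F τ = C := by
  have : NeZero N := ⟨hN.ne'⟩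
  let f : ModularForm ((CongruenceSubgroup.Gamma0 N : Subgroup SL(2, ℤ)) :
      Subgroup (GL (Fin 2) ℝ)) 0 :=
    { toFun := F
      slash_action_eq' := by
        rintro _ ⟨γ, hγ, rfl⟩
        ext τ
        rw [ModularForm.slash_apply, hinv _ (mapGL_mem_scaledGamma0 hγ)]
        simp [σ]
      holo' := hF
      bdd_at_cusps' := fun hc =>
        hbdd _ ((Subgroup.IsArithmetic.isCusp_iff_isCusp_SL2Z _).mp hc) }
  obtain ⟨C, hC⟩ := ModularForm.eq_const_of_weight_zero f
  exact ⟨C, fun τ => congrFun hC τ⟩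

/-- A holomorphic function that is invariant under a group `H ⊇ Γ₀(N)`, bounded at `∞` and at all
cusps that are not equivalent to `∞`, is constant. -/
theorem exists_eq_const_of_group {N : ℕ} (hN : 0 < N) {H : Subgroup (GL (Fin 2) ℝ)}
    (hH : scaledGamma0 N ≤ H) {F : ℍ → ℂ} (hF : MDifferentiable 𝓘(ℂ) 𝓘(ℂ) F)
    (hinv : ∀ g ∈ H, ∀ τ, F (g • τ) = F τ) (hinfty : OnePoint.infty.IsBoundedAt F 0)
    (hbdd : ∀ c, IsCusp c 𝒮ℒ → (∀ g ∈ H, g • OnePoint.infty ≠ c) → c.IsBoundedAt F 0) :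
    ∃ C, ∀ τ, F τ = C := by
  refine exists_eq_const hN hF (fun g hg => hinv g (hH hg)) fun c hc => ?_
  by_cases h : ∀ g ∈ H, g • OnePoint.infty ≠ c
  · exact hbdd c hc h
  · push Not at h
    obtain ⟨g, hg, rfl⟩ := h
    exact isBoundedAt_smul_of_invariant (hinv g hg) hinfty

lemma mdifferentiable_comp_smul {F : ℍ → ℂ} (hF : MDifferentiable 𝓘(ℂ) 𝓘(ℂ) F)
    {g : GL (Fin 2) ℝ} (hg : 0 < g.det.val) :
    MDifferentiable 𝓘(ℂ) 𝓘(ℂ) fun τ => F (g • τ) :=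
  hF.comp (mdifferentiable_smul hg)

lemma mdifferentiable_sum_comp_smul {ι : Type} {s : Finset ι} {F : ℍ → ℂ}
    (hF : MDifferentiable 𝓘(ℂ) 𝓘(ℂ) F) {g : ι → GL (Fin 2) ℝ}
    (hg : ∀ i ∈ s, 0 < (g i).det.val) :
    MDifferentiable 𝓘(ℂ) 𝓘(ℂ) fun τ => ∑ i ∈ s, F (g i • τ) := by
  have := MDifferentiable.sum (t := s) (f := fun i τ => F (g i • τ))
    fun i hi => mdifferentiable_comp_smul hF (hg i hi)
  convert this using 1
  ext τ
  simp

/-- The sum of the translates of an invariant function over coset representatives is invariant. -/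
lemma sum_smul_eq_of_cosets {X ι A : Type*} [MulAction (GL (Fin 2) ℝ) X] [AddCommMonoid A]
    {s : Finset ι} {F : X → A} {K : Subgroup (GL (Fin 2) ℝ)}
    (hF : ∀ k ∈ K, ∀ x, F (k • x) = F x) {rep : ι → GL (Fin 2) ℝ}
    (hinj : ∀ i ∈ s, ∀ j ∈ s, rep i * (rep j)⁻¹ ∈ K → i = j) {k₀ g : GL (Fin 2) ℝ}
    (hk₀ : ∀ x, F (k₀ • x) = F x) (hnorm : ∀ k ∈ K, k₀ * k * k₀⁻¹ ∈ K)
    (hcover : ∀ i ∈ s, ∃ j ∈ s, k₀⁻¹ * rep i * g * (rep j)⁻¹ ∈ K) (x : X) :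
    ∑ i ∈ s, F (rep i • g • x) = ∑ i ∈ s, F (rep i • x) := by
  classical
  -- Translation by g permutes the cosets: rep i · g = k₀ k rep (σ i) with k ∈ K. Injectivity of σ
  -- holds because k₀ normalizes K and the representatives are inequivalent.
  choose! σ hσs hσ using hcover
  have hterm : ∀ i ∈ s, F (rep i • g • x) = F (rep (σ i) • x) := fun i hi => by
    have h1 := hF _ (hσ i hi) (rep (σ i) • x)
    have h2 := hk₀ ((k₀⁻¹ * rep i * g * (rep (σ i))⁻¹) • rep (σ i) • x)
    rw [← h1, ← h2]
    simp only [smul_smul]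
    congr 2
    group
  rw [Finset.sum_congr rfl hterm]
  have hinj' : Set.InjOn σ s := fun i hi j hj hij => by
    refine hinj i hi j hj ?_
    have h1 := hσ i hi
    rw [hij] at h1
    have := hnorm _ (K.mul_mem h1 (K.inv_mem (hσ j hj)))
    convert this using 1
    group
  have himg : s.image σ = s := by
    refine Finset.eq_of_subset_of_card_le (fun j hj => ?_) ?_
    · obtain ⟨i, hi, rfl⟩ := Finset.mem_image.mp hj
      exact hσs i hi
    · rw [Finset.card_image_of_injOn hinj']
  conv_rhs => rw [← himg, Finset.sum_image hinj']

/-! ### The operator `U_p` -/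

/-- The matrix `(1, μ; 0, p)`. -/
noncomputable def upMat {p : ℕ} (hp : 0 < p) (μ : ℕ) : GL (Fin 2) ℝ :=
  gl 1 μ 0 p (by simp; omega)

lemma represents_upMat {p : ℕ} (hp : 0 < p) (μ : ℕ) :
    Represents (upMat hp μ) !![1, (μ : ℝ); 0, (p : ℝ)] := represents_gl _

lemma det_upMat_pos {p : ℕ} (hp : 0 < p) (μ : ℕ) : 0 < (upMat hp μ).det.val := by
  simp [upMat, Matrix.det_fin_two_of, hp]

lemma coe_upMat_smul {p : ℕ} (hp : 0 < p) (μ : ℕ) (τ : ℍ) :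
    ((upMat hp μ • τ : ℍ) : ℂ) = ((τ : ℂ) + μ) / p := by
  rw [coe_smul_of_det_pos (det_upMat_pos hp μ)]
  simp [num, denom, upMat]

lemma mul_U_apply {p : ℕ} (hp : 0 < p) (f : ℍ → ℂ) (τ : ℍ) :
    (p : ℂ) * U p f τ = ∑ μ ∈ Finset.range p, f (upMat hp μ • τ) := by
  have hp' : (p : ℂ) ≠ 0 := by exact_mod_cast hp.ne'
  rw [U, ← mul_assoc, mul_one_div_cancel hp', one_mul]
  refine Finset.sum_congr rfl fun μ _ => ?_
  -- The argument lies in ℍ, so the default value of `ofComplex` never enters.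
  rw [← coe_upMat_smul hp, ofComplex_apply]

lemma upMat_smul_infty {p : ℕ} (hp : 0 < p) (μ : ℕ) :
    upMat hp μ • (OnePoint.infty : OnePoint ℝ) = OnePoint.infty :=
  OnePoint.smul_infty_eq_self_iff.mpr (by simp [upMat])

lemma tendsto_mul_U {p : ℕ} (hp : 0 < p) {f : ℍ → ℂ} (hf : Tendsto f atImInfty (𝓝 0)) :
    Tendsto (fun τ => (p : ℂ) * U p f τ) atImInfty (𝓝 0) := by
  simp only [mul_U_apply hp]
  rw [show (0 : ℂ) = ∑ μ ∈ Finset.range p, 0 by simp]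
  refine tendsto_finsetSum _ fun μ _ => hf.comp (tendsto_smul_atImInfty ?_)
  simp [upMat]

lemma tendsto_exp_atImInfty :
    Tendsto (fun τ : ℍ => Complex.exp (2 * Real.pi * Complex.I * τ)) atImInfty (𝓝 0) := by
  have := qParam_tendsto_atImInfty (h := 1) one_pos
  simpa [Function.Periodic.qParam] using this

namespace IsHauptmodul

variable {G : Subgroup (GL (Fin 2) ℝ)} {T : ℍ → ℂ}

lemma tendsto_sub_exp (hT : IsHauptmodul G T) :
    Tendsto (fun τ : ℍ => T τ - Complex.exp (-(2 * Real.pi * Complex.I * τ))) atImInfty (𝓝 0) :=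
  hT.normalized.trans_tendsto tendsto_exp_atImInfty

lemma tendsto_sub {G' : Subgroup (GL (Fin 2) ℝ)} {T' : ℍ → ℂ} (hT : IsHauptmodul G T)
    (hT' : IsHauptmodul G' T') : Tendsto (fun τ => T τ - T' τ) atImInfty (𝓝 0) := by
  simpa using hT.tendsto_sub_exp.sub hT'.tendsto_sub_exp

lemma isBoundedAt_infty_sub {G' : Subgroup (GL (Fin 2) ℝ)} {T' : ℍ → ℂ} (hT : IsHauptmodul G T)
    (hT' : IsHauptmodul G' T') : OnePoint.infty.IsBoundedAt (fun τ => T τ - T' τ) 0 :=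
  isBoundedAt_infty_of_bounded (IsZeroAtImInfty.isBoundedAtImInfty (hT.tendsto_sub hT'))

lemma tendsto_mul_U (hT : IsHauptmodul G T) {p : ℕ} (hp : 1 < p) :
    Tendsto (fun τ => (p : ℂ) * U p T τ) atImInfty (𝓝 0) := by
  have hp0 : 0 < p := by omega
  have hp' : (p : ℂ) ≠ 0 := by exact_mod_cast hp0.ne'
  refine (Moonshine.tendsto_mul_U hp0 hT.tendsto_sub_exp).congr fun τ => ?_
  rw [mul_U_apply hp0, mul_U_apply hp0, Finset.sum_sub_distrib, sub_eq_self]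
  -- The polar terms of the p translates are proportional to the powers of a primitive p-th root of
  -- unity and sum to 0.
  have hζ := (Complex.isPrimitiveRoot_exp p hp0.ne').inv
  have : ∀ μ : ℕ, Complex.exp (-(2 * Real.pi * Complex.I * (upMat hp0 μ • τ : ℍ))) =
      Complex.exp (-(2 * Real.pi * Complex.I * τ / p)) *
        (Complex.exp (2 * Real.pi * Complex.I / p))⁻¹ ^ μ := fun μ => by
    rw [coe_upMat_smul, ← Complex.exp_neg, ← Complex.exp_nat_mul, ← Complex.exp_add]
    congr 1
    field_simp
    ring
  simp only [this]
  rw [← Finset.mul_sum, hζ.geom_sum_eq_zero hp, mul_zero]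

lemma isBoundedAt_mul_U (hT : IsHauptmodul G T) {p : ℕ} (hp : 1 < p) :
    OnePoint.infty.IsBoundedAt (fun τ => (p : ℂ) * U p T τ) 0 :=
  isBoundedAt_infty_of_bounded (IsZeroAtImInfty.isBoundedAtImInfty (hT.tendsto_mul_U hp))

lemma isBoundedAt (hT : IsHauptmodul G T) {N : ℕ} (hN : 0 < N) (hG : scaledGamma0 N ≤ G)
    {c : OnePoint ℝ} (hc : IsCusp c 𝒮ℒ) (h : ∀ g ∈ G, g • OnePoint.infty ≠ c) :
    c.IsBoundedAt T 0 :=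
  hT.bounded c (isCusp_of_scaledGamma0_le hN hG hc) h

end IsHauptmodul

/-- Uniqueness of limits at i∞ depends on this; it identifies the constants in `eq_zero_of_const`.
-/
instance neBot_atImInfty : (atImInfty : Filter ℍ).NeBot := by
  rw [atImInfty]
  exact Filter.comap_neBot_iff_frequently.mpr <| Filter.Eventually.frequently <|
    (Filter.eventually_gt_atTop (0 : ℝ)).mono fun y hy => ⟨⟨⟨0, y⟩, hy⟩, rfl⟩

/-- A constant function that tends to `0` at `i∞` vanishes. -/
lemma eq_zero_of_const {F : ℍ → ℂ} (hF : ∃ C, ∀ τ, F τ = C) (h0 : Tendsto F atImInfty (𝓝 0))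
    (τ : ℍ) : F τ = 0 := by
  obtain ⟨C, hC⟩ := hF
  rw [hC]
  exact tendsto_nhds_unique (tendsto_const_nhds.congr fun τ => (hC τ).symm) h0

/-! ### Cosets of `Γ₀(Mp)` in `Γ₀(M)` -/

lemma exists_lt_dvd_add_mul {p : ℕ} (hp : p.Prime) {a : ℤ} (ha : ¬ (p : ℤ) ∣ a) (c : ℤ) :
    ∃ μ < p, (p : ℤ) ∣ c + a * (μ : ℤ) := by
  have hp0 : (0 : ℤ) < p := by exact_mod_cast hp.pos
  obtain ⟨u, v, huv⟩ := ((Nat.prime_iff_prime_int.mp hp).coprime_iff_not_dvd.mpr ha).symm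
  have h1 := Int.emod_nonneg (-(c * u)) hp0.ne'
  have h2 := Int.emod_lt_of_pos (-(c * u)) hp0
  refine ⟨(-(c * u) % p).toNat, by omega, ?_⟩
  rw [Int.toNat_of_nonneg h1]
  obtain ⟨k, hk⟩ := Int.dvd_self_sub_emod (x := -(c * u)) (m := p)
  exact ⟨c * v - a * k, by linear_combination (-a) * hk - c * huv⟩

/-- Two representatives of determinant 1 differ by a sign, so divisibility of c by p does not depend
on the choice. -/
lemma mem_scaledGamma0_mul_iff {M p : ℕ} (hM : 0 < M) {a b c d : ℤ}
    (hdet : a * d - b * c * M = 1) {g : GL (Fin 2) ℝ}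
    (hg : Represents g !![(a : ℝ), (b : ℝ); (c : ℝ) * M, (d : ℝ)]) :
    g ∈ scaledGamma0 (M * p) ↔ (p : ℤ) ∣ c := by
  have hM' : (M : ℝ) ≠ 0 := by positivity
  rw [mem_scaledGamma0_iff]
  constructor
  · rintro ⟨a', b', c', d', hdet', s, hs, hgs⟩
    obtain ⟨r, hr, hgr⟩ := hg
    have heq := hgr.symm.trans hgs
    have h00 : r * a = s * a' := by simpa using congrFun (congrFun heq 0) 0
    have h01 : r * b = s * b' := by simpa using congrFun (congrFun heq 0) 1
    have h10 : r * (c * M) = s * (c' * (M * p)) := by simpa using congrFun (congrFun heq 1) 0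
    have h11 : r * d = s * d' := by simpa using congrFun (congrFun heq 1) 1
    have e1 : (a : ℝ) * d - b * c * M = 1 := by exact_mod_cast hdet
    have e2 : (a' : ℝ) * d' - b' * c' * (M * p) = 1 := by exact_mod_cast hdet'
    have hsq : r ^ 2 = s ^ 2 := by
      linear_combination (-r ^ 2) * e1 + s ^ 2 * e2 + r * d * h00 + s * a' * h11 -
        r * (c * M) * h01 - s * b' * h10
    have h10' : r * c = s * (c' * p) := by
      apply mul_right_cancel₀ hM'
      linear_combination h10
    rcases sq_eq_sq_iff_eq_or_eq_neg.mp hsq with h | h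
    · refine ⟨c', ?_⟩
      rw [h] at h10'
      have := mul_left_cancel₀ hs h10'
      have : c = c' * p := by exact_mod_cast this
      rw [this, mul_comm]
    · refine ⟨-c', ?_⟩
      rw [h] at h10'
      have : (c : ℝ) = -(c' * p) := by
        apply mul_left_cancel₀ hs
        linear_combination -h10'
      have : c = -(c' * p) := by exact_mod_cast this
      rw [this]; ring
  · rintro ⟨k, rfl⟩
    refine ⟨a, b, k, d, by push_cast at hdet ⊢; linear_combination hdet, hg.congr ?_⟩
    apply of_congr <;> push_cast <;> ring

lemma upperUni_inv (t : ℝ) : (upperUni t)⁻¹ = upperUni (-t) := by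
  have := upperUni_zpow t (-1)
  simpa using this

lemma upperUni_mul_inv (μ ν : ℝ) : upperUni μ * (upperUni ν)⁻¹ = upperUni (μ - ν) := by
  rw [upperUni_inv, ← upperUni_add, sub_eq_add_neg]

lemma upperUni_mem_scaledGamma0 (M : ℕ) (t : ℤ) : upperUni t ∈ scaledGamma0 M :=
  mem_scaledGamma0_iff.mpr ⟨1, t, 0, 1, by simp, (represents_upperUni _).congr (by simp)⟩

lemma eq_of_dvd_sub {p μ ν : ℕ} (hμ : μ < p) (hν : ν < p) (h : (p : ℤ) ∣ (μ : ℤ) - ν) :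
    μ = ν := by
  have h1 : (ν : ℤ) % p = (μ : ℤ) % p := Int.emod_eq_emod_iff_emod_sub_eq_zero.mpr
    (Int.emod_eq_zero_of_dvd (by rw [← neg_sub]; exact dvd_neg.mpr h))
  rw [Int.emod_eq_of_lt (by positivity) (by exact_mod_cast hν),
    Int.emod_eq_of_lt (by positivity) (by exact_mod_cast hμ)] at h1
  exact_mod_cast h1.symm

/-- The representatives `1, δ, δ t, …, δ t^(p-1)` of `Γ₀(Mp)` in `Γ₀(M)`, where `p ∤ M`. -/
noncomputable def primeRep (δ : GL (Fin 2) ℝ) : ℕ → GL (Fin 2) ℝ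
  | 0 => 1
  | μ + 1 => δ * upperUni μ

section PrimeRep

variable {p M : ℕ} {δ : GL (Fin 2) ℝ} {a b c d : ℤ}

lemma primeRep_mem (hdet : a * d - b * c * M = 1)
    (hδ : Represents δ !![(a : ℝ), (b : ℝ); (c : ℝ) * M, (d : ℝ)]) (i : ℕ) :
    primeRep δ i ∈ scaledGamma0 M := by
  cases i with
  | zero => exact one_mem _
  | succ μ =>
    exact mul_mem (mem_scaledGamma0_iff.mpr ⟨a, b, c, d, hdet, hδ⟩)
      (by exact_mod_cast upperUni_mem_scaledGamma0 M μ)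

lemma primeRep_cover (hp : p.Prime) (hM : 0 < M) (hpM : ¬ p ∣ M)
    (hdet : a * d - b * c * M = 1) (hpc : ¬ (p : ℤ) ∣ c)
    (hδ : Represents δ !![(a : ℝ), (b : ℝ); (c : ℝ) * M, (d : ℝ)]) {g : GL (Fin 2) ℝ}
    (hg : g ∈ scaledGamma0 M) :
    ∃ j ∈ Finset.range (p + 1), g * (primeRep δ j)⁻¹ ∈ scaledGamma0 (M * p) := by
  obtain ⟨A, B, C, D, hdet', hg⟩ := mem_scaledGamma0_iff.mp hg
  have hpp := Nat.prime_iff_prime_int.mp hp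
  by_cases hC : (p : ℤ) ∣ C
  · refine ⟨0, by simp, ?_⟩
    rw [primeRep, inv_one, mul_one]
    exact (mem_scaledGamma0_mul_iff hM hdet' hg).mpr hC
  · have hpM' : ¬ (p : ℤ) ∣ (M : ℤ) := by exact_mod_cast hpM
    have hndvd : ¬ (p : ℤ) ∣ M * c * C := by
      intro h
      rcases hpp.dvd_or_dvd h with h | h
      · rcases hpp.dvd_or_dvd h with h | h
        · exact hpM' h
        · exact hpc h
      · exact hC h
    -- Divided by M, the lower left entry of g(δt^μ)⁻¹ is (Cd − cD) + McC·μ, whose slope in μ is a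
    -- unit modulo p.
    obtain ⟨μ, hμ, hdvd⟩ := exists_lt_dvd_add_mul hp hndvd (C * d - c * D)
    refine ⟨μ + 1, by simpa using hμ, ?_⟩
    have hrep := hg.mul_of ((hδ.mul_of (represents_upperUni (μ : ℝ))).inv)
    rw [← primeRep.eq_2] at hrep
    refine (mem_scaledGamma0_mul_iff (a := A * (c * M * μ + d) - B * c * M)
      (b := -A * (a * μ + b) + B * a) (c := C * d - c * D + M * c * C * μ)
      (d := -C * M * (a * μ + b) + D * a) hM ?_ (hrep.congr ?_)).mpr hdvd
    · linear_combination (a * d - b * c * M) * hdet' + hdet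
    · apply of_congr <;> push_cast <;> ring

lemma primeRep_inj (hp : p.Prime) (hM : 0 < M) (hpM : ¬ p ∣ M)
    (hdet : a * d - b * c * M = 1) (hpc : ¬ (p : ℤ) ∣ c)
    (hδ : Represents δ !![(a : ℝ), (b : ℝ); (c : ℝ) * M, (d : ℝ)]) {i j : ℕ}
    (hi : i ∈ Finset.range (p + 1)) (hj : j ∈ Finset.range (p + 1))
    (h : primeRep δ i * (primeRep δ j)⁻¹ ∈ scaledGamma0 (M * p)) : i = j := by
  have hpp := Nat.prime_iff_prime_int.mp hp
  have hpM' : ¬ (p : ℤ) ∣ (M : ℤ) := by exact_mod_cast hpM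
  have hnot (μ : ℕ) : primeRep δ (μ + 1) ∉ scaledGamma0 (M * p) := by
    have hrep := hδ.mul_of (represents_upperUni (μ : ℝ))
    rw [← primeRep.eq_2] at hrep
    rw [mem_scaledGamma0_mul_iff (a := a) (b := a * μ + b) (c := c) (d := c * M * μ + d) hM
      (by linear_combination hdet) (hrep.congr (by apply of_congr <;> push_cast <;> ring))]
    exact hpc
  rcases i with _ | μ <;> rcases j with _ | ν
  · rfl
  · rw [primeRep.eq_1, one_mul, inv_mem_iff] at h
    exact absurd h (hnot ν)
  · rw [primeRep.eq_1, inv_one, mul_one] at h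
    exact absurd h (hnot μ)
  · have hrep := (hδ.mul_of (represents_upperUni ((μ : ℝ) - ν))).mul_of hδ.inv
    rw [primeRep.eq_2, primeRep.eq_2, _root_.mul_inv_rev, ← mul_assoc, mul_assoc δ,
      upperUni_mul_inv] at h
    rw [mem_scaledGamma0_mul_iff (a := 1 - a * (μ - ν) * c * M) (b := a ^ 2 * (μ - ν))
      (c := -(c ^ 2 * M * (μ - ν))) (d := 1 + a * (μ - ν) * c * M) hM (by ring)
      (hrep.congr ?_)] at h
    · rw [dvd_neg] at h
      have h' : (p : ℤ) ∣ (μ : ℤ) - ν := by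
        rcases hpp.dvd_or_dvd h with h | h
        · rcases hpp.dvd_or_dvd h with h | h
          · exact absurd (hpp.dvd_of_dvd_pow h) hpc
          · exact absurd h hpM'
        · exact h
      simp only [Finset.mem_range, add_lt_add_iff_right] at hi hj
      rw [eq_of_dvd_sub hi hj h']
    · have hdr : (a : ℝ) * d - b * c * M = 1 := by exact_mod_cast hdet
      apply of_congr <;> push_cast
      · linear_combination hdr
      · ring
      · ring
      · linear_combination hdr

end PrimeRep

/-! ### Cosets of Γ₀(PMp) in Γ₀(PM) for p ∣ P and p ∤ M -/

section UnipotentRep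

variable {p P M : ℕ} {V : GL (Fin 2) ℝ} {B D : ℤ}

/-- These parabolic elements fix the cusp V∞. The factor −tM in front of PM shows that t modulo p
separates their cosets when p ∤ M. -/
lemma represents_conj_upperUni (hP : 0 < P) (hBD : (P : ℤ) * D - B * M = 1)
    (hV : Represents V !![(P : ℝ), (B : ℝ); P * M, P * D]) (t : ℤ) :
    Represents (V * upperUni t * V⁻¹)
      !![((1 - t * (P * M) : ℤ) : ℝ), ((t * P : ℤ) : ℝ);
        ((-(t * M) : ℤ) : ℝ) * ((P * M : ℕ) : ℝ), ((1 + t * (P * M) : ℤ) : ℝ)] := by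
  have hBDr : (P : ℝ) * D - B * M = 1 := by exact_mod_cast hBD
  have hP' : (P : ℝ) ≠ 0 := by positivity
  refine ((hV.mul_of (represents_upperUni _)).mul_of hV.inv).of_smul hP' ?_
  apply of_eq_smul <;> push_cast
  · linear_combination (P : ℝ) * hBDr
  · ring
  · ring
  · linear_combination (P : ℝ) * hBDr

lemma conj_upperUni_mem (hP : 0 < P) (hBD : (P : ℤ) * D - B * M = 1)
    (hV : Represents V !![(P : ℝ), (B : ℝ); P * M, P * D]) (t : ℤ) :
    V * upperUni t * V⁻¹ ∈ scaledGamma0 (P * M) :=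
  mem_scaledGamma0_iff.mpr ⟨_, _, _, _, by push_cast; ring,
    represents_conj_upperUni hP hBD hV t⟩

lemma conj_upperUni_cover (hp : p.Prime) (hP : 0 < P) (hM : 0 < M) (hpP : p ∣ P) (hpM : ¬ p ∣ M)
    (hBD : (P : ℤ) * D - B * M = 1)
    (hV : Represents V !![(P : ℝ), (B : ℝ); P * M, P * D]) {g : GL (Fin 2) ℝ}
    (hg : g ∈ scaledGamma0 (P * M)) :
    ∃ μ ∈ Finset.range p, g * (V * upperUni μ * V⁻¹)⁻¹ ∈ scaledGamma0 (P * M * p) := by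
  obtain ⟨a, b, c, d, hdet, hg⟩ := mem_scaledGamma0_iff.mp hg
  have hpp := Nat.prime_iff_prime_int.mp hp
  have hpM' : ¬ (p : ℤ) ∣ (M : ℤ) := by exact_mod_cast hpM
  obtain ⟨k, hk⟩ := hpP
  have hkz : (P : ℤ) = p * k := by exact_mod_cast hk
  have hndvd : ¬ (p : ℤ) ∣ d * M := by
    intro h
    rcases hpp.dvd_or_dvd h with ⟨e, he⟩ | h
    · refine hpp.not_isUnit (isUnit_of_dvd_one ⟨a * e - b * c * k * M, ?_⟩)
      rw [← hdet, he]
      push_cast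
      rw [hkz]
      ring
    · exact hpM' h
  -- Modulo p the quantity to be killed is c + dMμ; d is prime to p because p ∣ P and the
  -- determinant is 1.
  obtain ⟨μ, hμ, hdvd⟩ := exists_lt_dvd_add_mul hp hndvd c
  refine ⟨μ, by simpa using hμ, ?_⟩
  have hrep := hg.mul_of ((represents_conj_upperUni hP hBD hV μ).inv)
  rw [Int.cast_natCast] at hrep
  refine (mem_scaledGamma0_mul_iff (a := a * (1 + μ * (P * M)) + b * (μ * M * (P * M)))
    (b := -a * (μ * P) + b * (1 - μ * (P * M))) (c := c * (1 + μ * (P * M)) + d * (μ * M))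
    (d := -c * (P * M) * (μ * P) + d * (1 - μ * (P * M))) (Nat.mul_pos hP hM) ?_
    (hrep.congr ?_)).mpr ?_
  · push_cast at hdet ⊢
    linear_combination hdet
  · apply of_congr <;> push_cast <;> ring
  · obtain ⟨e, he⟩ := hdvd
    exact ⟨e + c * μ * k * M, by rw [hkz]; linear_combination he⟩

lemma conj_upperUni_inj (hp : p.Prime) (hP : 0 < P) (hM : 0 < M) (hpM : ¬ p ∣ M)
    (hBD : (P : ℤ) * D - B * M = 1)
    (hV : Represents V !![(P : ℝ), (B : ℝ); P * M, P * D]) {μ ν : ℕ}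
    (hμ : μ ∈ Finset.range p) (hν : ν ∈ Finset.range p)
    (h : V * upperUni μ * V⁻¹ * (V * upperUni ν * V⁻¹)⁻¹ ∈ scaledGamma0 (P * M * p)) :
    μ = ν := by
  have hpp := Nat.prime_iff_prime_int.mp hp
  have hpM' : ¬ (p : ℤ) ∣ (M : ℤ) := by exact_mod_cast hpM
  have heq : V * upperUni μ * V⁻¹ * (V * upperUni ν * V⁻¹)⁻¹ =
      V * upperUni ((μ - ν : ℤ) : ℝ) * V⁻¹ := by
    push_cast
    rw [← upperUni_mul_inv]
    group
  rw [heq, mem_scaledGamma0_mul_iff (Nat.mul_pos hP hM) (by push_cast; ring)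
    (represents_conj_upperUni hP hBD hV _), dvd_neg] at h
  rw [Finset.mem_range] at hμ hν
  exact eq_of_dvd_sub hμ hν ((hpp.dvd_or_dvd h).resolve_right hpM')

end UnipotentRep

/-! ### Cusps -/

/-- The cusps of SL₂(ℤ) form the projective line over ℚ, which is preserved by matrices proportional
to integral ones. -/
lemma isCusp_smul {a b c d : ℤ} {g : GL (Fin 2) ℝ}
    (hg : Represents g !![(a : ℝ), (b : ℝ); (c : ℝ), (d : ℝ)]) {x : OnePoint ℝ}
    (hx : IsCusp x 𝒮ℒ) : IsCusp (g • x) 𝒮ℒ := by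
  obtain ⟨r, hr, hg⟩ := hg
  have h00 : g 0 0 = r * a := by rw [hg]; simp
  have h01 : g 0 1 = r * b := by rw [hg]; simp
  have h10 : g 1 0 = r * c := by rw [hg]; simp
  have h11 : g 1 1 = r * d := by rw [hg]; simp
  rw [isCusp_SL2Z_iff] at hx ⊢
  obtain ⟨q, rfl⟩ := hx
  cases q with
  | infty =>
    rw [OnePoint.map_infty, OnePoint.smul_infty_eq_ite, h00, h10]
    split_ifs with h
    · exact ⟨OnePoint.infty, rfl⟩
    · refine ⟨((a / c : ℚ) : OnePoint ℚ), ?_⟩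
      rw [OnePoint.map_some, mul_div_mul_left _ _ hr]
      push_cast
      rfl
  | coe q =>
    rw [OnePoint.map_some, OnePoint.smul_some_eq_ite, h00, h01, h10, h11]
    split_ifs with h
    · exact ⟨OnePoint.infty, rfl⟩
    · refine ⟨(((a * q + b) / (c * q + d) : ℚ) : OnePoint ℚ), ?_⟩
      rw [OnePoint.map_some, mul_assoc, mul_assoc, ← mul_add, ← mul_add,
        mul_div_mul_left _ _ hr]
      push_cast
      rfl

lemma isCusp_infty : IsCusp (OnePoint.infty : OnePoint ℝ) 𝒮ℒ :=
  isCusp_SL2Z_iff.mpr ⟨OnePoint.infty, rfl⟩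

lemma isCusp_smul_of_mem_scaledGamma0 {N : ℕ} {g : GL (Fin 2) ℝ} (hg : g ∈ scaledGamma0 N)
    {x : OnePoint ℝ} (hx : IsCusp x 𝒮ℒ) : IsCusp (g • x) 𝒮ℒ := by
  obtain ⟨a, b, c, d, -, hg⟩ := mem_scaledGamma0_iff.mp hg
  exact isCusp_smul (a := a) (b := b) (c := c * N) (d := d) (hg.congr (by push_cast; rfl)) hx

lemma det_pos_of_represents {g : GL (Fin 2) ℝ} {a b c d : ℝ}
    (hg : Represents g !![a, b; c, d]) (h : 0 < a * d - b * c) : 0 < g.det.val := by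
  obtain ⟨r, hr, hg⟩ := hg
  rw [GeneralLinearGroup.val_det_apply, hg, Matrix.det_smul, Matrix.det_fin_two_of]
  have : 0 < r ^ 2 := by positivity
  simpa using mul_pos this h

lemma det_pos_of_mem_scaledGamma0 {N : ℕ} {g : GL (Fin 2) ℝ} (hg : g ∈ scaledGamma0 N) :
    0 < g.det.val := by
  obtain ⟨a, b, c, d, hdet, hg⟩ := mem_scaledGamma0_iff.mp hg
  refine det_pos_of_represents hg ?_
  have : (a : ℝ) * d - b * c * N = 1 := by exact_mod_cast hdet
  linarith

lemma smul_infty_eq_iff {g g' : GL (Fin 2) ℝ} {a b c d a' b' c' d' : ℝ}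
    (hg : Represents g !![a, b; c, d]) (hg' : Represents g' !![a', b'; c', d'])
    (h : g • (OnePoint.infty : OnePoint ℝ) = g' • OnePoint.infty) : a * c' = a' * c := by
  have h1 : (g'⁻¹ * g) • (OnePoint.infty : OnePoint ℝ) = OnePoint.infty := by
    rw [mul_smul, h, inv_smul_smul]
  rw [OnePoint.smul_infty_eq_self_iff] at h1
  obtain ⟨r, hr, hrep⟩ := hg'.inv.mul_of hg
  rw [hrep] at h1
  have h2 : r * (-c' * a + a' * c) = 0 := by simpa using h1
  have := (mul_eq_zero.mp h2).resolve_left hr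
  linarith

/-! ### Traces of Hauptmoduln -/

/-- The subgroup of all matrices under which `F` is invariant. -/
def invariantSubgroup (F : ℍ → ℂ) : Subgroup (GL (Fin 2) ℝ) where
  carrier := {g | ∀ τ, F (g • τ) = F τ}
  one_mem' := fun τ => by rw [one_smul]
  mul_mem' := fun {x y} hx hy τ => by rw [mul_smul, hx, hy]
  inv_mem' := fun {x} hx τ => by
    have := hx (x⁻¹ • τ)
    rw [smul_inv_smul] at this
    exact this.symm

/-- The sum of the translates of a `G`-invariant function over representatives of `K` in `L`, where
`K ≤ G` and `G` normalizes `K` and `L`, is invariant under `G` and `L`. -/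
lemma trace_invariant {ι : Type*} {s : Finset ι} {F : ℍ → ℂ} {K L G : Subgroup (GL (Fin 2) ℝ)}
    (hKG : K ≤ G) (hF : ∀ g ∈ G, ∀ τ, F (g • τ) = F τ)
    (hGK : ∀ g ∈ G, ∀ x ∈ K, g * x * g⁻¹ ∈ K) (hGL : ∀ g ∈ G, ∀ x ∈ L, g * x * g⁻¹ ∈ L)
    {rep : ι → GL (Fin 2) ℝ} (hrep : ∀ i ∈ s, rep i ∈ L)
    (hinj : ∀ i ∈ s, ∀ j ∈ s, rep i * (rep j)⁻¹ ∈ K → i = j)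
    (hcover : ∀ g ∈ L, ∃ j ∈ s, g * (rep j)⁻¹ ∈ K) {g : GL (Fin 2) ℝ} (hg : g ∈ G ⊔ L) (τ : ℍ) :
    ∑ i ∈ s, F (rep i • g • τ) = ∑ i ∈ s, F (rep i • τ) := by
  have key : G ⊔ L ≤ invariantSubgroup fun τ => ∑ i ∈ s, F (rep i • τ) := by
    refine sup_le (fun g hg τ => ?_) fun g hg τ => ?_
    -- For g ∈ G the element itself serves as k₀: g⁻¹ (rep i) g stays in L, so it is covered by the
    -- representatives. For g ∈ L, k₀ = 1 works.
    · refine sum_smul_eq_of_cosets (fun k hk => hF k (hKG hk)) hinj (k₀ := g) (hF g hg)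
        (hGK g hg) (fun i hi => hcover _ ?_) τ
      have := hGL g⁻¹ (inv_mem hg) _ (hrep i hi)
      rwa [inv_inv] at this
    · refine sum_smul_eq_of_cosets (fun k hk => hF k (hKG hk)) hinj (k₀ := 1)
        (fun x => by rw [one_smul]) (fun k hk => by simpa using hk)
        (fun i hi => hcover _ ?_) τ
      simpa using mul_mem (hrep i hi) hg
  exact key hg τ

/-! ### Traces from level Mp to level M with p ∤ M -/

section Prime

variable {p M : ℕ} {B D : ℤ} {W : GL (Fin 2) ℝ} {G : Subgroup (GL (Fin 2) ℝ)} {T : ℍ → ℂ}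

lemma upMat_zero_mul_upperUni {p : ℕ} (hp : 0 < p) (μ : ℕ) :
    upMat hp 0 * upperUni μ = upMat hp μ := by
  apply Units.ext
  simp [upMat, upperUni]

lemma atkinLehner_det_pos {P : ℕ} (hP : 0 < P) (hBD : (P : ℤ) * D - B * M = 1)
    (hW : Represents W !![(P : ℝ), (B : ℝ); P * M, P * D]) : 0 < W.det.val := by
  refine det_pos_of_represents hW ?_
  have : (P : ℝ) * D - B * M = 1 := by exact_mod_cast hBD
  rw [show (P : ℝ) * (P * D) - B * (P * M) = P * (P * D - B * M) by ring, this]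
  simpa using hP

lemma isCusp_atkinLehner_smul {P : ℕ} (hW : Represents W !![(P : ℝ), (B : ℝ); P * M, P * D])
    {c : OnePoint ℝ} (hc : IsCusp c 𝒮ℒ) : IsCusp (W • c) 𝒮ℒ :=
  isCusp_smul (a := P) (b := B) (c := P * M) (d := P * D) (hW.congr (by push_cast; rfl)) hc

/-- This is the representative δ for the trace of T∘W: it is made so that Wδ(1,μ;0,1) = (1,μ;0,p).
-/
lemma represents_inv_mul_upMat (hp : 0 < p)
    (hW : Represents W !![(p : ℝ), (B : ℝ); p * M, p * D]) :
    Represents (W⁻¹ * upMat hp 0)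
      !![(D : ℝ), ((-B : ℤ) : ℝ); ((-1 : ℤ) : ℝ) * M, ((p : ℤ) : ℝ)] := by
  have hp' : (p : ℝ) ≠ 0 := by positivity
  refine (hW.inv.mul_of (represents_upMat hp 0)).of_smul hp' ?_
  apply of_eq_smul <;> push_cast <;> ring

/-- This is the representative δ for the trace of T, where δ(1,μ;0,1) = W(1,μ;0,p) produces
(T∘W)|U_p. -/
lemma represents_mul_upMat (hp : 0 < p)
    (hW : Represents W !![(p : ℝ), (B : ℝ); p * M, p * D]) :
    Represents (W * upMat hp 0)
      !![((1 : ℤ) : ℝ), (B : ℝ); ((1 : ℤ) : ℝ) * M, ((p * D : ℤ) : ℝ)] := by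
  have hp' : (p : ℝ) ≠ 0 := by positivity
  refine (hW.mul_of (represents_upMat hp 0)).of_smul hp' ?_
  apply of_eq_smul <;> push_cast <;> ring

/-- The trace of `T ∘ W_p` to level `M` is constant. -/
theorem exists_comp_add_mul_U_eq (hp : p.Prime) (hM : 0 < M) (hpM : ¬ p ∣ M)
    (hBD : (p : ℤ) * D - B * M = 1) (hW : Represents W !![(p : ℝ), (B : ℝ); p * M, p * D])
    (hKG : scaledGamma0 (M * p) ≤ G)
    (hWG : ∀ g ∈ G, W * g * W⁻¹ ∈ G ∧ W⁻¹ * g * W ∈ G)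
    (hGK : ∀ g ∈ G, ∀ x ∈ scaledGamma0 (M * p), g * x * g⁻¹ ∈ scaledGamma0 (M * p))
    (hGL : ∀ g ∈ G, ∀ x ∈ scaledGamma0 M, g * x * g⁻¹ ∈ scaledGamma0 M)
    (hcusp : ∀ g ∈ G, g • (OnePoint.infty : OnePoint ℝ) ≠ W • OnePoint.infty)
    (hT : IsHauptmodul G T) : ∃ C, ∀ τ, T (W • τ) + p * U p T τ = C := by
  have hN : 0 < M * p := Nat.mul_pos hM hp.pos
  have hpu : ¬ (p : ℤ) ∣ -1 := fun h =>
    (Nat.prime_iff_prime_int.mp hp).not_isUnit (isUnit_of_dvd_unit h (by simp))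
  have hdet : D * (p : ℤ) - (-B) * (-1) * M = 1 := by linear_combination hBD
  have hδ := represents_inv_mul_upMat hp.pos hW
  set δ := W⁻¹ * upMat hp.pos 0 with hδdef
  have hrepδ (μ : ℕ) : W * (δ * upperUni μ) = upMat hp.pos μ := by
    rw [hδdef, ← upMat_zero_mul_upperUni hp.pos μ]
    group
  have hsum (τ : ℍ) : ∑ i ∈ Finset.range (p + 1), T (W • primeRep δ i • τ) =
      T (W • τ) + p * U p T τ := by
    rw [Finset.sum_range_succ', mul_U_apply hp.pos, primeRep.eq_1, one_smul, add_comm]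
    congr 1
    refine Finset.sum_congr rfl fun μ _ => ?_
    rw [primeRep.eq_2, smul_smul, hrepδ]
  have hrep (i : ℕ) := primeRep_mem hdet hδ i
  have hdetW := atkinLehner_det_pos hp.pos hBD hW
  have hholo := mdifferentiable_comp_smul hT.holo hdetW
  have hinv : ∀ g ∈ G, ∀ τ, T (W • g • τ) = T (W • τ) := fun g hg τ => by
    have := hT.invariant _ (hWG g hg).1 (W • τ)
    rwa [smul_smul, inv_mul_cancel_right, mul_smul] at this
  suffices h : ∃ C, ∀ τ, ∑ i ∈ Finset.range (p + 1), T (W • primeRep δ i • τ) = C by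
    simpa only [hsum] using h
  refine exists_eq_const_of_group (N := M) hM (H := G ⊔ scaledGamma0 M) le_sup_right
    (mdifferentiable_sum_comp_smul hholo fun i _ => det_pos_of_mem_scaledGamma0 (hrep i))
    (fun g hg τ => trace_invariant (F := fun τ => T (W • τ)) hKG hinv hGK hGL
      (fun i _ => hrep i) (fun i hi j hj h => primeRep_inj hp hM hpM hdet hpu hδ hi hj h)
      (fun g hg => primeRep_cover hp hM hpM hdet hpu hδ hg) hg τ) ?_ ?_
  · simp only [hsum]
    refine isBoundedAt_add ?_ (hT.isBoundedAt_mul_U hp.one_lt)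
    rw [isBoundedAt_comp_smul]
    exact hT.isBoundedAt hN hKG (isCusp_atkinLehner_smul hW isCusp_infty) hcusp
  · intro c hc hne
    refine isBoundedAt_sum fun i _ => ?_
    rw [isBoundedAt_comp_smul (f := fun τ => T (W • τ)), isBoundedAt_comp_smul]
    refine hT.isBoundedAt hN hKG
      (isCusp_atkinLehner_smul hW (isCusp_smul_of_mem_scaledGamma0 (hrep i) hc)) fun g hg h => ?_
    -- A pole at c would mean W(rep i)c = g∞. Since (1,0;0,p) fixes ∞, W⁻¹∞ = δ∞, and c becomes
    -- equivalent to ∞ under G ⊔ Γ₀(M), contrary to the choice of c.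
    refine hne ((primeRep δ i)⁻¹ * (W⁻¹ * g * W) * δ) ?_ ?_
    · refine mul_mem (mul_mem ?_ ?_) ?_
      · exact inv_mem (le_sup_right (a := G) (hrep i))
      · exact le_sup_left (b := scaledGamma0 M) (hWG g hg).2
      · exact le_sup_right (a := G) (mem_scaledGamma0_iff.mpr ⟨_, _, _, _, hdet, hδ⟩)
    · have : (primeRep δ i)⁻¹ * (W⁻¹ * g * W) * δ =
          (primeRep δ i)⁻¹ * W⁻¹ * g * upMat hp.pos 0 := by
        rw [hδdef]; group
      rw [this, mul_smul, upMat_smul_infty, mul_smul, h, smul_smul]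
      simp

/-- The trace of `T` to level `M` is the Hauptmodul of level `M`, up to a constant. -/
theorem exists_add_mul_U_comp_sub_eq {G' : Subgroup (GL (Fin 2) ℝ)} {T' : ℍ → ℂ} (hp : p.Prime)
    (hM : 0 < M) (hpM : ¬ p ∣ M)
    (hBD : (p : ℤ) * D - B * M = 1) (hW : Represents W !![(p : ℝ), (B : ℝ); p * M, p * D])
    (hKG : scaledGamma0 (M * p) ≤ G)
    (hGK : ∀ g ∈ G, ∀ x ∈ scaledGamma0 (M * p), g * x * g⁻¹ ∈ scaledGamma0 (M * p))
    (hGL : ∀ g ∈ G, ∀ x ∈ scaledGamma0 M, g * x * g⁻¹ ∈ scaledGamma0 M)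
    (hcusp : ∀ g ∈ G, g • (OnePoint.infty : OnePoint ℝ) ≠ W • OnePoint.infty)
    (hGG' : G ≤ G') (hLG' : scaledGamma0 M ≤ G') (hG' : G' ≤ G ⊔ scaledGamma0 M)
    (hT : IsHauptmodul G T) (hT' : IsHauptmodul G' T') :
    ∃ C, ∀ τ, T τ + p * U p (fun τ => T (W • τ)) τ - T' τ = C := by
  have hN : 0 < M * p := Nat.mul_pos hM hp.pos
  have hpu : ¬ (p : ℤ) ∣ 1 := (Nat.prime_iff_prime_int.mp hp).not_dvd_one
  have hdet : 1 * ((p : ℤ) * D) - B * 1 * M = 1 := by linear_combination hBD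
  have hδ := represents_mul_upMat hp.pos hW
  set δ := W * upMat hp.pos 0 with hδdef
  have hrepδ (μ : ℕ) : δ * upperUni μ = W * upMat hp.pos μ := by
    rw [hδdef, ← upMat_zero_mul_upperUni hp.pos μ, mul_assoc]
  have hsum (τ : ℍ) : ∑ i ∈ Finset.range (p + 1), T (primeRep δ i • τ) =
      T τ + p * U p (fun τ => T (W • τ)) τ := by
    rw [Finset.sum_range_succ', mul_U_apply hp.pos, primeRep.eq_1, one_smul, add_comm]
    congr 1
    refine Finset.sum_congr rfl fun μ _ => ?_
    rw [primeRep.eq_2, hrepδ, mul_smul]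
  have hrep (i : ℕ) := primeRep_mem hdet hδ i
  have hinf : (W • (OnePoint.infty : OnePoint ℝ)).IsBoundedAt T 0 :=
    hT.isBoundedAt hN hKG (isCusp_atkinLehner_smul hW isCusp_infty) hcusp
  suffices h : ∃ C, ∀ τ, ∑ i ∈ Finset.range (p + 1), T (primeRep δ i • τ) - T' τ = C by
    simpa only [hsum] using h
  refine exists_eq_const_of_group (N := M) hM (H := G') hLG'
    ((mdifferentiable_sum_comp_smul hT.holo fun i _ =>
      det_pos_of_mem_scaledGamma0 (hrep i)).sub hT'.holo)
    (fun g hg τ => ?_) ?_ ?_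
  · rw [hT'.invariant g hg, trace_invariant hKG hT.invariant hGK hGL
      (fun i _ => hrep i) (fun i hi j hj h => primeRep_inj hp hM hpM hdet hpu hδ hi hj h)
      (fun g hg => primeRep_cover hp hM hpM hdet hpu hδ hg) (hG' hg) τ]
  -- At ∞ the poles of T and T' cancel; the other p terms see T at W∞, where it is bounded.
  · have : (fun τ => ∑ i ∈ Finset.range (p + 1), T (primeRep δ i • τ) - T' τ) =
        fun τ => (T τ - T' τ) + ∑ μ ∈ Finset.range p, T ((W * upMat hp.pos μ) • τ) := by
      ext τ
      rw [hsum, mul_U_apply hp.pos]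
      simp only [mul_smul]
      ring
    rw [this]
    refine isBoundedAt_add (hT.isBoundedAt_infty_sub hT') (isBoundedAt_sum fun μ _ => ?_)
    rw [isBoundedAt_comp_smul, mul_smul, upMat_smul_infty]
    exact hinf
  · intro c hc hne
    refine isBoundedAt_sub (isBoundedAt_sum fun i _ => ?_) (hT'.isBoundedAt hM hLG' hc hne)
    rw [isBoundedAt_comp_smul]
    refine hT.isBoundedAt hN hKG (isCusp_smul_of_mem_scaledGamma0 (hrep i) hc) fun g hg h => ?_
    exact hne ((primeRep δ i)⁻¹ * g) (mul_mem (inv_mem (hLG' (hrep i))) (hGG' hg))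
      (by rw [mul_smul, h, inv_smul_smul])

end Prime

/-- If `G'` is generated by `G` and an Atkin–Lehner matrix `W` that normalizes `G`, then
`T + T ∘ W` is the Hauptmodul of `G'`, up to a constant. -/
theorem exists_add_comp_sub_eq {P M : ℕ} {B D : ℤ} {W : GL (Fin 2) ℝ}
    {G G' : Subgroup (GL (Fin 2) ℝ)} {T T' : ℍ → ℂ} (hP : 0 < P) (hM : 0 < M)
    (hBD : (P : ℤ) * D - B * M = 1) (hW : Represents W !![(P : ℝ), (B : ℝ); P * M, P * D])
    (hKG : scaledGamma0 (P * M) ≤ G)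
    (hWG : ∀ g ∈ G, W * g * W⁻¹ ∈ G)
    (hcusp : ∀ g ∈ G, g • (OnePoint.infty : OnePoint ℝ) ≠ W • OnePoint.infty)
    (hGG' : G ≤ G') (hWG' : W ∈ G') (hG' : ∀ g ∈ G', g ∈ G ∨ g * W⁻¹ ∈ G)
    (hT : IsHauptmodul G T) (hT' : IsHauptmodul G' T') :
    ∃ C, ∀ τ, T τ + T (W • τ) - T' τ = C := by
  have hN : 0 < P * M := Nat.mul_pos hP hM
  have hWw := NHSymbol.atkinLehner_mem_w_level hP hBD hW
  -- Since W² acts trivially on T, the action of W exchanges T and T∘W.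
  have hWW : W * W ∈ G := hKG <| by
    have := mul_mem_w (h := 1) (k := P) (e := 1) (f := 1) (m := M) one_pos hP one_pos one_pos
      (by ring) (by rwa [mul_one]) (by rwa [mul_one]) (x := W) (y := W) (n := P * M)
    rw [mem_scaledGamma0]
    simpa using this
  have hinv (g : GL (Fin 2) ℝ) (hg : g ∈ G) (τ : ℍ) : T (W • g • τ) = T (W • τ) := by
    have := hT.invariant _ (hWG g hg) (W • τ)
    rwa [smul_smul, inv_mul_cancel_right, mul_smul] at this
  refine exists_eq_const_of_group hN (H := G') (hKG.trans hGG')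
    ((hT.holo.add (mdifferentiable_comp_smul hT.holo (atkinLehner_det_pos hP hBD hW))).sub
      hT'.holo) (fun g hg τ => ?_) ?_ ?_
  · rw [hT'.invariant g hg]
    rcases hG' g hg with h | h
    · rw [hT.invariant g h, hinv g h]
    · have h1 : T (g • τ) = T (W • τ) := by
        have := hT.invariant _ h (W • τ)
        rwa [smul_smul, inv_mul_cancel_right] at this
      have h2 : T (W • g • τ) = T τ := by
        have := hinv _ h (W • τ)
        rw [smul_smul (g * W⁻¹), inv_mul_cancel_right, smul_smul W W, hT.invariant _ hWW] at this
        exact this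
      rw [h1, h2, add_comm]
  · have : (fun τ => T τ + T (W • τ) - T' τ) = fun τ => (T τ - T' τ) + T (W • τ) := by
      ext τ; ring
    rw [this]
    refine isBoundedAt_add (hT.isBoundedAt_infty_sub hT') ?_
    rw [isBoundedAt_comp_smul]
    exact hT.isBoundedAt hN hKG (isCusp_atkinLehner_smul hW isCusp_infty) hcusp
  · intro c hc hne
    refine isBoundedAt_sub (isBoundedAt_add ?_ ?_)
      (hT'.isBoundedAt hN (hKG.trans hGG') hc hne)
    · exact hT.isBoundedAt hN hKG hc fun g hg => hne g (hGG' hg)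
    · rw [isBoundedAt_comp_smul]
      refine hT.isBoundedAt hN hKG (isCusp_atkinLehner_smul hW hc) fun g hg h => ?_
      exact hne (W⁻¹ * g) (mul_mem (inv_mem hWG') (hGG' hg)) (by rw [mul_smul, h, inv_smul_smul])

/-- The diagonal matrix `(p, 0; 0, 1)`. -/
noncomputable def diagMat {p : ℕ} (hp : 0 < p) : GL (Fin 2) ℝ := gl p 0 0 1 (by simp; omega)

lemma represents_diagMat {p : ℕ} (hp : 0 < p) :
    Represents (diagMat hp) !![(p : ℝ), 0; 0, 1] := represents_gl _

/-- If `T` is invariant under the Atkin–Lehner matrix `V · (p, 0; 0, 1)` of level `PMp`, where `V` is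
the one of level `PM` and `p ∣ P`, then `p T | U_p` is the image under `V` of the Hauptmodul of level
`PM`, up to a constant. -/
theorem exists_mul_U_sub_comp_eq {p P M : ℕ} {B D : ℤ} {V : GL (Fin 2) ℝ}
    {G G₀ G' : Subgroup (GL (Fin 2) ℝ)} {T T' : ℍ → ℂ} (hp : p.Prime) (hP : 0 < P) (hM : 0 < M)
    (hpP : p ∣ P) (hpM : ¬ p ∣ M)
    (hBD : (P : ℤ) * D - B * M = 1) (hV : Represents V !![(P : ℝ), (B : ℝ); P * M, P * D])
    (hKG : scaledGamma0 (P * M * p) ≤ G₀) (hG₀G : G₀ ≤ G) (hG₀G' : G₀ ≤ G')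
    (hLG' : scaledGamma0 (P * M) ≤ G') (hG' : G' ≤ G₀ ⊔ scaledGamma0 (P * M))
    (hGK : ∀ g ∈ G₀, ∀ x ∈ scaledGamma0 (P * M * p), g * x * g⁻¹ ∈ scaledGamma0 (P * M * p))
    (hGL : ∀ g ∈ G₀, ∀ x ∈ scaledGamma0 (P * M), g * x * g⁻¹ ∈ scaledGamma0 (P * M))
    (hWG : V * diagMat hp.pos ∈ G)
    (hG : ∀ g ∈ G, g ∈ G₀ ∨ g * (V * diagMat hp.pos)⁻¹ ∈ G₀)
    (hcusp' : ∀ g ∈ G', g • (OnePoint.infty : OnePoint ℝ) ≠ V • OnePoint.infty)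
    (hcusp : ∀ μ : ℕ, 0 < μ → μ < p → ∀ g ∈ G, g • (OnePoint.infty : OnePoint ℝ) ≠
      (V * upperUni μ * V⁻¹) • OnePoint.infty)
    (hT : IsHauptmodul G T) (hT' : IsHauptmodul G' T') :
    ∃ C, ∀ τ, p * U p T τ - T' (V • τ) = C := by
  have hQ : 0 < P * M := Nat.mul_pos hP hM
  have hN : 0 < P * M * p := Nat.mul_pos hQ hp.pos
  have hrep (μ : ℕ) : V * upperUni μ * V⁻¹ ∈ scaledGamma0 (P * M) := by
    exact_mod_cast conj_upperUni_mem hP hBD hV μ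
  have hKG' := hKG.trans hG₀G
  have hsum (τ : ℍ) : ∑ μ ∈ Finset.range p, T ((V * upperUni μ * V⁻¹) • V • τ) =
      p * U p T τ := by
    rw [mul_U_apply hp.pos]
    refine Finset.sum_congr rfl fun μ _ => ?_
    rw [smul_smul, inv_mul_cancel_right, ← hT.invariant _ hWG (upMat hp.pos μ • τ), smul_smul]
    -- (p,0;0,1)(1,μ;0,p) is p times (1,μ;0,1), so invariance under V(p,0;0,1) gives T((1,μ;0,p)τ) =
    -- T(V(1,μ;0,1)τ).
    have hk : V * upperUni μ * (V * diagMat hp.pos * upMat hp.pos μ)⁻¹ ∈ G := by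
      refine hKG' (mem_scaledGamma0_iff.mpr ⟨1, 0, 0, 1, by ring, ?_⟩)
      have h1 := (represents_upperUni (μ : ℝ)).mul_of
        ((represents_diagMat hp.pos).mul_of (represents_upMat hp.pos μ)).inv
      have hp' : (p : ℝ) ≠ 0 := by exact_mod_cast hp.ne_zero
      have h2 : Represents (upperUni μ * (diagMat hp.pos * upMat hp.pos μ)⁻¹)
          (1 : Matrix (Fin 2) (Fin 2) ℝ) := by
        refine h1.of_smul hp' ?_
        rw [Matrix.one_fin_two]
        apply of_eq_smul <;> ring
      obtain ⟨r, hr, h2⟩ := h2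
      refine ⟨r, hr, ?_⟩
      have h3 : V * upperUni μ * (V * diagMat hp.pos * upMat hp.pos μ)⁻¹ =
          V * (upperUni μ * (diagMat hp.pos * upMat hp.pos μ)⁻¹) * V⁻¹ := by group
      rw [h3, Units.val_mul, Units.val_mul, h2, Matrix.mul_smul, mul_one, Matrix.smul_mul,
        Units.mul_inv]
      simp [Matrix.one_fin_two]
    have := hT.invariant _ hk ((V * diagMat hp.pos * upMat hp.pos μ) • τ)
    rwa [smul_smul, inv_mul_cancel_right] at this
  set R : ℍ → ℂ := fun τ => ∑ μ ∈ Finset.range p, T ((V * upperUni μ * V⁻¹) • τ) with hR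
  have hRinv : ∀ g ∈ G', ∀ τ, R (g • τ) = R τ := fun g hg τ =>
    trace_invariant hKG (fun g hg => hT.invariant g (hG₀G hg)) hGK hGL
      (rep := fun μ : ℕ => V * upperUni μ * V⁻¹)
      (fun μ _ => hrep μ) (fun μ hμ ν hν h => conj_upperUni_inj hp hP hM hpM hBD hV hμ hν h)
      (fun g hg => conj_upperUni_cover hp hP hM hpP hpM hBD hV hg) (hG' hg) τ
  have hWV : (V * diagMat hp.pos) • (OnePoint.infty : OnePoint ℝ) = V • OnePoint.infty := by
    rw [mul_smul, OnePoint.smul_infty_eq_self_iff.mpr (show diagMat hp.pos 1 0 = 0 by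
      simp [diagMat])]
  -- Here R∘V = pT|U_p, which has no pole at ∞, and T' is bounded at V∞.
  have hbV : (V • (OnePoint.infty : OnePoint ℝ)).IsBoundedAt (fun τ => R τ - T' τ) 0 := by
    refine isBoundedAt_sub ?_ (hT'.isBoundedAt hQ hLG'
      (isCusp_atkinLehner_smul hV isCusp_infty) hcusp')
    rw [← isBoundedAt_comp_smul]
    simpa only [hR, hsum] using hT.isBoundedAt_mul_U hp.one_lt
  have hDinv : ∀ g ∈ G', ∀ τ, R (g • τ) - T' (g • τ) = R τ - T' τ := fun g hg τ => by
    rw [hRinv g hg, hT'.invariant g hg]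
  obtain ⟨C, hC⟩ : ∃ C, ∀ τ, R τ - T' τ = C := by
    refine exists_eq_const_of_group hQ (H := G') hLG'
      ((mdifferentiable_sum_comp_smul hT.holo fun μ _ =>
        det_pos_of_mem_scaledGamma0 (hrep μ)).sub hT'.holo) hDinv ?_ ?_
    -- Only the translate with μ = 0 has a pole at ∞, and T' cancels it.
    · have : (fun τ => R τ - T' τ) = fun τ => (T τ - T' τ) +
          ∑ μ ∈ Finset.range (p - 1), T ((V * upperUni (μ + 1 : ℕ) * V⁻¹) • τ) := by
        ext τ
        have h1 : upperUni ((0 : ℕ) : ℝ) = 1 := by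
          apply Units.ext
          simp [upperUni, Matrix.one_fin_two]
        obtain ⟨k, hk⟩ : ∃ k, p = k + 1 := ⟨p - 1, by have := hp.pos; omega⟩
        simp only [hR]
        subst hk
        rw [Finset.sum_range_succ', h1, mul_one, mul_inv_cancel, one_smul, Nat.add_sub_cancel]
        ring
      rw [this]
      refine isBoundedAt_add (hT.isBoundedAt_infty_sub hT') (isBoundedAt_sum fun μ hμ => ?_)
      rw [isBoundedAt_comp_smul]
      rw [Finset.mem_range] at hμ
      exact hT.isBoundedAt hN hKG' (isCusp_smul_of_mem_scaledGamma0 (hrep _) isCusp_infty)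
        (hcusp (μ + 1) (by omega) (by omega))
    · intro c hc hne
      by_cases hV' : ∃ g ∈ G', (g * V) • (OnePoint.infty : OnePoint ℝ) = c
      · obtain ⟨g, hg, rfl⟩ := hV'
        rw [mul_smul]
        exact isBoundedAt_smul_of_invariant (hDinv g hg) hbV
      · push Not at hV'
        refine isBoundedAt_sub (isBoundedAt_sum fun μ _ => ?_) (hT'.isBoundedAt hQ hLG' hc hne)
        rw [isBoundedAt_comp_smul]
        refine hT.isBoundedAt hN hKG' (isCusp_smul_of_mem_scaledGamma0 (hrep _) hc)
          fun g hg h => ?_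
        have hmem {x : GL (Fin 2) ℝ} (hx : x ∈ G₀) : (V * upperUni μ * V⁻¹)⁻¹ * x ∈ G' :=
          mul_mem (inv_mem (hLG' (hrep μ))) (hG₀G' hx)
        -- G is made of G₀ and G₀V(p,0;0,1), so a pole of a translate is G'-equivalent to ∞ or to
        -- V(p,0;0,1)∞ = V∞; both are excluded here.
        rcases hG g hg with h' | h'
        · exact hne _ (hmem h') (by rw [mul_smul, h, inv_smul_smul])
        · refine hV' _ (hmem h') ?_
          rw [mul_smul, ← hWV, smul_smul, mul_assoc, inv_mul_cancel_right, mul_smul, h,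
            inv_smul_smul]
  refine ⟨C, fun τ => ?_⟩
  rw [← hsum, ← hC (V • τ)]

namespace NHSymbol

variable {Γ : NHSymbol}

/-! ### Comparison of fixing groups at different levels -/

lemma IsNHType.conj_mem_scaledGamma0 (hΓ : Γ.IsNHType) {g x : GL (Fin 2) ℝ} (hg : g ∈ Γ.group)
    (hx : x ∈ scaledGamma0 (Γ.n * Γ.h)) : g * x * g⁻¹ ∈ scaledGamma0 (Γ.n * Γ.h) := by
  obtain ⟨e, he, hg⟩ := hΓ.mem_group_iff.mp hg
  obtain ⟨m, hm, -⟩ := hΓ.exists_decomp he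
  exact Moonshine.conj_mem_scaledGamma0 hΓ.h_dvd_24 hΓ.h_pos (hΓ.pos_of_mem he) hm hg hx

/-- The cusp `W_P ∞` is not equivalent to `∞` if all `e` are prime to `P`. -/
lemma IsNHType.smul_infty_ne (hΓ : Γ.IsNHType) {P n' : ℕ} {B D : ℤ} (hn : Γ.n = P * n')
    (hP : 1 < P) (hcop : ∀ e ∈ Γ.E, Nat.Coprime e P)
    (hBD : (P : ℤ) * D - B * (n' * Γ.h) = 1) {W : GL (Fin 2) ℝ}
    (hW : Represents W !![(P : ℝ), (B : ℝ); P * (n' * Γ.h), P * D]) {g : GL (Fin 2) ℝ}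
    (hg : g ∈ Γ.group) : g • (OnePoint.infty : OnePoint ℝ) ≠ W • OnePoint.infty := by
  intro heq
  obtain ⟨e, he, hg⟩ := hΓ.mem_group_iff.mp hg
  obtain ⟨m, hm, -⟩ := hΓ.exists_decomp he
  obtain ⟨a, b, c, d, hdet, hr⟩ := (mem_w_iff hΓ.h_pos (hΓ.pos_of_mem he) hm).mp hg
  have h1 := smul_infty_eq_iff hr hW heq
  have h2 : a * e * (P * (n' * Γ.h)) = (P : ℤ) * (c * Γ.n) := by exact_mod_cast h1
  have hnz : (Γ.n : ℤ) = P * n' := by exact_mod_cast hn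
  have hmz : (Γ.n : ℤ) = Γ.h * e * m := by exact_mod_cast hm
  have hn0 : (Γ.n : ℤ) ≠ 0 := by exact_mod_cast hΓ.n_pos.ne'
  -- P is prime to eh, so this gives P ∣ a, while n = hem gives P ∣ m. Then P divides ade − bcm = 1.
  have h3 : a * (e * Γ.h) = P * c := mul_left_cancel₀ hn0 (by
    linear_combination h2 + (a * e * Γ.h) * hnz)
  have hcPh : IsCoprime (P : ℤ) (Γ.h : ℤ) := ⟨D, -(B * n'), by linear_combination hBD⟩
  have hcPe : IsCoprime (P : ℤ) (e : ℤ) := (Nat.isCoprime_iff_coprime.mpr (hcop e he)).symm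
  have hPa : (P : ℤ) ∣ a := (hcPe.mul_right hcPh).dvd_of_dvd_mul_right ⟨c, h3⟩
  have hPm : (P : ℤ) ∣ m := (hcPh.mul_right hcPe).dvd_of_dvd_mul_left ⟨n', by
    rw [← hmz, hnz]⟩
  have hP1 : (P : ℤ) ∣ 1 := by
    rw [← hdet]
    exact dvd_sub ((hPa.mul_right d).mul_right e) (hPm.mul_left _)
  have : P ∣ 1 := by exact_mod_cast hP1
  exact hP.ne' (Nat.dvd_one.mp this)

lemma lowerUni_mem_scaledGamma0 (n h : ℕ) :
    lowerUni ((h : ℝ) * n) ∈ scaledGamma0 (n * h) :=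
  mem_scaledGamma0_iff.mpr ⟨1, 0, 1, 1, by ring,
    (represents_lowerUni _).congr (by apply of_congr <;> push_cast <;> ring)⟩

/-- The only generator of Δ not at hand is y = (1,0;Δ.n,1). But y^t ∈ A, y^h ∈ Γ₀(Δ.n Δ.h), and t is
prime to h. -/
lemma IsNHType.group_le_sup {A Δ : NHSymbol} (hA : A.IsNHType) (hΔ : Δ.IsNHType)
    (hh : A.h = Δ.h) {t : ℕ} (hn : A.n = Δ.n * t) (hE : Δ.E ⊆ A.E) (hc : Nat.Coprime t Δ.h) :
    Δ.group ≤ A.group ⊔ scaledGamma0 (Δ.n * Δ.h) := by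
  intro g hg
  obtain ⟨e, he, hg⟩ := hΔ.mem_group_iff.mp hg
  obtain ⟨e', -, -, x, -, hx⟩ := hA.exists_atkinLehner (hE he)
  have hxK : x ∈ A.group ⊔ scaledGamma0 (Δ.n * Δ.h) :=
    (le_sup_left : A.group ≤ _) (hA.mem_group_iff.mpr ⟨e, hE he, hx⟩)
  obtain ⟨m, hm, -⟩ := hΔ.exists_decomp he
  rw [hh, hn] at hx
  have hx' := mem_w_of_mul hΔ.h_pos (hΔ.pos_of_mem he) hm hx
  have h1 : g * x ∈ w Δ.n Δ.h 1 := by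
    have := mul_mem_w_star hΔ.h_pos hΔ.div_pos hΔ.n_eq (hΔ.exact e he).1 (hΔ.exact e he).1 hg hx'
    rwa [star_self (hΔ.pos_of_mem he)] at this
  have hY : lowerUni Δ.n ∈ A.group ⊔ scaledGamma0 (Δ.n * Δ.h) := by
    obtain ⟨u, v, huv⟩ := Nat.isCoprime_iff_coprime.mpr hc
    have h2 : lowerUni Δ.n ^ (t : ℤ) ∈ A.group := by
      rw [lowerUni_zpow]
      have := hA.lowerUni_mem_group
      rw [hn] at this
      convert this using 2
      push_cast
      ring
    have h3 : lowerUni Δ.n ^ (Δ.h : ℤ) ∈ scaledGamma0 (Δ.n * Δ.h) := by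
      rw [lowerUni_zpow]
      exact_mod_cast lowerUni_mem_scaledGamma0 Δ.n Δ.h
    rw [← zpow_one (lowerUni Δ.n), ← huv, _root_.zpow_add, mul_comm u, mul_comm v, _root_.zpow_mul, _root_.zpow_mul]
    exact mul_mem (zpow_mem ((le_sup_left : A.group ≤ _) h2) u)
      (zpow_mem ((le_sup_right : scaledGamma0 (Δ.n * Δ.h) ≤ _) h3) v)
  have hX := hA.upperUni_mem_group
  rw [hh] at hX
  have := mem_of_mem_w_one hΔ.h_dvd_24 hΔ.h_pos hΔ.n_eq le_sup_right
    ((le_sup_left : A.group ≤ _) hX) hY h1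
  rwa [Subgroup.mul_mem_cancel_right _ hxK] at this

section Transfer

variable {A Δ : NHSymbol} {t : ℕ} {lam : Γ.group →* rootsOfUnity Γ.h ℂ}
  {mu : Δ.group →* rootsOfUnity Δ.h ℂ}

lemma IsConwayNortonMap.inf_fixingGroup_eq (hA : A.IsNHType) (hΓ : Γ.IsNHType)
    (hΔ : Δ.IsNHType) (hAn : A.n = Γ.n) (hAh : A.h = Γ.h) (hAE : A.E ⊆ Γ.E)
    (hΔh : A.h = Δ.h) (hΔn : A.n = Δ.n * t) (hΔE : A.E ⊆ Δ.E)
    (hcop : ∀ e ∈ A.E, Nat.Coprime e t) (hlam : Γ.IsConwayNortonMap lam)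
    (hmu : Δ.IsConwayNortonMap mu)
    (hy : ((lam ⟨_, hΓ.lowerUni_mem_group⟩ : ℂˣ) : ℂ) =
      ((mu ⟨_, hΔ.lowerUni_mem_group⟩ : ℂˣ) : ℂ) ^ t) :
    A.group ⊓ Γ.fixingGroup lam = A.group ⊓ Δ.fixingGroup mu := by
  have hAΓ : A.group ≤ Γ.group :=
    hA.group_le_of_subset hΓ hAh (t := 1) (by rw [hAn, mul_one]) hAE
  have hAΔ : A.group ≤ Δ.group := hA.group_le_of_subset hΔ hΔh hΔn hΔE
  ext g
  simp only [Subgroup.mem_inf]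
  refine and_congr_right fun hg => ?_
  have h := hlam.agree hA hΓ hΔ hAn hAh hAE hΔh hΔn hΔE hcop hmu hy hg (hAΓ hg) (hAΔ hg)
  rw [mem_fixingGroup, mem_fixingGroup]
  constructor
  · rintro ⟨h1, h2⟩
    refine ⟨hAΔ hg, Subtype.ext ?_⟩
    rw [← h, h2, OneMemClass.coe_one, OneMemClass.coe_one]
  · rintro ⟨h1, h2⟩
    refine ⟨hAΓ hg, Subtype.ext ?_⟩
    rw [h, h2, OneMemClass.coe_one, OneMemClass.coe_one]

/-- A normalizes Γ₀(Δ.n Δ.h), so an element of Δ factors as al with a ∈ A and l ∈ Γ₀(Δ.n Δ.h); as l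
is in the kernel, a is in it together with al. -/
lemma IsConwayNortonMap.fixingGroup_le_sup (hA : A.IsNHType) (hΔ : Δ.IsNHType)
    (hΔh : A.h = Δ.h) (hΔn : A.n = Δ.n * t) (hΔE : A.E = Δ.E) (hc : Nat.Coprime t Δ.h)
    (hmu : Δ.IsConwayNortonMap mu) :
    Δ.fixingGroup mu ≤ A.group ⊓ Δ.fixingGroup mu ⊔ scaledGamma0 (Δ.n * Δ.h) := by
  intro g hg
  have hAΔ : A.group ≤ Δ.group := hA.group_le_of_subset hΔ hΔh hΔn hΔE.le
  have hnorm : A.group ≤ Subgroup.normalizer (scaledGamma0 (Δ.n * Δ.h) : Set (GL (Fin 2) ℝ)) := by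
    intro a ha
    rw [Subgroup.mem_normalizer_iff]
    refine fun x => ⟨fun hx => hΔ.conj_mem_scaledGamma0 (hAΔ ha) hx, fun hx => ?_⟩
    have := hΔ.conj_mem_scaledGamma0 (hAΔ (inv_mem ha)) hx
    rwa [inv_inv, show a⁻¹ * (a * x * a⁻¹) * a = x by group] at this
  have hg' := hA.group_le_sup hΔ hΔh hΔn hΔE.ge hc (fixingGroup_le _ hg)
  rw [← SetLike.mem_coe, Subgroup.coe_mul_of_left_le_normalizer_right _ _ hnorm] at hg'
  obtain ⟨a, ha, l, hl, rfl⟩ := Set.mem_mul.mp hg'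
  have hl' := hmu.scaledGamma0_le hΔ hl
  rw [Subgroup.mul_mem_cancel_right _ hl'] at hg
  exact Subgroup.mul_mem_sup (Subgroup.mem_inf.mpr ⟨ha, hg⟩) hl

end Transfer

lemma IsConwayNortonMap.atkinLehner_mem_fixingGroup {lam : Γ.group →* rootsOfUnity Γ.h ℂ}
    (hlam : Γ.IsConwayNortonMap lam) (hΓ : Γ.IsNHType) {P n' : ℕ} {B D : ℤ}
    (hn : Γ.n = P * n') (hPE : P ∈ Γ.E) (hBD : (P : ℤ) * D - B * (n' * Γ.h) = 1)
    {W : GL (Fin 2) ℝ} (hW : Represents W !![(P : ℝ), (B : ℝ); P * (n' * Γ.h), P * D]) :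
    W ∈ Γ.fixingGroup lam := by
  have hP := hΓ.pos_of_mem hPE
  have hN : Γ.n * Γ.h = P * (n' * Γ.h) := by rw [hn]; ring
  refine mem_fixingGroup.mpr ⟨hΓ.mem_group_iff.mpr ⟨P, hPE, atkinLehner_mem_w hΓ hn hP hBD hW⟩,
    hlam.atkinLehner P ⟨⟨_, hN⟩, ?_⟩ (fun q _ hd => hd.trans (hΓ.exact P hPE).1) _ ?_⟩
  · rw [hN, Nat.mul_div_cancel_left _ hP]
    exact Nat.isCoprime_iff_coprime.mp ⟨D, -B, by push_cast; linear_combination hBD⟩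
  · rw [hN]
    exact atkinLehner_mem_w_level hP (by push_cast; exact hBD) (by push_cast; exact hW)

/-- If `Γ` is generated by `A` and `w_P`, then `Γ_λ` is the union of two cosets of `A ∩ Γ_λ`. -/
lemma IsNHType.mem_inf_or_mul_inv_mem {A : NHSymbol} (hA : A.IsNHType) (hΓ : Γ.IsNHType)
    (hAn : A.n = Γ.n) (hAh : A.h = Γ.h) {P : ℕ} (hPE : P ∈ Γ.E)
    (hE : ∀ e ∈ Γ.E, e ∈ A.E ∨ star e P ∈ A.E) {lam : Γ.group →* rootsOfUnity Γ.h ℂ}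
    {W g : GL (Fin 2) ℝ} (hWw : W ∈ w Γ.n Γ.h P) (hW : W ∈ Γ.fixingGroup lam)
    (hg : g ∈ Γ.fixingGroup lam) :
    g ∈ A.group ⊓ Γ.fixingGroup lam ∨ g * W⁻¹ ∈ A.group ⊓ Γ.fixingGroup lam := by
  obtain ⟨e, he, hge⟩ := hΓ.mem_group_iff.mp (fixingGroup_le _ hg)
  obtain ⟨m, hm, -⟩ := hΓ.exists_decomp hPE
  refine (hE e he).imp (fun h => ⟨hA.mem_group_iff.mpr ⟨e, h, ?_⟩, hg⟩)
    fun h => ⟨hA.mem_group_iff.mpr ⟨_, h, ?_⟩, Subgroup.mul_mem _ hg (Subgroup.inv_mem _ hW)⟩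
  · rwa [hAn, hAh]
  · rw [hAn, hAh]
    exact mul_mem_w_star hΓ.h_pos hΓ.div_pos hΓ.n_eq (hΓ.exact e he).1 (hΓ.exact P hPE).1 hge
      (inv_mem_w hΓ.h_pos (hΓ.pos_of_mem hPE) hm hWw)

/-! ### The symbols `⟨Γ, w_P⟩` and `Γ^p` -/

section Adjoin

variable {P : ℕ}

lemma mem_adjoin_iff (hcop : ∀ e ∈ Γ.E, Nat.Coprime e P) {f : ℕ} :
    f ∈ (Γ.adjoin P).E ↔ f ∈ Γ.E ∨ ∃ e ∈ Γ.E, f = e * P := by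
  simp only [adjoin, Finset.mem_union, Finset.mem_image]
  refine or_congr_right (exists_congr fun e => and_congr_right fun he => ?_)
  rw [star_of_coprime (hcop e he), eq_comm]

lemma star_mul_left {e f l : ℕ} (hl : 0 < l) (he : e ∣ l) (hf : f ∣ l) (hP : Nat.Coprime f P) :
    star (e * P) f = star e f * P := by
  obtain ⟨k, e', f', m, hk, he', hf', rfl, rfl, rfl, hc, hs⟩ := exists_star_decomp hl he hf
  rw [hs, mul_assoc k, star_mul_mul hk (Nat.Coprime.mul_left hc hP.symm.coprime_mul_left_right)]
  ring

lemma star_mul_mul_right {e f l : ℕ} (hl : 0 < l) (he : e ∣ l) (hf : f ∣ l) (hP : 0 < P) :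
    star (e * P) (f * P) = star e f := by
  obtain ⟨k, e', f', m, hk, he', hf', rfl, rfl, rfl, hc, hs⟩ := exists_star_decomp hl he hf
  rw [hs, mul_right_comm k e', mul_right_comm k f', star_mul_mul (by positivity) hc]

lemma _root_.Moonshine.ExactDvd.mul {e l : ℕ} (hl : 0 < l) (he : ExactDvd e l) (hP : ExactDvd P l)
    (hc : Nat.Coprime e P) : ExactDvd (e * P) l := by
  obtain ⟨k, hk⟩ := hc.mul_dvd_of_dvd_of_dvd he.1 hP.1
  have he0 : 0 < e := Nat.pos_of_dvd_of_pos he.1 hl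
  have hP0 : 0 < P := Nat.pos_of_dvd_of_pos hP.1 hl
  have h1 := he.2
  have h2 := hP.2
  rw [hk, mul_assoc, Nat.mul_div_cancel_left _ he0] at h1
  rw [hk, mul_comm e, mul_assoc, Nat.mul_div_cancel_left _ hP0] at h2
  refine ⟨⟨k, hk⟩, ?_⟩
  rw [hk, Nat.mul_div_cancel_left _ (by positivity)]
  exact Nat.Coprime.mul_left h1.coprime_mul_left_right h2.coprime_mul_left_right

lemma IsNHType.adjoin (hΓ : Γ.IsNHType) (hP : ExactDvd P (Γ.n / Γ.h))
    (hcop : ∀ e ∈ Γ.E, Nat.Coprime e P) : (Γ.adjoin P).IsNHType where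
  n_pos := hΓ.n_pos
  h_dvd := hΓ.h_dvd
  one_mem := (mem_adjoin_iff hcop).mpr (Or.inl hΓ.one_mem)
  exact f hf := by
    rcases (mem_adjoin_iff hcop).mp hf with hf | ⟨e, he, rfl⟩
    · exact hΓ.exact f hf
    · exact (hΓ.exact e he).mul hΓ.div_pos hP (hcop e he)
  star_mem := by
    have hP0 := Nat.pos_of_dvd_of_pos hP.1 hΓ.div_pos
    intro e he f hf
    rw [mem_adjoin_iff hcop] at he hf ⊢
    rcases he with he | ⟨e, he, rfl⟩ <;> rcases hf with hf | ⟨f, hf, rfl⟩ <;>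
      have hs := hΓ.star_mem e he f hf <;>
      have he' := (hΓ.exact e he).1 <;> have hf' := (hΓ.exact f hf).1
    · exact Or.inl hs
    · refine Or.inr ⟨_, hs, ?_⟩
      rw [star_comm, star_mul_left hΓ.div_pos hf' he' (hcop e he), star_comm]
    · exact Or.inr ⟨_, hs, star_mul_left hΓ.div_pos he' hf' (hcop f hf)⟩
    · rw [star_mul_mul_right hΓ.div_pos he' hf' hP0]
      exact Or.inl hs

lemma mem_adjoin_self (hΓ : Γ.IsNHType) (hcop : ∀ e ∈ Γ.E, Nat.Coprime e P) :
    P ∈ (Γ.adjoin P).E :=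
  (mem_adjoin_iff hcop).mpr (Or.inr ⟨1, hΓ.one_mem, (one_mul P).symm⟩)

end Adjoin

section Power

variable {p n' : ℕ}

/-- The subgroup of `Γ` of the same level obtained by keeping the `e` prime to `p`. -/
def restrict (Γ : NHSymbol) (p : ℕ) : NHSymbol := ⟨Γ.n, Γ.h, Γ.E.filter fun e => ¬ p ∣ e⟩

lemma not_dvd_star (hp : p.Prime) {e f l : ℕ} (hl : 0 < l) (he : e ∣ l) (hf : f ∣ l)
    (hpe : ¬ p ∣ e) (hpf : ¬ p ∣ f) : ¬ p ∣ star e f := by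
  obtain ⟨k, e', f', m, hk, he', hf', rfl, rfl, rfl, hc, hs⟩ := exists_star_decomp hl he hf
  rw [hs, hp.dvd_mul]
  rintro (h | h)
  · exact hpe (h.mul_left k)
  · exact hpf (h.mul_left k)

lemma IsNHType.restrict (hΓ : Γ.IsNHType) (hp : p.Prime) : (Γ.restrict p).IsNHType where
  n_pos := hΓ.n_pos
  h_dvd := hΓ.h_dvd
  one_mem := Finset.mem_filter.mpr ⟨hΓ.one_mem, hp.not_dvd_one⟩
  exact e he := hΓ.exact e (Finset.mem_filter.mp he).1
  star_mem e he f hf := by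
    obtain ⟨he, hpe⟩ := Finset.mem_filter.mp he
    obtain ⟨hf, hpf⟩ := Finset.mem_filter.mp hf
    exact Finset.mem_filter.mpr ⟨hΓ.star_mem e he f hf,
      not_dvd_star hp hΓ.div_pos (hΓ.exact e he).1 (hΓ.exact f hf).1 hpe hpf⟩

lemma restrict_eq_self (h : ∀ e ∈ Γ.E, ¬ p ∣ e) : Γ.restrict p = Γ := by
  rw [NHSymbol.ext_iff]
  exact ⟨rfl, rfl, Finset.filter_true_of_mem h⟩

lemma _root_.Moonshine.ExactDvd.dvd_iff_not_dvd (hp : p.Prime) {e l : ℕ} (hl : 0 < l) (he : ExactDvd e (l * p)) :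
    e ∣ l ↔ ¬ p ∣ e := by
  constructor
  · rintro ⟨k, rfl⟩ hpe
    have h := he.2
    rw [mul_assoc, Nat.mul_div_cancel_left _ (Nat.pos_of_mul_pos_right hl)] at h
    exact hp.one_lt.ne' (Nat.dvd_one.mp (h.gcd_eq_one ▸ Nat.dvd_gcd hpe (dvd_mul_left p k)))
  · intro h
    exact ((hp.coprime_iff_not_dvd.mpr h).symm).dvd_of_dvd_mul_right he.1

lemma power_h (hp : p.Prime) (hh : ¬ p ∣ Γ.h) : (Γ.power p).h = Γ.h := by
  have : Nat.Coprime Γ.h p := (hp.coprime_iff_not_dvd.mpr hh).symm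
  simp [power, this.gcd_eq_one]

lemma power_n (hp : p.Prime) (hn : Γ.n = n' * p) : (Γ.power p).n = n' := by
  simp [power, hn, hp.pos]

/-- An exact divisor of lp that divides l leaves p in its cofactor and so is prime to p. Hence Γ^p
loses precisely the e divisible by p. -/
lemma IsNHType.power_E (hΓ : Γ.IsNHType) (hp : p.Prime) (hn : Γ.n = n' * p) (hh : ¬ p ∣ Γ.h) :
    (Γ.power p).E = (Γ.restrict p).E := by
  have hc : Nat.Coprime Γ.h p := (hp.coprime_iff_not_dvd.mpr hh).symm
  obtain ⟨l, rfl⟩ : Γ.h ∣ n' := hc.dvd_of_dvd_mul_right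
    (hn ▸ hΓ.h_dvd.trans (Nat.gcd_dvd_left _ _))
  have hl : Γ.n / Γ.h = l * p := by
    rw [hn, mul_assoc, Nat.mul_div_cancel_left _ hΓ.h_pos]
  have hl0 : 0 < l := Nat.pos_of_ne_zero fun h => by
    have := hΓ.div_pos
    simp [hl, h] at this
  refine Finset.filter_congr fun e he => ?_
  rw [hn, Nat.gcd_mul_left_left, Nat.mul_div_cancel _ hp.pos, hc.gcd_eq_one, Nat.div_one,
    Nat.mul_div_cancel_left _ hΓ.h_pos]
  exact (hl ▸ hΓ.exact e he).dvd_iff_not_dvd hp hl0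

lemma IsNHType.power (hΓ : Γ.IsNHType) (hp : p.Prime) (hn : Γ.n = n' * p) (hh : ¬ p ∣ Γ.h) :
    (Γ.power p).IsNHType := by
  have hc : Nat.Coprime Γ.h p := (hp.coprime_iff_not_dvd.mpr hh).symm
  have hhn : Γ.h ∣ n' := hc.dvd_of_dvd_mul_right (hn ▸ hΓ.h_dvd.trans (Nat.gcd_dvd_left _ _))
  obtain ⟨l, hl⟩ := hhn
  have hR := hΓ.restrict hp
  have hE := hΓ.power_E hp hn hh
  have hn0 : 0 < n' := Nat.pos_of_ne_zero fun h => by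
    have := hΓ.n_pos
    simp [hn, h] at this
  refine ⟨by rwa [power_n hp hn], ?_, by rw [hE]; exact hR.one_mem, ?_, by
    rw [hE]; exact hR.star_mem⟩
  · rw [power_n hp hn, power_h hp hh]
    exact Nat.dvd_gcd ⟨l, hl⟩ hΓ.h_dvd_24
  · intro e he
    rw [power_n hp hn, power_h hp hh, hl, Nat.mul_div_cancel_left _ hΓ.h_pos]
    rw [hE] at he
    obtain ⟨he, hpe⟩ := Finset.mem_filter.mp he
    have hex := hΓ.exact e he
    rw [show Γ.n / Γ.h = l * p by rw [hn, hl, mul_assoc, Nat.mul_div_cancel_left _ hΓ.h_pos]] at hex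
    have hl0 : 0 < l := Nat.pos_of_ne_zero fun h => by simp [hl, h] at hn0
    have hel := (hex.dvd_iff_not_dvd hp hl0).mpr hpe
    exact ⟨hel, hex.2.coprime_dvd_right (Nat.div_dvd_div hel (dvd_mul_right _ _))⟩

/-- If `p ∣ e`, then an exact divisor `e` of `p ^ r * l` with `p ∤ l` is divisible by `p ^ r`. -/
lemma _root_.Moonshine.ExactDvd.exists_eq_mul (hp : p.Prime) {r l e : ℕ} (hpl : ¬ p ∣ l)
    (he : ExactDvd e (p ^ r * l)) (hpe : p ∣ e) : ∃ f, e = p ^ r * f ∧ ¬ p ∣ f := by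
  obtain ⟨⟨k, hk⟩, hc⟩ := he
  have hl0 : 0 < l := Nat.pos_of_ne_zero fun h => hpl (h ▸ dvd_zero p)
  have he0 : 0 < e := Nat.pos_of_ne_zero fun h => by
    rw [h, zero_mul] at hk
    exact (Nat.mul_pos (pow_pos hp.pos r) hl0).ne' hk
  rw [hk, Nat.mul_div_cancel_left _ he0] at hc
  have hpk : Nat.Coprime (p ^ r) k := (hc.coprime_dvd_left hpe).pow_left r
  obtain ⟨f, rfl⟩ := hpk.dvd_of_dvd_mul_right ⟨l, hk.symm⟩
  refine ⟨f, rfl, fun hf => hpl ?_⟩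
  rw [mul_assoc] at hk
  rw [Nat.eq_of_mul_eq_mul_left (pow_pos hp.pos r) hk]
  exact hf.mul_right k

end Power

/-! ### Compatibility of eigenvalue maps on the moonshine list -/

/-- The groups on the list with `h > 2`. -/
def shortList : List NHSymbol :=
  [minus 3 3, minus 6 3, plus 8 4, minus 8 4, plus 12 3, minus 12 6, minus 15 3, plus 21 3,
    plus 24 6, plusSome 24 4 {6}, plusSome 24 4 {2}, minus 24 12, plusSome 30 3 {10}, plus 39 3,
    plus 40 4, plusSome 42 3 {7}, plusSome 56 4 {14}, plus 57 3, plusSome 60 6 {10}, plus 84 3,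
    plus 93 3, plus 104 4]

lemma AppearsInMoonshine.mem_shortList (hΓ : Γ.AppearsInMoonshine) (h : 2 < Γ.h) :
    Γ ∈ shortList := by
  have : ∀ Γ ∈ moonshineList, 2 < Γ.h → Γ ∈ shortList := by decide +kernel
  exact this Γ hΓ h

lemma eq_of_subset_of_mem_shortList : ∀ Γ ∈ shortList, ∀ Δ ∈ shortList, Γ.n = Δ.n → Γ.h = Δ.h →
    Γ.E ⊆ Δ.E → Γ = Δ ∨ Γ = minus 8 4 := by
  decide +kernel

/-- This is the finite check behind `power_compat`. The two alternatives in the last hypothesis are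
those of (b) and (d), and the primes are the only ones dividing a level on the short list. -/
lemma power_mem_shortList : ∀ Γ ∈ shortList, ∀ p ∈ [2, 3, 5, 7, 13, 19, 31], p ∣ Γ.n →
    ¬ p ∣ Γ.h → Γ.power p ∈ shortList → (¬ p ^ 2 ∣ Γ.n ∧ ∀ e ∈ Γ.E, ¬ p ∣ e) ∨ p ^ 2 ∈ Γ.E →
    Γ.h ∣ p + 1 ∧ (Γ.n / Γ.h ∈ Γ.E ↔ (Γ.power p).n / (Γ.power p).h ∉ (Γ.power p).E) := by
  decide +kernel

lemma n_dvd_of_mem_shortList : ∀ Γ ∈ shortList, Γ.n ∣ 2 ^ 3 * 3 * 5 * 7 * 13 * 19 * 31 := by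
  decide +kernel

lemma prime_mem_of_dvd {p : ℕ} (hp : p.Prime) (h : p ∣ 2 ^ 3 * 3 * 5 * 7 * 13 * 19 * 31) :
    p ∈ [2, 3, 5, 7, 13, 19, 31] := by
  have h1 : ∀ q : ℕ, q.Prime → p ∣ q → p = q := fun q hq => (Nat.prime_dvd_prime_iff_eq hp hq).mp
  simp only [hp.dvd_mul] at h
  rcases h with (((((h | h) | h) | h) | h) | h) | h
  · simp [h1 2 (by norm_num) (hp.dvd_of_dvd_pow h)]
  all_goals simp [h1 _ (by norm_num) h]

/-- Adjoining w_P may create a Fricke involution and reverse the sign in the rule, which is harmless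
for h ≤ 2. For h > 2 the only group of the list properly contained in another with the same n and h
is 8|4−, and no P > 1 dividing 8 is prime to 4. -/
lemma AppearsInMoonshine.h_le_two {P : ℕ} (hM : Γ.AppearsInMoonshine)
    (hM' : (Γ.adjoin P).AppearsInMoonshine) (hΓ : Γ.IsNHType) (hP : 1 < P) (hPn : P ∣ Γ.n)
    (hPh : Nat.Coprime P Γ.h) (hcop : ∀ e ∈ Γ.E, Nat.Coprime e P) : Γ.h ≤ 2 := by
  by_contra! hh
  rcases eq_of_subset_of_mem_shortList Γ (hM.mem_shortList hh) _ (hM'.mem_shortList hh) rfl rfl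
    Finset.subset_union_left with h | rfl
  · have hPE := mem_adjoin_self hΓ hcop
    rw [← h] at hPE
    exact hP.ne' ((Nat.coprime_self P).mp (hcop P hPE))
  · have h8 : Nat.Coprime P (2 ^ 3) := (Nat.Coprime.coprime_dvd_right (by decide) hPh :
      Nat.Coprime P 2).pow_right 3
    exact hP.ne' (Nat.Coprime.eq_one_of_dvd h8 hPn)

lemma AppearsInMoonshine.power_compat {p : ℕ} (hM : Γ.AppearsInMoonshine)
    (hM' : (Γ.power p).AppearsInMoonshine) (hp : p.Prime) (hpn : p ∣ Γ.n) (hph : ¬ p ∣ Γ.h)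
    (h : (¬ p ^ 2 ∣ Γ.n ∧ ∀ e ∈ Γ.E, ¬ p ∣ e) ∨ p ^ 2 ∈ Γ.E) :
    Γ.h ≤ 2 ∨ Γ.h ∣ p + 1 ∧
      (Γ.n / Γ.h ∈ Γ.E ↔ (Γ.power p).n / (Γ.power p).h ∉ (Γ.power p).E) := by
  by_cases hh : Γ.h ≤ 2
  · exact Or.inl hh
  push Not at hh
  have hΓ := hM.mem_shortList hh
  exact Or.inr (power_mem_shortList Γ hΓ p
    (prime_mem_of_dvd hp (hpn.trans (n_dvd_of_mem_shortList Γ hΓ))) hpn hph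
    (hM'.mem_shortList (by rwa [power_h hp hph])) h)

/-- With z = exp(2πi/h): for h ≤ 2, z = z⁻¹ = z^t because t is prime to h; for h ∣ t + 1, z^t = z⁻¹
and the opposite Fricke signs compensate. -/
lemma IsConwayNortonMap.map_lowerUni_eq_pow {Δ : NHSymbol}
    {lam : Γ.group →* rootsOfUnity Γ.h ℂ} {mu : Δ.group →* rootsOfUnity Δ.h ℂ}
    (hlam : Γ.IsConwayNortonMap lam) (hmu : Δ.IsConwayNortonMap mu) (hΓ : Γ.IsNHType)
    (hΔ : Δ.IsNHType) (hh : Γ.h = Δ.h) {t : ℕ} (hc : Nat.Coprime t Γ.h)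
    (h : Γ.h ≤ 2 ∨ Γ.h ∣ t + 1 ∧ (Γ.n / Γ.h ∈ Γ.E ↔ Δ.n / Δ.h ∉ Δ.E)) :
    ((lam ⟨_, hΓ.lowerUni_mem_group⟩ : ℂˣ) : ℂ) =
      ((mu ⟨_, hΔ.lowerUni_mem_group⟩ : ℂˣ) : ℂ) ^ t := by
  have hh0 := hΓ.h_pos
  rw [hlam.map_lowerUni hΓ, hmu.map_lowerUni hΔ, ← hh]
  have hz := (Complex.isPrimitiveRoot_exp Γ.h hh0.ne').pow_eq_one
  simp only [Complex.exp_neg]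
  set z := Complex.exp (2 * Real.pi * Complex.I / Γ.h) with hzdef
  have hz0 : z ≠ 0 := Complex.exp_ne_zero _
  rcases h with h | ⟨⟨k, hk⟩, h⟩
  · have hz2 : z ^ 2 = 1 := by
      obtain h1 | h1 : Γ.h = 1 ∨ Γ.h = 2 := by omega
      · rw [h1, pow_one] at hz
        rw [hz, one_pow]
      · rwa [h1] at hz
    have hzi : z⁻¹ = z := inv_eq_of_mul_eq_one_left (by rw [← sq, hz2])
    have hzt : z ^ t = z := by
      obtain h1 | h1 : Γ.h = 1 ∨ Γ.h = 2 := by omega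
      · rw [h1, pow_one] at hz
        rw [hz, one_pow]
      · rw [h1, Nat.coprime_two_right] at hc
        obtain ⟨k, rfl⟩ := hc
        rw [pow_add, pow_mul, hz2, one_pow, one_mul, pow_one]
    simp only [hzi, ite_self, hzt]
  · have hzt : z ^ t = z⁻¹ := eq_inv_of_mul_eq_one_left (by
      rw [← pow_succ, hk, pow_mul, hz, one_pow])
    rw [← hh] at h
    by_cases hE : Γ.n / Γ.h ∈ Γ.E
    · rw [if_pos hE, if_neg (h.mp hE), inv_pow, hzt, inv_inv]
    · rw [if_neg hE, if_pos (not_not.mp (mt h.mpr hE)), hzt]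

/-! ### The identities up to constants -/

lemma exactDvd_of_det {P n' : ℕ} {B D : ℤ} (hΓ : Γ.IsNHType) (hn : Γ.n = P * n') (hP : 0 < P)
    (hBD : (P : ℤ) * D - B * (n' * Γ.h) = 1) : ExactDvd P (Γ.n / Γ.h) := by
  obtain ⟨l, hl⟩ := exists_mul_of_det hΓ hn hBD
  have hd : Γ.n / Γ.h = P * l := by
    rw [hn, hl, Nat.div_eq_of_eq_mul_right hΓ.h_pos]; ring
  rw [hd]
  refine ⟨dvd_mul_right _ _, ?_⟩
  rw [Nat.mul_div_cancel_left _ hP]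
  refine Nat.isCoprime_iff_coprime.mp ⟨D, -(B * Γ.h * Γ.h), ?_⟩
  rw [hl] at hBD
  push_cast at hBD
  linear_combination hBD

theorem exists_comp_add_mul_U_eq {p n' : ℕ} {B D : ℤ} {W : GL (Fin 2) ℝ} (hΓ : Γ.IsNHType)
    (hp : p.Prime) (hn : Γ.n = p * n') (hpn : ¬ p ∣ n' * Γ.h) (hE : ∀ e ∈ Γ.E, ¬ p ∣ e)
    (hBD : (p : ℤ) * D - B * (n' * Γ.h) = 1)
    (hW : Represents W !![(p : ℝ), (B : ℝ); p * (n' * Γ.h), p * D])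
    {lam : Γ.group →* rootsOfUnity Γ.h ℂ} (hlam : Γ.IsConwayNortonMap lam) {T : ℍ → ℂ}
    (hT : IsHauptmodul (Γ.fixingGroup lam) T) : ∃ C, ∀ τ, T (W • τ) + p * U p T τ = C := by
  have hcop : ∀ e ∈ Γ.E, Nat.Coprime e p := fun e he =>
    (hp.coprime_iff_not_dvd.mpr (hE e he)).symm
  have hph : ¬ p ∣ Γ.h := fun h => hpn (h.mul_left n')
  have hnp : Γ.n = n' * p := by rw [hn, mul_comm]
  have hΔ := hΓ.power hp hnp hph
  have hN : Γ.n * Γ.h = n' * Γ.h * p := by rw [hn]; ring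
  have hM : 0 < n' * Γ.h := Nat.pos_of_ne_zero fun h => hpn (h ▸ dvd_zero p)
  have hle : Γ.group ≤ (Γ.power p).group := hΓ.group_le_of_subset hΔ (power_h hp hph).symm
    (t := p) (by rw [power_n hp hnp, hnp])
    (by rw [hΓ.power_E hp hnp hph, restrict_eq_self hE])
  refine Moonshine.exists_comp_add_mul_U_eq hp hM hpn (by push_cast; exact hBD)
    (by push_cast; exact hW) (hN ▸ hlam.scaledGamma0_le hΓ)
    (fun g hg => hlam.conj_mem_fixingGroup hΓ hn hp.pos hcop hBD hW hg) (fun g hg x hx => ?_)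
    (fun g hg x hx => ?_)
    (fun g hg => hΓ.smul_infty_ne hn hp.one_lt hcop hBD hW (fixingGroup_le _ hg)) hT
  · rw [← hN] at hx ⊢
    exact hΓ.conj_mem_scaledGamma0 (fixingGroup_le _ hg) hx
  · have := hΔ.conj_mem_scaledGamma0 (x := x) (hle (fixingGroup_le _ hg))
    rw [power_n hp hnp, power_h hp hph] at this
    exact this hx

theorem exists_add_mul_U_comp_sub_eq {p n' : ℕ} {B D : ℤ} {W : GL (Fin 2) ℝ} (hΓ : Γ.IsNHType)
    (hp : p.Prime) (hn : Γ.n = p * n') (hpn : ¬ p ∣ n' * Γ.h) (hE : ∀ e ∈ Γ.E, ¬ p ∣ e)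
    (hBD : (p : ℤ) * D - B * (n' * Γ.h) = 1)
    (hW : Represents W !![(p : ℝ), (B : ℝ); p * (n' * Γ.h), p * D])
    {lam : Γ.group →* rootsOfUnity Γ.h ℂ} (hlam : Γ.IsConwayNortonMap lam) {T : ℍ → ℂ}
    (hT : IsHauptmodul (Γ.fixingGroup lam) T)
    {mu : (Γ.power p).group →* rootsOfUnity (Γ.power p).h ℂ}
    (hmu : (Γ.power p).IsConwayNortonMap mu) {T' : ℍ → ℂ}
    (hT' : IsHauptmodul ((Γ.power p).fixingGroup mu) T')
    (hcompat : Γ.h ≤ 2 ∨ Γ.h ∣ p + 1 ∧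
      (Γ.n / Γ.h ∈ Γ.E ↔ (Γ.power p).n / (Γ.power p).h ∉ (Γ.power p).E)) :
    ∃ C, ∀ τ, T τ + p * U p (fun τ => T (W • τ)) τ - T' τ = C := by
  have hcop : ∀ e ∈ Γ.E, Nat.Coprime e p := fun e he =>
    (hp.coprime_iff_not_dvd.mpr (hE e he)).symm
  have hph : ¬ p ∣ Γ.h := fun h => hpn (h.mul_left n')
  have hnp : Γ.n = n' * p := by rw [hn, mul_comm]
  have hΔ := hΓ.power hp hnp hph
  have hN : Γ.n * Γ.h = n' * Γ.h * p := by rw [hn]; ring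
  have hN' : (Γ.power p).n * (Γ.power p).h = n' * Γ.h := by rw [power_n hp hnp, power_h hp hph]
  have hM : 0 < n' * Γ.h := Nat.pos_of_ne_zero fun h => hpn (h ▸ dvd_zero p)
  have hΔn : Γ.n = (Γ.power p).n * p := by rw [power_n hp hnp, hnp]
  have hΔh : Γ.h = (Γ.power p).h := (power_h hp hph).symm
  have hΔE : Γ.E = (Γ.power p).E := by rw [hΓ.power_E hp hnp hph, restrict_eq_self hE]
  have hle : Γ.group ≤ (Γ.power p).group := hΓ.group_le_of_subset hΔ hΔh hΔn hΔE.le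
  have hc : Nat.Coprime p Γ.h := hp.coprime_iff_not_dvd.mpr hph
  have hinf := hlam.inf_fixingGroup_eq hΓ hΓ hΔ rfl rfl subset_rfl hΔh hΔn hΔE.le hcop hmu
    (hlam.map_lowerUni_eq_pow hmu hΓ hΔ hΔh hc hcompat)
  rw [inf_eq_right.mpr (fixingGroup_le lam)] at hinf
  have hsup := hmu.fixingGroup_le_sup hΓ hΔ hΔh hΔn hΔE (hΔh ▸ hc)
  rw [← hinf, hN'] at hsup
  refine Moonshine.exists_add_mul_U_comp_sub_eq hp hM hpn (by push_cast; exact hBD)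
    (by push_cast; exact hW) (hN ▸ hlam.scaledGamma0_le hΓ) (fun g hg x hx => ?_)
    (fun g hg x hx => ?_)
    (fun g hg => hΓ.smul_infty_ne hn hp.one_lt hcop hBD hW (fixingGroup_le _ hg))
    (hinf ▸ inf_le_right) (hN' ▸ hmu.scaledGamma0_le hΔ) hsup hT hT'
  · rw [← hN] at hx ⊢
    exact hΓ.conj_mem_scaledGamma0 (fixingGroup_le _ hg) hx
  · rw [← hN'] at hx ⊢
    exact hΔ.conj_mem_scaledGamma0 (hle (fixingGroup_le _ hg)) hx

theorem exists_add_comp_sub_eq {P n' : ℕ} {B D : ℤ} {W : GL (Fin 2) ℝ} (hΓ : Γ.IsNHType)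
    (hP : 1 < P) (hn : Γ.n = P * n') (hcop : ∀ e ∈ Γ.E, Nat.Coprime e P) (hh : Γ.h ≤ 2)
    (hBD : (P : ℤ) * D - B * (n' * Γ.h) = 1)
    (hW : Represents W !![(P : ℝ), (B : ℝ); P * (n' * Γ.h), P * D])
    {lam : Γ.group →* rootsOfUnity Γ.h ℂ} (hlam : Γ.IsConwayNortonMap lam) {T : ℍ → ℂ}
    (hT : IsHauptmodul (Γ.fixingGroup lam) T)
    {mu : (Γ.adjoin P).group →* rootsOfUnity (Γ.adjoin P).h ℂ}
    (hmu : (Γ.adjoin P).IsConwayNortonMap mu) {T' : ℍ → ℂ}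
    (hT' : IsHauptmodul ((Γ.adjoin P).fixingGroup mu) T') :
    ∃ C, ∀ τ, T τ + T (W • τ) - T' τ = C := by
  have hP0 : 0 < P := by omega
  have hΔ := hΓ.adjoin (exactDvd_of_det hΓ hn hP0 hBD) hcop
  have hN : Γ.n * Γ.h = P * (n' * Γ.h) := by rw [hn]; ring
  have hM : 0 < n' * Γ.h := Nat.pos_of_ne_zero fun h => by
    have := Nat.mul_pos hΓ.n_pos hΓ.h_pos
    simp [hN, h] at this
  have hPE := mem_adjoin_self hΓ hcop
  have hWw : W ∈ w (Γ.adjoin P).n (Γ.adjoin P).h P := atkinLehner_mem_w hΓ hn hP0 hBD hW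
  have hWfix : W ∈ (Γ.adjoin P).fixingGroup mu :=
    hmu.atkinLehner_mem_fixingGroup hΔ (n' := n') hn hPE hBD hW
  have hsub : Γ.E ⊆ (Γ.adjoin P).E := Finset.subset_union_left
  have hinf := hlam.inf_fixingGroup_eq (t := 1) hΓ hΓ hΔ rfl rfl subset_rfl rfl (mul_one _).symm
    hsub (fun e _ => Nat.coprime_one_right e) hmu
    (hlam.map_lowerUni_eq_pow hmu hΓ hΔ rfl (Nat.coprime_one_left _) (Or.inl hh))
  rw [inf_eq_right.mpr (fixingGroup_le lam)] at hinf
  refine Moonshine.exists_add_comp_sub_eq hP0 hM (by push_cast; exact hBD)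
    (by push_cast; exact hW) (hN ▸ hlam.scaledGamma0_le hΓ)
    (fun g hg => (hlam.conj_mem_fixingGroup hΓ hn hP0 hcop hBD hW hg).1)
    (fun g hg => hΓ.smul_infty_ne hn hP hcop hBD hW (fixingGroup_le _ hg))
    (hinf ▸ inf_le_right) hWfix (fun g hg => ?_) hT hT'
  rw [hinf]
  refine hΓ.mem_inf_or_mul_inv_mem hΔ rfl rfl hPE (fun e he => ?_) hWw hWfix hg
  rcases (mem_adjoin_iff hcop).mp he with he | ⟨f, hf, rfl⟩
  · exact Or.inl he
  · right
    have := star_mul_mul (e := f) (f := 1) hP0 (by simp)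
    rw [mul_one, mul_one, mul_comm] at this
    rwa [this]

/-- If every `e` is prime to `p` or divisible by `p ^ 2`, then `∞` is not equivalent to the cusps
`V (1, μ; 0, 1) V⁻¹ ∞` with `0 < μ < p`. -/
lemma IsNHType.smul_infty_ne_conj_upperUni (hΓ : Γ.IsNHType) {p P n : ℕ} {B D : ℤ} (hp : p.Prime)
    (hn : Γ.n = P * p * n) (hpP : p ∣ P) (hpn : ¬ p ∣ n * Γ.h)
    (hE : ∀ e ∈ Γ.E, p ∣ e → p ^ 2 ∣ e) (hBD : (P : ℤ) * D - B * (n * Γ.h : ℕ) = 1)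
    {V : GL (Fin 2) ℝ}
    (hV : Represents V !![(P : ℝ), (B : ℝ); P * (n * Γ.h : ℕ), P * D]) {μ : ℕ} (hμ : 0 < μ)
    (hμp : μ < p) {g : GL (Fin 2) ℝ} (hg : g ∈ Γ.group) :
    g • (OnePoint.infty : OnePoint ℝ) ≠ (V * upperUni μ * V⁻¹) • OnePoint.infty := by
  intro heq
  have hpp := Nat.prime_iff_prime_int.mp hp
  have hP : 0 < P := Nat.pos_of_ne_zero fun h => by
    have := hΓ.n_pos
    simp [hn, h] at this
  obtain ⟨e, he, hg⟩ := hΓ.mem_group_iff.mp hg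
  obtain ⟨m, hm, -⟩ := hΓ.exists_decomp he
  obtain ⟨a, b, c, d, hdet, hr⟩ := (mem_w_iff hΓ.h_pos (hΓ.pos_of_mem he) hm).mp hg
  have hr' := represents_conj_upperUni hP hBD hV μ
  rw [Int.cast_natCast] at hr'
  have h1 := smul_infty_eq_iff hr hr' heq
  have h2 : a * e * (-(μ * (n * Γ.h : ℕ)) * (P * (n * Γ.h : ℕ) : ℕ)) =
      (1 - μ * (P * (n * Γ.h : ℕ))) * (c * (Γ.n : ℤ)) := by exact_mod_cast h1
  have hnz : (Γ.n : ℤ) = P * p * n := by exact_mod_cast hn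
  have hmz : (Γ.n : ℤ) = Γ.h * e * m := by exact_mod_cast hm
  have hn0 : (P : ℤ) * n ≠ 0 := by
    intro h
    have : (Γ.n : ℤ) = 0 := by rw [hnz]; linear_combination p * h
    exact hΓ.n_pos.ne' (by exact_mod_cast this)
  have h3 : a * e * -(μ * ((n * Γ.h : ℕ) : ℤ) * Γ.h) =
      p * ((1 - μ * (P * (n * Γ.h : ℕ))) * c) := mul_left_cancel₀ hn0 (by
    rw [hnz] at h2
    push_cast at h2 ⊢
    linear_combination h2)
  have hpM : ¬ (p : ℤ) ∣ ((n * Γ.h : ℕ) : ℤ) := by exact_mod_cast hpn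
  have hph : ¬ (p : ℤ) ∣ Γ.h := fun h => hpn ((Int.natCast_dvd_natCast.mp h).mul_left n)
  have hpμ : ¬ (p : ℤ) ∣ μ := fun h =>
    absurd (Nat.le_of_dvd hμ (Int.natCast_dvd_natCast.mp h)) (by omega)
  have hpX : ¬ (p : ℤ) ∣ -(μ * ((n * Γ.h : ℕ) : ℤ) * Γ.h) := by
    rw [dvd_neg]
    intro h
    rcases hpp.dvd_or_dvd h with h | h
    · exact (hpp.dvd_or_dvd h).elim hpμ hpM
    · exact hph h
  have hpY : ¬ (p : ℤ) ∣ 1 - μ * (P * (n * Γ.h : ℕ)) := fun h => by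
    have hP' : (p : ℤ) ∣ μ * (P * (n * Γ.h : ℕ)) :=
      ((Int.natCast_dvd_natCast.mpr hpP).mul_right _).mul_left _
    exact hpp.not_dvd_one (by simpa using dvd_add h hP')
  have hcontra : ¬ ((p : ℤ) ∣ a * d * e ∧ (p : ℤ) ∣ b * c * m) := fun h =>
    hpp.not_dvd_one (hdet ▸ dvd_sub h.1 h.2)
  -- In `h3` the cofactors of ae and of pc are prime to p. If p ∣ e then p² ∣ e forces p ∣ c;
  -- otherwise p ∣ a and p ∣ m. Either way p divides ade − bcm = 1.
  by_cases hpe : p ∣ e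
  · obtain ⟨k, hk⟩ := hE e he hpe
    have hkz : (e : ℤ) = p ^ 2 * k := by exact_mod_cast hk
    have hp0 : (p : ℤ) ≠ 0 := hpp.ne_zero
    have h4 : (1 - μ * (P * (n * Γ.h : ℕ))) * c =
        p * (a * k * -(μ * ((n * Γ.h : ℕ) : ℤ) * Γ.h)) := mul_left_cancel₀ hp0 (by
      rw [← h3, hkz]; ring)
    have hpc : (p : ℤ) ∣ c := (hpp.dvd_or_dvd ⟨_, h4⟩).resolve_left hpY
    exact hcontra ⟨(Int.natCast_dvd_natCast.mpr hpe).mul_left _, (hpc.mul_left b).mul_right m⟩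
  · have hpe' : ¬ (p : ℤ) ∣ e := by exact_mod_cast hpe
    have hpa : (p : ℤ) ∣ a := ((hpp.dvd_or_dvd ((hpp.dvd_or_dvd ⟨_, h3⟩).resolve_right hpX))
      ).resolve_right hpe'
    have hpm : (p : ℤ) ∣ m := by
      have : (p : ℤ) ∣ Γ.h * e * m := ⟨P * n, by rw [← hmz, hnz]; ring⟩
      refine (hpp.dvd_or_dvd this).resolve_left fun h => ?_
      exact (hpp.dvd_or_dvd h).elim hph hpe'
    exact hcontra ⟨(hpa.mul_right d).mul_right e, hpm.mul_left _⟩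

theorem exists_mul_U_sub_comp_eq {p s n : ℕ} {B D : ℤ} {V : GL (Fin 2) ℝ} (hΓ : Γ.IsNHType)
    (hp : p.Prime) (hs : 0 < s) (hn : Γ.n = p ^ (s + 1) * n) (hpn : ¬ p ∣ n * Γ.h)
    (hPE : p ^ (s + 1) ∈ Γ.E) (hBD : ((p ^ s : ℕ) : ℤ) * (p * D) - B * (n * Γ.h) = 1)
    (hV : Represents V !![((p ^ s : ℕ) : ℝ), (B : ℝ); ((p ^ s : ℕ) : ℝ) * (n * Γ.h),
      ((p ^ s : ℕ) : ℝ) * ((p * D : ℤ) : ℝ)])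
    {lam : Γ.group →* rootsOfUnity Γ.h ℂ} (hlam : Γ.IsConwayNortonMap lam) {T : ℍ → ℂ}
    (hT : IsHauptmodul (Γ.fixingGroup lam) T)
    {mu : (Γ.power p).group →* rootsOfUnity (Γ.power p).h ℂ}
    (hmu : (Γ.power p).IsConwayNortonMap mu) {T' : ℍ → ℂ}
    (hT' : IsHauptmodul ((Γ.power p).fixingGroup mu) T')
    (hcompat : Γ.h ≤ 2 ∨ Γ.h ∣ p + 1 ∧
      (Γ.n / Γ.h ∈ Γ.E ↔ (Γ.power p).n / (Γ.power p).h ∉ (Γ.power p).E)) :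
    ∃ C, ∀ τ, p * U p T τ - T' (V • τ) = C := by
  have hph : ¬ p ∣ Γ.h := fun h => hpn (h.mul_left n)
  have hc : Nat.Coprime p Γ.h := hp.coprime_iff_not_dvd.mpr hph
  have hpP : p ∣ p ^ s := dvd_pow_self p hs.ne'
  have hp' : (p : ℝ) ≠ 0 := by exact_mod_cast hp.ne_zero
  have hdiv : ∀ e ∈ Γ.E, p ∣ e → ∃ f, e = p ^ (s + 1) * f ∧ ¬ p ∣ f := fun e he hpe => by
    have hd : Nat.Coprime Γ.h (p ^ (s + 1)) := hc.symm.pow_right _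
    obtain ⟨l, rfl⟩ : Γ.h ∣ n := hd.dvd_of_dvd_mul_left
      (hn ▸ hΓ.h_dvd.trans (Nat.gcd_dvd_left _ _))
    have hex := hΓ.exact e he
    rw [hn, mul_left_comm, Nat.mul_div_cancel_left _ hΓ.h_pos] at hex
    exact hex.exists_eq_mul hp (fun h => hpn ((h.mul_left _).mul_right _)) hpe
  obtain ⟨P, hP⟩ : ∃ P, P = p ^ s := ⟨_, rfl⟩
  rw [← hP] at hBD hV hpP
  have hP0 : 0 < P := hP ▸ pow_pos hp.pos s
  have hP1 : 1 < P := hp.one_lt.trans_le (Nat.le_of_dvd hP0 hpP)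
  have hQ : p ^ (s + 1) = P * p := by rw [hP, pow_succ]
  rw [hQ] at hn hPE hdiv
  have hnp : Γ.n = P * n * p := by rw [hn]; ring
  have hM : 0 < n * Γ.h := Nat.pos_of_ne_zero fun h => hpn (h ▸ dvd_zero p)
  have hA := hΓ.restrict hp
  have hΔ := hΓ.power hp hnp hph
  have hN : Γ.n * Γ.h = P * (n * Γ.h) * p := by rw [hn]; ring
  have hN' : (Γ.power p).n * (Γ.power p).h = P * (n * Γ.h) := by
    rw [power_n hp hnp, power_h hp hph, mul_assoc]
  have hΔn : (Γ.restrict p).n = (Γ.power p).n * p := by rw [power_n hp hnp, ← hnp]; rfl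
  have hΔh : (Γ.restrict p).h = (Γ.power p).h := (power_h hp hph).symm
  have hΔE : (Γ.restrict p).E = (Γ.power p).E := (hΓ.power_E hp hnp hph).symm
  have hcopA : ∀ e ∈ (Γ.restrict p).E, Nat.Coprime e p := fun e he =>
    (hp.coprime_iff_not_dvd.mpr (Finset.mem_filter.mp he).2).symm
  have hle : (Γ.restrict p).group ≤ (Γ.power p).group :=
    hA.group_le_of_subset hΔ hΔh hΔn hΔE.le
  have hinf := hlam.inf_fixingGroup_eq hA hΓ hΔ rfl rfl (Finset.filter_subset _ _) hΔh hΔn hΔE.le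
    hcopA hmu (hlam.map_lowerUni_eq_pow hmu hΓ hΔ hΔh hc hcompat)
  have hsup := hmu.fixingGroup_le_sup hA hΔ hΔh hΔn hΔE (hΔh ▸ hc)
  rw [← hinf, hN'] at hsup
  -- The factor p in the entry pD of V makes V(p,0;0,1) an Atkin–Lehner matrix for Pp with the same
  -- B and D.
  have hBD' : ((P * p : ℕ) : ℤ) * D - B * (n * Γ.h) = 1 := by
    push_cast; linear_combination hBD
  have hW : Represents (V * diagMat hp.pos) !![((P * p : ℕ) : ℝ), (B : ℝ);
      ((P * p : ℕ) : ℝ) * (n * Γ.h), ((P * p : ℕ) : ℝ) * D] := by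
    refine (hV.mul_of (represents_diagMat hp.pos)).congr ?_
    apply of_congr <;> push_cast <;> ring
  have hWw := atkinLehner_mem_w hΓ hn (Nat.mul_pos hP0 hp.pos) hBD' hW
  have hWfix := hlam.atkinLehner_mem_fixingGroup hΓ hn hPE hBD' hW
  refine Moonshine.exists_mul_U_sub_comp_eq (G₀ := (Γ.restrict p).group ⊓ Γ.fixingGroup lam) hp
    hP0 hM hpP hpn (by push_cast; exact hBD) (by rw [Nat.cast_mul]; exact hV)
    (hN ▸ le_inf hA.scaledGamma0_le_group (hlam.scaledGamma0_le hΓ))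
    inf_le_right (hinf ▸ inf_le_right) (hN' ▸ hmu.scaledGamma0_le hΔ) hsup (fun g hg x hx => ?_)
    (fun g hg x hx => ?_) hWfix (fun g hg => hA.mem_inf_or_mul_inv_mem hΓ rfl rfl hPE
      (fun e he => ?_) hWw hWfix hg) (fun g hg => ?_) (fun μ hμ hμp g hg => ?_) hT hT'
  · rw [← hN] at hx ⊢
    exact hΓ.conj_mem_scaledGamma0 (fixingGroup_le _ (Subgroup.mem_inf.mp hg).2) hx
  · rw [← hN'] at hx ⊢
    exact hΔ.conj_mem_scaledGamma0 (hle (Subgroup.mem_inf.mp hg).1) hx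
  · by_cases hpe : p ∣ e
    · right
      obtain ⟨f, rfl, hpf⟩ := hdiv e he hpe
      have hs := hΓ.star_mem _ he _ hPE
      have := star_mul_mul (e := f) (f := 1) (Nat.mul_pos hP0 hp.pos) (by simp)
      rw [mul_one, mul_one] at this
      rw [this] at hs ⊢
      exact Finset.mem_filter.mpr ⟨hs, hpf⟩
    · exact Or.inl (Finset.mem_filter.mpr ⟨he, hpe⟩)
  · refine hΔ.smul_infty_ne (P := P) (n' := n) (B := B) (D := p * D) (power_n hp hnp) hP1
      (fun e he => ?_) ?_ ?_ (fixingGroup_le _ hg)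
    · rw [hP]
      exact (hcopA e (hΔE ▸ he)).pow_right s
    · rw [power_h hp hph]; exact hBD
    · rw [power_h hp hph]; exact hV
  · refine hΓ.smul_infty_ne_conj_upperUni (D := p * D) hp hn hpP hpn (fun e he hpe => ?_)
      (by push_cast; exact hBD) (by rw [Nat.cast_mul]; exact hV) hμ hμp (fixingGroup_le _ hg)
    obtain ⟨f, rfl, -⟩ := hdiv e he hpe
    rw [sq]
    exact (mul_dvd_mul_right hpP p).mul_right f

end NHSymbol

/-! ### Combining the relations and removing the constants -/

lemma mul_U_const_sub {p : ℕ} (hp : 0 < p) (C : ℂ) (f : ℍ → ℂ) (τ : ℍ) :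
    (p : ℂ) * U p (fun τ => C - p * f τ) τ = p * C - p ^ 2 * U p f τ := by
  rw [sq, mul_assoc (p : ℂ) p, mul_U_apply hp, mul_U_apply hp, Finset.sum_sub_distrib,
    Finset.mul_sum]
  simp

lemma tendsto_sq_mul_U_U {p : ℕ} (hp : 1 < p) {G : Subgroup (GL (Fin 2) ℝ)} {T : ℍ → ℂ}
    (hT : IsHauptmodul G T) :
    Tendsto (fun τ => (p : ℂ) ^ 2 * U p (U p T) τ) atImInfty (𝓝 0) := by
  have hp0 : 0 < p := by omega
  refine (tendsto_mul_U hp0 (hT.tendsto_mul_U hp)).congr fun τ => ?_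
  rw [sq, mul_assoc (p : ℂ) p, mul_U_apply hp0, mul_U_apply hp0, Finset.mul_sum]

lemma exists_mul_sub_mul_eq_one {P M : ℕ} (h : Nat.Coprime P M) :
    ∃ B D : ℤ, (P : ℤ) * D - B * M = 1 := by
  obtain ⟨u, v, huv⟩ := Nat.isCoprime_iff_coprime.mpr h
  exact ⟨-v, u, by linear_combination huv⟩

lemma exists_represents_atkinLehner {P : ℕ} (hP : 0 < P) {n h : ℕ} {B D : ℤ}
    (hBD : (P : ℤ) * D - B * (n * h) = 1) :
    ∃ W : GL (Fin 2) ℝ, Represents W !![(P : ℝ), (B : ℝ); P * (n * h), P * (D : ℝ)] := by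
  have hr : (P : ℝ) * D - B * (n * h) = 1 := by exact_mod_cast hBD
  refine ⟨gl P B (P * (n * h)) (P * D) ?_, represents_gl _⟩
  rw [show (P : ℝ) * (P * D) - B * (P * (n * h)) = P * (P * D - B * (n * h)) by ring, hr, mul_one]
  positivity

namespace NHSymbol

variable {Γ : NHSymbol} {p n : ℕ} {T T' T'' : ℍ → ℂ}

theorem mul_U_eq_sub_adjoin (hp : p.Prime) (hpn : ¬ p ∣ n * Γ.h) (hΓ : Γ.IsNHType)
    (hn : Γ.n = p * n) (hM : Γ.AppearsInMoonshine) (hT : Γ.IsHauptmodulOf T)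
    (hE : ∀ e ∈ Γ.E, ¬ p ∣ e) (hM' : (Γ.adjoin p).AppearsInMoonshine)
    (hT' : (Γ.adjoin p).IsHauptmodulOf T') (τ : ℍ) : (p : ℂ) * U p T τ = T τ - T' τ := by
  obtain ⟨lam, hlam, hT⟩ := hT
  obtain ⟨mu, hmu, hT'⟩ := hT'
  have hcop : ∀ e ∈ Γ.E, Nat.Coprime e p := fun e he =>
    (hp.coprime_iff_not_dvd.mpr (hE e he)).symm
  have hc := hp.coprime_iff_not_dvd.mpr hpn
  obtain ⟨B, D, hBD⟩ := exists_mul_sub_mul_eq_one hc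
  push_cast at hBD
  obtain ⟨W, hW⟩ := exists_represents_atkinLehner hp.pos hBD
  have hh := hM.h_le_two hM' hΓ hp.one_lt ⟨n, hn⟩ (hc.coprime_dvd_right (dvd_mul_left _ _)) hcop
  obtain ⟨C, hC⟩ := exists_comp_add_mul_U_eq hΓ hp hn hpn hE hBD hW hlam hT
  obtain ⟨C', hC'⟩ := exists_add_comp_sub_eq hΓ hp.one_lt hn hcop hh hBD hW hlam hT hmu hT'
  have := eq_zero_of_const (F := fun τ => p * U p T τ - (T τ - T' τ))
    ⟨C - C', fun τ => by linear_combination hC τ - hC' τ⟩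
    (by simpa using (hT.tendsto_mul_U hp.one_lt).sub (hT.tendsto_sub hT')) τ
  exact sub_eq_zero.mp this

theorem sq_mul_U_U_eq_sub_power (hp : p.Prime) (hpn : ¬ p ∣ n * Γ.h) (hΓ : Γ.IsNHType)
    (hn : Γ.n = p * n) (hM : Γ.AppearsInMoonshine) (hT : Γ.IsHauptmodulOf T)
    (hE : ∀ e ∈ Γ.E, ¬ p ∣ e) (hM' : (Γ.power p).AppearsInMoonshine)
    (hT' : (Γ.power p).IsHauptmodulOf T') (τ : ℍ) :
    (p : ℂ) ^ 2 * U p (U p T) τ = T τ - T' τ := by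
  obtain ⟨lam, hlam, hT⟩ := hT
  obtain ⟨mu, hmu, hT'⟩ := hT'
  have hph : ¬ p ∣ Γ.h := fun h => hpn (h.mul_left n)
  have hp2 : ¬ p ^ 2 ∣ Γ.n := fun h => by
    rw [hn, sq] at h
    exact hpn ((Nat.dvd_of_mul_dvd_mul_left hp.pos h).mul_right _)
  obtain ⟨B, D, hBD⟩ := exists_mul_sub_mul_eq_one (hp.coprime_iff_not_dvd.mpr hpn)
  push_cast at hBD
  obtain ⟨W, hW⟩ := exists_represents_atkinLehner hp.pos hBD
  obtain ⟨C, hC⟩ := exists_comp_add_mul_U_eq hΓ hp hn hpn hE hBD hW hlam hT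
  obtain ⟨C', hC'⟩ := exists_add_mul_U_comp_sub_eq hΓ hp hn hpn hE hBD hW hlam hT hmu hT'
    (hM.power_compat hM' hp ⟨n, hn⟩ hph (Or.inl ⟨hp2, hE⟩))
  -- Substituting this in the trace of T turns p(T∘W)|U_p into a constant minus p²T|U_p².
  have hTW : (fun τ => T (W • τ)) = fun τ => C - p * U p T τ :=
    funext fun τ => eq_sub_of_add_eq (hC τ)
  simp only [hTW, mul_U_const_sub hp.pos] at hC'
  have := eq_zero_of_const (F := fun τ => (p : ℂ) ^ 2 * U p (U p T) τ - (T τ - T' τ))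
    ⟨p * C - C', fun τ => by linear_combination - hC' τ⟩
    (by simpa using (tendsto_sq_mul_U_U hp.one_lt hT).sub (hT.tendsto_sub hT')) τ
  exact sub_eq_zero.mp this

theorem mul_U_eq_adjoin_sub_power {s : ℕ} (hp : p.Prime) (hpn : ¬ p ∣ n * Γ.h) (hΓ : Γ.IsNHType)
    (hs : 0 < s) (hn : Γ.n = p ^ (s + 1) * n) (hT : Γ.IsHauptmodulOf T)
    (hPE : p ^ (s + 1) ∈ Γ.E) (hM' : (Γ.power p).AppearsInMoonshine)
    (hM'' : ((Γ.power p).adjoin (p ^ s)).AppearsInMoonshine) (hT' : (Γ.power p).IsHauptmodulOf T')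
    (hT'' : ((Γ.power p).adjoin (p ^ s)).IsHauptmodulOf T'') (τ : ℍ) :
    (p : ℂ) * U p T τ = T'' τ - T' τ := by
  obtain ⟨lam, hlam, hT⟩ := hT
  obtain ⟨mu, hmu, hT'⟩ := hT'
  obtain ⟨nu, hnu, hT''⟩ := hT''
  have hph : ¬ p ∣ Γ.h := fun h => hpn (h.mul_left n)
  have hc := hp.coprime_iff_not_dvd.mpr hpn
  have hP : 1 < p ^ s := Nat.one_lt_pow hs.ne' hp.one_lt
  have hnp : Γ.n = p ^ s * n * p := by rw [hn]; ring
  have hΔ := hΓ.power hp hnp hph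
  have hcop : ∀ e ∈ (Γ.power p).E, Nat.Coprime e (p ^ s) := fun e he => by
    rw [hΓ.power_E hp hnp hph] at he
    exact (hp.coprime_iff_not_dvd.mpr (Finset.mem_filter.mp he).2).symm.pow_right s
  have hcP : Nat.Coprime (p ^ s) (Γ.power p).h := by
    rw [power_h hp hph]
    exact (hp.coprime_iff_not_dvd.mpr hph).pow_left s
  -- The pair Γ^p, ⟨Γ^p, w⟩ already forces h ≤ 2, which also makes Γ and Γ^p compatible.
  have hh := hM'.h_le_two hM'' hΔ hP (by rw [power_n hp hnp]; exact dvd_mul_right _ _) hcP hcop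
  -- Solving the determinant equation for p^(s+1) gives a V of level p^s whose last entry has the
  -- extra factor p.
  obtain ⟨B, D, hBD⟩ := exists_mul_sub_mul_eq_one (hc.pow_left (s + 1))
  have hBD' : ((p ^ s : ℕ) : ℤ) * (p * D) - B * (n * Γ.h) = 1 := by
    push_cast at hBD ⊢
    linear_combination hBD
  obtain ⟨V, hV⟩ := exists_represents_atkinLehner (by omega : 0 < p ^ s) hBD'
  obtain ⟨C, hC⟩ := exists_mul_U_sub_comp_eq hΓ hp hs hn hpn hPE hBD' hV hlam hT hmu hT'
    (Or.inl (by rwa [power_h hp hph] at hh))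
  obtain ⟨C', hC'⟩ := exists_add_comp_sub_eq hΔ hP (power_n hp hnp) hcop hh
    (by rw [power_h hp hph]; exact hBD') (by rw [power_h hp hph]; exact hV) hmu hT' hnu hT''
  have := eq_zero_of_const (F := fun τ => p * U p T τ - (T'' τ - T' τ))
    ⟨C + C', fun τ => by linear_combination hC τ + hC' τ⟩
    (by simpa using (hT.tendsto_mul_U hp.one_lt).sub (hT''.tendsto_sub hT')) τ
  exact sub_eq_zero.mp this

theorem U_eq_neg_U_power (hp : p.Prime) (hpn : ¬ p ∣ n * Γ.h) (hΓ : Γ.IsNHType)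
    (hn : Γ.n = p ^ 2 * n) (hM : Γ.AppearsInMoonshine) (hT : Γ.IsHauptmodulOf T)
    (hPE : p ^ 2 ∈ Γ.E) (hM' : (Γ.power p).AppearsInMoonshine)
    (hT' : (Γ.power p).IsHauptmodulOf T') (τ : ℍ) : U p T τ = -U p T' τ := by
  obtain ⟨lam, hlam, hT⟩ := hT
  obtain ⟨mu, hmu, hT'⟩ := hT'
  have hph : ¬ p ∣ Γ.h := fun h => hpn (h.mul_left n)
  have hc := hp.coprime_iff_not_dvd.mpr hpn
  have hnp : Γ.n = p * n * p := by rw [hn]; ring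
  have hΔ := hΓ.power hp hnp hph
  have hE : ∀ e ∈ (Γ.power p).E, ¬ p ∣ e := fun e he => by
    rw [hΓ.power_E hp hnp hph] at he
    exact (Finset.mem_filter.mp he).2
  obtain ⟨B, D, hBD⟩ := exists_mul_sub_mul_eq_one (hc.pow_left 2)
  have hBD' : (p : ℤ) * (p * D) - B * (n * Γ.h) = 1 := by
    push_cast at hBD ⊢
    linear_combination hBD
  obtain ⟨V, hV⟩ := exists_represents_atkinLehner hp.pos hBD'
  obtain ⟨C, hC⟩ := exists_mul_U_sub_comp_eq (s := 1) hΓ hp one_pos hn hpn hPE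
    (by rw [pow_one]; exact hBD') (by rw [pow_one]; exact hV) hlam hT hmu hT'
    (hM.power_compat hM' hp ⟨_, hnp.trans (mul_comm _ _)⟩ hph (Or.inr hPE))
  -- For r = 2 the matrix V is also a W_p for Γ^p, so T'∘V cancels between the two relations.
  obtain ⟨C', hC'⟩ := exists_comp_add_mul_U_eq hΔ hp (power_n hp hnp)
    (by rwa [power_h hp hph]) hE (by rw [power_h hp hph]; exact hBD')
    (by rw [power_h hp hph]; exact hV) hmu hT'
  have := eq_zero_of_const (F := fun τ => p * U p T τ + p * U p T' τ)
    ⟨C + C', fun τ => by linear_combination hC τ + hC' τ⟩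
    (by simpa using (hT.tendsto_mul_U hp.one_lt).add (hT'.tendsto_mul_U hp.one_lt)) τ
  have hp0 : (p : ℂ) ≠ 0 := by exact_mod_cast hp.ne_zero
  exact mul_left_cancel₀ hp0 (by linear_combination this)

end NHSymbol

end Moonshine

theorem proposition4p3 (p r n h : ℕ) (hp : p.Prime) (hpnh : ¬ p ∣ n * h)
    (Γ : Moonshine.NHSymbol) (hΓ : Γ.IsNHType) (hΓn : Γ.n = p ^ r * n) (hΓh : Γ.h = h)
    (hΓM : Γ.AppearsInMoonshine) (T : UpperHalfPlane → ℂ) (hT : Γ.IsHauptmodulOf T) :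
    -- (a)
    (r = 1 → (∀ e ∈ Γ.E, ¬ p ∣ e) → (Γ.adjoin p).AppearsInMoonshine →
      ∀ T' : UpperHalfPlane → ℂ, (Γ.adjoin p).IsHauptmodulOf T' →
        ∀ τ, (p : ℂ) * Moonshine.U p T τ = T τ - T' τ) ∧
    -- (b)
    (r = 1 → (∀ e ∈ Γ.E, ¬ p ∣ e) → (Γ.power p).AppearsInMoonshine →
      ∀ T' : UpperHalfPlane → ℂ, (Γ.power p).IsHauptmodulOf T' →
        ∀ τ, (p : ℂ) ^ 2 * Moonshine.U p (Moonshine.U p T) τ = T τ - T' τ) ∧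
    -- (c)
    (1 < r → p ^ r ∈ Γ.E → (Γ.power p).AppearsInMoonshine →
      ((Γ.power p).adjoin (p ^ (r - 1))).AppearsInMoonshine →
      ∀ T' T'' : UpperHalfPlane → ℂ, (Γ.power p).IsHauptmodulOf T' →
        ((Γ.power p).adjoin (p ^ (r - 1))).IsHauptmodulOf T'' →
        ∀ τ, (p : ℂ) * Moonshine.U p T τ = T'' τ - T' τ) ∧
    -- (d)
    (r = 2 → p ^ 2 ∈ Γ.E → (Γ.power p).AppearsInMoonshine →
      ∀ T' : UpperHalfPlane → ℂ, (Γ.power p).IsHauptmodulOf T' →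
        ∀ τ, Moonshine.U p T τ = - Moonshine.U p T' τ) := by
  subst hΓh
  refine ⟨?_, ?_, ?_, ?_⟩
  · rintro rfl hE hM' T' hT'
    rw [pow_one] at hΓn
    exact Moonshine.NHSymbol.mul_U_eq_sub_adjoin hp hpnh hΓ hΓn hΓM hT hE hM' hT'
  · rintro rfl hE hM' T' hT'
    rw [pow_one] at hΓn
    exact Moonshine.NHSymbol.sq_mul_U_U_eq_sub_power hp hpnh hΓ hΓn hΓM hT hE hM' hT'
  · intro hr hPE hM' hM'' T' T'' hT' hT''
    obtain ⟨s, rfl⟩ : ∃ s, r = s + 1 := ⟨r - 1, by omega⟩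
    rw [Nat.add_sub_cancel] at hM'' hT''
    exact Moonshine.NHSymbol.mul_U_eq_adjoin_sub_power hp hpnh hΓ (by omega) hΓn hT hPE hM' hM''
      hT' hT''
  · rintro rfl hPE hM' T' hT'
    exact Moonshine.NHSymbol.U_eq_neg_U_power hp hpnh hΓ hΓn hΓM hT hPE hM' hT'
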